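/- Let $\mathbb T_L=\mathbb R/L\mathbb Z$ for $L>0$, and $\mathbb T=\mathbb T_{2\pi}$. All functions are complex-valued, $L^2(\mathbb T_L)$ is taken with respect to the Lebesgue measure $dx$ (total mass $L$), $\|u\|_{H^1}^2=\|u\|_{L^2}^2+\|\partial_xu\|_{L^2}^2$, and $c>0$ denotes the norm of the Sobolev embedding $H^1(\mathbb T)\hookrightarrow L^\infty(\mathbb T)$. Put $p_0(u)=-u+u^3$ and, for $\varepsilon>0$, consider the system $$\partial_t u_1+\partial_x\overline{u_2}=0,\qquad \partial_t u_2+\partial_x\overline{p_0(u_1)}+i\varepsilon\,\partial_x^2u_2=0. \tag{$*$}$$ For every $\lambda\in(0,1/(c\sqrt2)]$ there are $T>0$, $C$ and $\varepsilon_0>0$, depending only on $\lambda$, such that the following holds for every $\varepsilon\in(0,\varepsilon_0)$, every period $L>0$ that is an integer multiple of $2\pi\varepsilon^2$ (so that $2\pi$-periodic functions of $x/\varepsilon^2$ are $L$-periodic; $L=2\pi$ is allowed exactly when $\varepsilon^{-2}\in\mathbb N$), and all $(u_1^0,u_2^0)\in H^1(\mathbb T)\times L^2(\mathbb T)$ with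 $$\int_{\mathbb T}u_1^0\,dx=\int_{\mathbb T}u_2^0\,dx=0,\qquad \max(\|u_1^0\|_{H^1},\|u_2^0\|_{L^2})<\tfrac16,$$ $$\int_{\mathbb T}\Big(\tfrac14\,\mathrm{Re}\,(u_1^0)^4-\tfrac12\,\mathrm{Re}\,(u_1^0)^2+\tfrac12|u_2^0|^2\Big)dx\le0.$$ There is one and only one $u=(u_1,u_2)\in C^0([0,T],H^1(\mathbb T_L)\times L^2(\mathbb T_L))$ that solves $(*)$ on $[0,T]$ in the sense of distributions on $\mathbb T_L$ and satisfies $$u(0,x)=\lambda\big(u_1^0(x/\varepsilon^2),\,u_2^0(x/\varepsilon^2)\big).$$ Moreover the solution is $O(1)$ on $[0,T]$: $\|u_1(t)\|_{L^\infty}\le C$ and $\|u_2(t)\|_{L^2(\mathbb T_L)}\le C\sqrt L$ for all $t\in[0,T]$. -/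

import Mathlib

open MeasureTheory Set
open scoped ContDiff Real ComplexConjugate

noncomputable section

namespace VdW

instance factTwoPiPos : Fact (0 < 2 * π) := ⟨Real.two_pi_pos⟩

/-- The complex Hilbert space `L²(ℝ/Lℤ; ℂ)`, for the Lebesgue measure (of total mass `L`). -/
abbrev L2 (L : ℝ) [Fact (0 < L)] : Type :=
  Lp ℂ 2 (volume : Measure (AddCircle L))

/-- Smooth functions on the circle `ℝ/Lℤ`: the `L`-periodic lift to `ℝ` is `C^∞`. -/
def IsSmooth {L : ℝ} (φ : AddCircle L → ℂ) : Prop :=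
  ContDiff ℝ ∞ (fun s : ℝ => φ (s : AddCircle L))

/-- The (classical) derivative `∂ₓ φ` of a function on the circle. -/
def dx {L : ℝ} (φ : AddCircle L → ℂ) (x : AddCircle L) : ℂ :=
  deriv (fun s : ℝ => φ (x + (s : AddCircle L))) 0

theorem dx_coe {L : ℝ} (φ : AddCircle L → ℂ) (x : ℝ) :
    dx φ (x : AddCircle L) = deriv (fun s : ℝ => φ (s : AddCircle L)) x := by
  have h := deriv_comp_const_add (f := fun s : ℝ => φ (s : AddCircle L)) x 0
  simp only [AddCircle.coe_add, add_zero] at h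
  exact h

theorem IsSmooth.dx {L : ℝ} {φ : AddCircle L → ℂ} (h : IsSmooth φ) : IsSmooth (dx φ) := by
  unfold IsSmooth
  simp only [dx_coe]
  exact (contDiff_infty_iff_deriv.1 h).2

theorem IsSmooth.continuous {L : ℝ} {φ : AddCircle L → ℂ} (h : IsSmooth φ) : Continuous φ :=
  (QuotientAddGroup.isOpenQuotientMap_mk).isQuotientMap.continuous_iff.2 (ContDiff.continuous h)

theorem integrable_mul_of_continuous {L : ℝ} [Fact (0 < L)] (f : L2 L) {φ : AddCircle L → ℂ}
    (h : Continuous φ) : Integrable (fun x => f x * φ x) := by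
  have h2 : MemLp φ 2 (volume : Measure (AddCircle L)) :=
    h.memLp_of_hasCompactSupport (HasCompactSupport.of_compactSpace φ)
  exact (Lp.memLp f).integrable_mul h2

/-- `g` is the weak derivative of `f` on the circle. -/
def HasWeakDeriv {L : ℝ} [Fact (0 < L)] (f g : L2 L) : Prop :=
  ∀ φ : AddCircle L → ℂ, IsSmooth φ → (∫ x, f x * dx φ x) = -(∫ x, g x * φ x)

/-- The Sobolev space `H¹(ℝ/Lℤ; ℂ)`, realised as the graph of the weak derivative in `L² × L²`.
Its norm is `‖u‖² = ‖u‖²_{L²} + ‖∂ₓ u‖²_{L²}`. -/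
def H1 (L : ℝ) [Fact (0 < L)] : Submodule ℂ (WithLp 2 (L2 L × L2 L)) where
  carrier := {p | HasWeakDeriv p.fst p.snd}
  zero_mem' := by
    intro φ hφ
    have h : ∀ ψ : AddCircle L → ℂ, ∫ x, (0 : L2 L) x * ψ x = 0 := fun ψ =>
      integral_eq_zero_of_ae (by
        filter_upwards [Lp.coeFn_zero ℂ 2 (volume : Measure (AddCircle L))] with x hx
        rw [hx, Pi.zero_apply, zero_mul])
    rw [WithLp.zero_fst, WithLp.zero_snd, h, h, neg_zero]
  add_mem' := by
    intro p q hp hq φ hφ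
    have h : ∀ (a b : L2 L) (ψ : AddCircle L → ℂ), Continuous ψ →
        ∫ x, (a + b : L2 L) x * ψ x = (∫ x, a x * ψ x) + ∫ x, b x * ψ x := fun a b ψ hψ => by
      rw [← integral_add (integrable_mul_of_continuous a hψ) (integrable_mul_of_continuous b hψ)]
      refine integral_congr_ae ?_
      filter_upwards [Lp.coeFn_add a b] with x hx
      rw [hx, Pi.add_apply, add_mul]
    rw [WithLp.add_fst, WithLp.add_snd, h _ _ _ hφ.dx.continuous, h _ _ _ hφ.continuous,
      hp φ hφ, hq φ hφ]
    ring
  smul_mem' := by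
    intro c p hp φ hφ
    have h : ∀ (a : L2 L) (ψ : AddCircle L → ℂ),
        ∫ x, (c • a : L2 L) x * ψ x = c * ∫ x, a x * ψ x := fun a ψ => by
      rw [← integral_const_mul]
      refine integral_congr_ae ?_
      filter_upwards [Lp.coeFn_smul c a] with x hx
      rw [hx, Pi.smul_apply, smul_eq_mul, mul_assoc]
    rw [WithLp.smul_fst, WithLp.smul_snd, h, h, hp φ hφ]
    ring

/-- The inclusion of `H¹` into `L²`. -/
def toL2 {L : ℝ} [Fact (0 < L)] (u : H1 L) : L2 L := (u : WithLp 2 (L2 L × L2 L)).fst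

/-- The norm of the Sobolev embedding `H¹(ℝ/Lℤ) ↪ L^∞(ℝ/Lℤ)`. -/
def embeddingNorm (L : ℝ) [Fact (0 < L)] : ℝ :=
  sInf {C : ℝ | 0 ≤ C ∧ ∀ u : H1 L, ∀ᵐ x, ‖toL2 u x‖ ≤ C * ‖u‖}

/-- The pressure law `p₀(u) = -u + u³`. -/
def p0 (z : ℂ) : ℂ := -z + z ^ 3

/-- The modified energy. -/
def energy {L : ℝ} [Fact (0 < L)] (u : H1 L × L2 L) : ℝ :=
  ∫ x, ((1 / 4) * (toL2 u.1 x ^ 4).re - (1 / 2) * (toL2 u.1 x ^ 2).re + (1 / 2) * ‖u.2 x‖ ^ 2)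

/-- `u ∈ C⁰([0,T], H¹ × L²)` solves, in the sense of distributions on the circle,
`∂ₜ u₁ + ∂ₓ ū₂ = 0`, `∂ₜ u₂ + ∂ₓ (conj (p₀ u₁)) + i ε ∂ₓ² u₂ = 0` on `[0,T]`. -/
structure IsSolution {L : ℝ} [Fact (0 < L)] (ε T : ℝ) (u : ℝ → H1 L × L2 L) : Prop where
  continuousOn : ContinuousOn u (Icc 0 T)
  eq_one : ∀ φ : AddCircle L → ℂ, IsSmooth φ → ∀ t ∈ Icc 0 T,
    HasDerivWithinAt (fun s => ∫ x, toL2 (u s).1 x * φ x)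
      (∫ x, conj ((u t).2 x) * dx φ x) (Icc 0 T) t
  eq_two : ∀ φ : AddCircle L → ℂ, IsSmooth φ → ∀ t ∈ Icc 0 T,
    HasDerivWithinAt (fun s => ∫ x, (u s).2 x * φ x)
      ((∫ x, conj (p0 (toL2 (u t).1 x)) * dx φ x)
        - Complex.I * ε * ∫ x, (u t).2 x * dx (dx φ) x) (Icc 0 T) t

/-- `v(x) = a * w(x / ε²)`, for a function `v` on `ℝ/Lℤ` and a function `w` on `ℝ/2πℤ`. -/
def IsRescaled {L : ℝ} [Fact (0 < L)] (a ε : ℝ) (v : L2 L) (w : L2 (2 * π)) : Prop :=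
  ∀ᵐ x : ℝ, v (x : AddCircle L) = (a : ℂ) * w ((x / ε ^ 2 : ℝ) : AddCircle (2 * π))

end VdW

end

/-! ### Calculus of Fourier sequences: products, the cubic form, resonances, the group -/

namespace VdW

noncomputable section

/-! Let `κ = 2π/L`, let `w` be the Fourier coefficients of the conjugate of `u₂`, and `γ` those of
`∂ₓu₁` divided by `iκ`. The system becomes `γ' = -iκ j² w`, `w' = -iκ nl(γ) - iεκ² j² w` (this is
`Modal`). Two changes of unknown remove the unbounded factor `j²`: `α = γ - w/(εκ)` satisfies `α' =
(i/ε) nl(γ)`, and `h = group(-εκ²t) w` satisfies `h' = -iκ group(-εκ²t) nl(γ)`, with `γ = α + (εκ)⁻¹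
group(εκ²t) h`. This is an ODE on `ℓ² × ℓ²` with a locally Lipschitz field. Hence uniqueness
(`Modal.eqOn`) and, after truncation of the field, existence. What has to be proved is a bound on a
time interval independent of `ε`, although the field has size `ε⁻²`.

The data are functions of `x/ε²`, so the solution is built on the circle of length `2πε²`, where `κ
= ε⁻²`, and carried to its integer multiples by dilation of frequencies (`Modal.dilate`). The group
multiplies by `exp(-i n² θ)` with `θ = t/ε³`; since every `n²` is an integer it is periodic in `t`
with period `τ = 2πε³`. Over one period, with `η = 2πε²` and up to an error `O(τ)`, the motion is `α
↦ α + iη(-α + tri(α,α,α))`, `h ↦ h + iη(h - 3 res(α,α,h))` (`fst_step`, `snd_step`): the term of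
size `ε⁻²` in `h'` averages to zero because means vanish, and at the next order only the frequencies
`n = ±m` resonate. In the frame `exp(-2it/ε) h` the linear part of the second line also becomes `-iη
h`. So `z`, the pair of `α` and the rotated `h`, makes a step `z ↦ z + iη(-z + q(z,z,z))` with `q`
complex trilinear (`rotating_step`).

As `q` contains no conjugates, the cubic term is not resonant with the rotation `-iz` and a normal
form removes it: the time-one flow of `q(x,x,x)/2` carries the field `i(-z + q(z,z,z))` exactly to
`-ib`. A step of length `η` multiplies `b` by `1 - iη`, whose modulus is at most `1 + η²`, and `η² =
O(τ)`. So `‖b‖` grows by `O(τ)` per period (`RadialCurve.step`), and by `O(T)` over the `T/τ`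
periods. A bootstrap keeps `z` in a small ball for a time independent of `ε` (`Trajectory.norm_lt`,
`exists_modal`).

Smallness of the data comes from testing the Sobolev constant on the function `1`: this gives `lam ≤
√π`, so the rescaled data have `ℓ²` norm at most `1/(6√2) < 0.1179`. -/

/-- Square summable complex sequences indexed by `ℤ`. -/
def Seq : Type := lp (fun _ : ℤ => ℂ) 2

namespace Seq

instance : NormedAddCommGroup Seq := inferInstanceAs (NormedAddCommGroup (lp (fun _ : ℤ => ℂ) 2))

instance : InnerProductSpace ℂ Seq :=
  inferInstanceAs (InnerProductSpace ℂ (lp (fun _ : ℤ => ℂ) 2))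

instance : CompleteSpace Seq := inferInstanceAs (CompleteSpace (lp (fun _ : ℤ => ℂ) 2))

instance : FunLike Seq ℤ ℂ where
  coe f := f.1
  coe_injective _ _ h := Subtype.ext h

theorem hasSum_sq (f : Seq) : HasSum (fun n => ‖f n‖ ^ 2) (‖f‖ ^ 2) := by
  have h := lp.hasSum_norm (E := fun _ : ℤ => ℂ) (p := 2) (by norm_num) f
  simp only [ENNReal.toReal_ofNat, Real.rpow_ofNat] at h
  exact h

theorem norm_apply_le (f : Seq) (n : ℤ) : ‖f n‖ ≤ ‖f‖ :=
  lp.norm_apply_le_norm (E := fun _ : ℤ => ℂ) (p := 2) (by norm_num) f n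

theorem memlp_of_summable {f : ℤ → ℂ} (h : Summable fun n => ‖f n‖ ^ 2) : Memℓp f 2 :=
  memℓp_gen (by simpa using h)

theorem norm_le_of_hasSum {f : Seq} {s C : ℝ} (hC : 0 ≤ C) (h : HasSum (fun n => ‖f n‖ ^ 2) s)
    (hs : s ≤ C ^ 2) : ‖f‖ ≤ C := by
  have := (hasSum_sq f).unique h
  exact abs_le_of_sq_le_sq' (by linarith) hC |>.2

/-- The evaluation functional. -/
def eval (n : ℤ) : Seq →L[ℂ] ℂ :=
  LinearMap.mkContinuous
    { toFun := fun f => f n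
      map_add' := fun _ _ => rfl
      map_smul' := fun _ _ => rfl } 1 (fun f => (norm_apply_le f n).trans_eq (one_mul _).symm)

@[simp] theorem eval_apply (n : ℤ) (f : Seq) : eval n f = f n := rfl

@[ext] theorem ext' {f g : Seq} (h : ∀ n, f n = g n) : f = g := DFunLike.ext _ _ h

@[simp] theorem add_apply (f g : Seq) (n : ℤ) : (f + g) n = f n + g n := rfl
@[simp] theorem sub_apply (f g : Seq) (n : ℤ) : (f - g) n = f n - g n := rfl
@[simp] theorem neg_apply (f : Seq) (n : ℤ) : (-f) n = -f n := rfl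
@[simp] theorem smul_apply (c : ℂ) (f : Seq) (n : ℤ) : (c • f) n = c * f n := rfl
@[simp] theorem zero_apply (n : ℤ) : (0 : Seq) n = 0 := rfl

/-- Where `m` does not vanish `e` is injective, so each `‖f k‖²` is counted at most once. -/
theorem wcomp_summable {m : ℤ → ℂ} {e : ℤ → ℤ} {C : ℝ} (hm : ∀ n, ‖m n‖ ≤ C)
    (he : InjOn e {n | m n ≠ 0}) (f : Seq) :
    Summable (fun n => ‖m n * f (e n)‖ ^ 2) ∧ ∑' n, ‖m n * f (e n)‖ ^ 2 ≤ C ^ 2 * ‖f‖ ^ 2 := by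
  have hC : 0 ≤ C := (norm_nonneg _).trans (hm 0)
  have hf := hasSum_sq f
  have hbound : ∀ s : Finset ℤ, ∑ n ∈ s, ‖m n * f (e n)‖ ^ 2 ≤ C ^ 2 * ‖f‖ ^ 2 := by
    classical
    intro s
    calc ∑ n ∈ s, ‖m n * f (e n)‖ ^ 2
        = ∑ n ∈ s with m n ≠ 0, ‖m n * f (e n)‖ ^ 2 := by
          rw [Finset.sum_filter]
          refine Finset.sum_congr rfl fun n _ => ?_
          split_ifs with h
          · rfl
          · simp only [ne_eq, not_not] at h; simp [h]
      _ ≤ ∑ n ∈ s with m n ≠ 0, C ^ 2 * ‖f (e n)‖ ^ 2 := by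
          refine Finset.sum_le_sum fun n _ => ?_
          rw [norm_mul, mul_pow]
          gcongr
          exact hm n
      _ = C ^ 2 * ∑ k ∈ (s.filter fun n => m n ≠ 0).image e, ‖f k‖ ^ 2 := by
          rw [← Finset.mul_sum, Finset.sum_image]
          intro a ha b hb hab
          exact he (by simpa using (Finset.mem_filter.1 ha).2)
            (by simpa using (Finset.mem_filter.1 hb).2) hab
      _ ≤ C ^ 2 * ‖f‖ ^ 2 := by
          gcongr
          exact sum_le_hasSum _ (fun _ _ => by positivity) hf
  exact ⟨summable_of_sum_le (fun _ => by positivity) hbound,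
    Real.tsum_le_of_sum_le (fun _ => by positivity) hbound⟩

/-- The weighted composition operator `(wcomp f) n = m n * f (e n)`. -/
def wcomp (m : ℤ → ℂ) (e : ℤ → ℤ) (C : ℝ) (hm : ∀ n, ‖m n‖ ≤ C)
    (he : InjOn e {n | m n ≠ 0}) : Seq →L[ℂ] Seq :=
  LinearMap.mkContinuous
    { toFun := fun f => ⟨fun n => m n * f (e n), memlp_of_summable (wcomp_summable hm he f).1⟩
      map_add' := fun f g => ext' fun n => mul_add _ _ _
      map_smul' := fun c f => ext' fun n => by
        change m n * (c * f (e n)) = c * (m n * f (e n)); ring } C (fun f => by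
      have h := wcomp_summable hm he f
      refine norm_le_of_hasSum (mul_nonneg ((norm_nonneg _).trans (hm 0)) (norm_nonneg _))
        h.1.hasSum (h.2.trans_eq (mul_pow _ _ _).symm))

@[simp] theorem wcomp_apply (m : ℤ → ℂ) (e : ℤ → ℤ) (C : ℝ) (hm : ∀ n, ‖m n‖ ≤ C)
    (he : InjOn e {n | m n ≠ 0}) (f : Seq) (n : ℤ) : wcomp m e C hm he f n = m n * f (e n) := rfl

theorem wcomp_norm_le (m : ℤ → ℂ) (e : ℤ → ℤ) (C : ℝ) (hm : ∀ n, ‖m n‖ ≤ C)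
    (he : InjOn e {n | m n ≠ 0}) (f : Seq) : ‖wcomp m e C hm he f‖ ≤ C * ‖f‖ :=
  (LinearMap.mkContinuous_norm_le _ ((norm_nonneg _).trans (hm 0)) _ |> fun h =>
    (ContinuousLinearMap.le_opNorm _ f).trans (mul_le_mul_of_nonneg_right h (norm_nonneg _)))

/-- The projection onto sequences with vanishing mean. -/
def proj : Seq →L[ℂ] Seq :=
  wcomp (fun n => if n = 0 then 0 else 1) id 1 (fun n => by split_ifs <;> simp)
    Function.injective_id.injOn

@[simp] theorem proj_apply (f : Seq) (n : ℤ) : proj f n = if n = 0 then 0 else f n := by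
  simp [proj]

theorem norm_proj_le (f : Seq) : ‖proj f‖ ≤ ‖f‖ :=
  (wcomp_norm_le _ _ _ _ _ f).trans_eq (one_mul _)

theorem proj_eq_self {f : Seq} (h : f 0 = 0) : proj f = f := by
  refine ext' fun n => ?_
  rw [proj_apply]
  split_ifs with hn
  · rw [hn, h]
  · rfl

/-- The antiderivative `f n / n` (up to a factor). -/
def anti : Seq →L[ℂ] Seq :=
  wcomp (fun n => (n : ℂ)⁻¹) id 1 (fun n => by
    rcases eq_or_ne n 0 with rfl | h
    · simp
    · rw [norm_inv, Complex.norm_intCast]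
      exact inv_le_one_of_one_le₀ (by exact_mod_cast Int.one_le_abs h))
    Function.injective_id.injOn

@[simp] theorem anti_apply (f : Seq) (n : ℤ) : anti f n = (n : ℂ)⁻¹ * f n := rfl

theorem norm_anti_le (f : Seq) : ‖anti f‖ ≤ ‖f‖ :=
  (wcomp_norm_le _ _ _ _ _ f).trans_eq (one_mul _)

/-- The shift `f (n - p)`. -/
def shift (p : ℤ) : Seq →L[ℂ] Seq :=
  wcomp (fun _ => 1) (fun n => n - p) 1 (fun n => by simp) (sub_left_injective.injOn)

@[simp] theorem shift_apply (p : ℤ) (f : Seq) (n : ℤ) : shift p f n = f (n - p) := by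
  simp [shift]

theorem norm_shift_apply_le (p : ℤ) (f : Seq) : ‖shift p f‖ ≤ ‖f‖ :=
  (wcomp_norm_le _ _ _ _ _ f).trans_eq (one_mul _)

theorem norm_shift_le (p : ℤ) : ‖shift p‖ ≤ 1 :=
  ContinuousLinearMap.opNorm_le_bound _ zero_le_one fun f => by
    simpa using norm_shift_apply_le p f

theorem shift_comm (p q : ℤ) : shift p ∘L shift q = shift q ∘L shift p := by
  ext f n
  simp [sub_right_comm]

/-- The reflection `f (p - n)`. -/
def refl (p : ℤ) : Seq →L[ℂ] Seq :=
  wcomp (fun _ => 1) (fun n => p - n) 1 (fun n => by simp) (sub_right_injective.injOn)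

@[simp] theorem refl_apply (p : ℤ) (f : Seq) (n : ℤ) : refl p f n = f (p - n) := by
  simp [refl]

theorem norm_refl_le (p : ℤ) (f : Seq) : ‖refl p f‖ ≤ ‖f‖ :=
  (wcomp_norm_le _ _ _ _ _ f).trans_eq (one_mul _)

/-- The complex conjugate sequence. -/
def conjSeq (f : Seq) : Seq := (star (show lp (fun _ : ℤ => ℂ) 2 from f) :)

theorem norm_conjSeq (f : Seq) : ‖conjSeq f‖ = ‖f‖ :=
  norm_star (show lp (fun _ : ℤ => ℂ) 2 from f)

/-- The bilinear pairing `∑ f n * g n`. -/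
def dot (f : Seq) : Seq →L[ℂ] ℂ := innerSL ℂ (conjSeq f)

theorem hasSum_dot (f g : Seq) : HasSum (fun n => f n * g n) (dot f g) := by
  have := lp.hasSum_inner (𝕜 := ℂ) (G := fun _ : ℤ => ℂ) (conjSeq f) g
  refine (congrArg (fun F => HasSum F (dot f g)) (funext fun n => ?_)).mpr this
  change _ = g n * conj (conj (f n))
  rw [Complex.conj_conj, mul_comm]

theorem norm_dot_le (f g : Seq) : ‖dot f g‖ ≤ ‖f‖ * ‖g‖ := by
  have := norm_inner_le_norm (𝕜 := ℂ) (conjSeq f) g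
  rwa [norm_conjSeq] at this

/-- The convolution `∑ f m * g (n - m)`. -/
def conv (f g : Seq) (n : ℤ) : ℂ := dot f (refl n g)

theorem hasSum_conv (f g : Seq) (n : ℤ) : HasSum (fun m => f m * g (n - m)) (conv f g n) := by
  simpa [conv] using hasSum_dot f (refl n g)

theorem norm_conv_le (f g : Seq) (n : ℤ) : ‖conv f g n‖ ≤ ‖f‖ * ‖g‖ :=
  (norm_dot_le _ _).trans (mul_le_mul_of_nonneg_left (norm_refl_le n g) (norm_nonneg _))

theorem conv_comm (f g : Seq) (n : ℤ) : conv f g n = conv g f n := by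
  refine (hasSum_conv f g n).unique ?_
  have h := (Equiv.subLeft n).hasSum_iff.2 (hasSum_conv g f n)
  refine (congrArg (fun F => HasSum F (conv g f n)) (funext fun m => ?_)).mpr h
  simp [mul_comm]

theorem hasSum_inv_sq : HasSum (fun n : ℤ => ‖(n : ℂ)⁻¹‖ ^ 2) (π ^ 2 / 3) := by
  have h : HasSum (fun n : ℤ => 1 / (n : ℝ) ^ 2) (π ^ 2 / 6 + π ^ 2 / 6 - 1 / ((0 : ℤ) : ℝ) ^ 2) :=
    HasSum.of_nat_of_neg (by simpa using hasSum_zeta_two) (by simpa using hasSum_zeta_two)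
  convert h using 1
  · ext n; simp
  · simp; ring

/-- The square summable sequence `1 / n`. -/
def inv : Seq := ⟨fun n => (n : ℂ)⁻¹, memlp_of_summable hasSum_inv_sq.summable⟩

theorem norm_inv_sq : ‖inv‖ ^ 2 = π ^ 2 / 3 := (hasSum_sq inv).unique hasSum_inv_sq

/-- Cauchy–Schwarz against `1/n`: this is the embedding of `H¹` into functions with absolutely
convergent Fourier series. -/
theorem summable_anti (f : Seq) : Summable fun n => ‖anti f n‖ := by
  have := lp.summable_mul (p := 2) (q := 2) (E := fun _ : ℤ => ℂ) (by norm_num; exact .two_two) inv f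
  refine this.congr fun n => ?_
  rw [anti_apply, norm_mul]
  rfl

theorem tsum_anti_le (f : Seq) : ∑' n, ‖anti f n‖ ≤ ‖inv‖ * ‖f‖ := by
  have := lp.tsum_mul_le_mul_norm' (p := 2) (q := 2) (E := fun _ : ℤ => ℂ) (by norm_num; exact .two_two) inv f
  refine (congrArg (· ≤ _) (tsum_congr fun n => ?_)).mpr this
  rw [anti_apply, norm_mul]
  rfl

theorem summable_smul_shift (f : Seq) : Summable fun p => anti f p • shift p :=
  .of_norm_bounded (summable_anti f) fun p => by
    rw [norm_smul]
    exact mul_le_of_le_one_right (norm_nonneg _) (norm_shift_le p)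

/-- Multiplication by the function with Fourier coefficients `f n / n`. -/
def mul : Seq →L[ℂ] Seq →L[ℂ] Seq :=
  LinearMap.mkContinuous
    { toFun := fun f => ∑' p, anti f p • shift p
      map_add' := fun f g => by
        rw [← (summable_smul_shift f).tsum_add (summable_smul_shift g)]
        simp only [map_add, add_apply, add_smul]
      map_smul' := fun c f => by
        rw [RingHom.id_apply, ← (summable_smul_shift f).tsum_const_smul]
        simp only [map_smul, smul_apply, mul_smul] } ‖inv‖ fun f => by
    refine (tsum_of_norm_bounded (summable_anti f).hasSum fun p => ?_).trans (tsum_anti_le f)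
    rw [norm_smul]
    exact mul_le_of_le_one_right (norm_nonneg _) (norm_shift_le p)

theorem mul_def (f : Seq) : HasSum (fun p => anti f p • shift p) (mul f) :=
  (summable_smul_shift f).hasSum

theorem hasSum_mul (f g : Seq) : HasSum (fun p => anti f p • shift p g) (mul f g) :=
  (mul_def f).mapL (ContinuousLinearMap.apply ℂ Seq g)

theorem hasSum_mul_apply (f g : Seq) (n : ℤ) :
    HasSum (fun p => anti f p * g (n - p)) (mul f g n) := by
  simpa using (hasSum_mul f g).mapL (eval n)

theorem norm_mul_le (f g : Seq) : ‖mul f g‖ ≤ ‖inv‖ * ‖f‖ * ‖g‖ :=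
  (mul f).le_of_opNorm_le (LinearMap.mkContinuous_norm_le _ (norm_nonneg _) _ |> fun h =>
    mul.le_of_opNorm_le h f) g

theorem mul_apply_eq_conv (f g : Seq) (n : ℤ) : mul f g n = conv (anti f) g n :=
  (hasSum_mul_apply f g n).unique (hasSum_conv _ _ _)

/-- Multiplications are sums of shifts, and shifts commute. -/
theorem mul_comm' (f g h : Seq) : mul f (mul g h) = mul g (mul f h) := by
  have key : ∀ p, shift p ∘L mul g = mul g ∘L shift p := fun p => by
    have h1 := (mul_def g).mapL (ContinuousLinearMap.compL ℂ Seq Seq Seq (shift p))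
    have h2 := (mul_def g).mapL ((ContinuousLinearMap.compL ℂ Seq Seq Seq).flip (shift p))
    refine h1.unique ((congrArg (fun F => HasSum F _) (funext fun q => ?_)).mpr h2)
    rw [map_smul, map_smul]
    exact congrArg _ (shift_comm p q)
  have h1 := hasSum_mul f (mul g h)
  have h2 := (hasSum_mul f h).mapL (mul g)
  refine h1.unique ?_
  convert h2 using 2 with p
  rw [map_smul]
  congr 1
  exact DFunLike.congr_fun (key p) h

/-- The trilinear form of the Fourier coefficients of `∂ₓ (u v w)`. -/
def tri : Seq →L[ℂ] Seq →L[ℂ] Seq →L[ℂ] Seq :=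
  LinearMap.mkContinuous₂
    (LinearMap.mk₂ ℂ (fun f g => mul f ∘L mul g + mul f ∘L mul.flip g + mul g ∘L mul.flip f)
      (fun _ _ _ => by ext1; simp; abel) (fun _ _ _ => by ext1; simp)
      (fun _ _ _ => by ext1; simp; abel) (fun _ _ _ => by ext1; simp)) (π ^ 2) fun f g => by
    refine ContinuousLinearMap.opNorm_le_bound _ (by positivity) fun h => ?_
    have h1 : ∀ a b c : Seq, ‖mul a (mul b c)‖ ≤ π ^ 2 / 3 * (‖a‖ * ‖b‖ * ‖c‖) := fun a b c => by
      rw [← norm_inv_sq]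
      refine (norm_mul_le _ _).trans ((mul_le_mul_of_nonneg_left (norm_mul_le b c)
        (by positivity)).trans_eq (by ring))
    refine (norm_add₃_le).trans ?_
    have e1 := h1 f g h
    have e2 := h1 f h g
    have e3 := h1 g h f
    change ‖mul f (mul g h)‖ + ‖mul f (mul h g)‖ + ‖mul g (mul h f)‖ ≤ _
    linarith

theorem tri_apply (f g h : Seq) :
    tri f g h = mul f (mul g h) + mul f (mul h g) + mul g (mul h f) := rfl

theorem tri_swap₁₂ (f g h : Seq) : tri f g h = tri g f h := by
  rw [tri_apply, tri_apply, mul_comm' f g h, add_right_comm]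

theorem tri_swap₂₃ (f g h : Seq) : tri f g h = tri f h g := by
  rw [tri_apply, tri_apply, mul_comm' g h f, add_comm (mul f (mul g h))]

/-- Each of the three products costs `‖inv‖² = π²/3`, and `π² < 10`. -/
theorem norm_tri_le (f g h : Seq) : ‖tri f g h‖ ≤ 10 * ‖f‖ * ‖g‖ * ‖h‖ := by
  have h1 : ‖tri‖ ≤ 10 := (LinearMap.mkContinuous₂_norm_le _ (by positivity) _).trans (by
    nlinarith [Real.pi_lt_d2, Real.pi_pos])
  exact (tri f g).le_of_opNorm_le ((tri f).le_of_opNorm_le (tri.le_of_opNorm_le h1 f) g) h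

/-- The product rule: write `n = p + (n - p)` in the convolution, and use `p * anti f p = f p`,
which at `p = 0` needs `f 0 = 0`. -/
theorem leibniz_aux (f g g' : Seq) (hf : f 0 = 0) (hg : ∀ n, g' n = n * g n) (n : ℤ) :
    n * mul f g n = mul f g' n + conv f g n := by
  have h1 := (hasSum_mul_apply f g n).mul_left (n : ℂ)
  refine h1.unique ?_
  rw [show (fun p => (n : ℂ) * (anti f p * g (n - p))) = fun p => anti f p * g' (n - p) + f p * g (n - p) from funext fun p => ?_]
  · exact (hasSum_mul_apply f g' n).add (hasSum_conv f g n)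
  rw [hg]
  rcases eq_or_ne p 0 with rfl | hp
  · simp [hf]
  · have : (p : ℂ) ≠ 0 := by exact_mod_cast hp
    simp only [anti_apply]
    push_cast
    field_simp
    ring

theorem conv_mul (f g h : Seq) (n : ℤ) : conv f (mul g (anti h)) n = mul g (mul h f) n := by
  have h1 := (hasSum_mul g (anti h)).mapL (dot f ∘L refl n)
  refine h1.unique ?_
  convert hasSum_mul_apply g (mul h f) n using 2 with p
  rw [map_smul, smul_eq_mul, mul_apply_eq_conv, conv_comm]
  congr 1
  change dot f (refl n (shift p (anti h))) = dot f (refl (n - p) (anti h))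
  refine congrArg _ (ext' fun m => ?_)
  simp only [refl_apply, shift_apply, sub_right_comm]

theorem int_mul_anti {f : Seq} (hf : f 0 = 0) (n : ℤ) : f n = n * anti f n := by
  rcases eq_or_ne n 0 with rfl | hn
  · simp [hf]
  · have : (n : ℂ) ≠ 0 := by exact_mod_cast hn
    simp [this]

theorem leibniz (f g : Seq) (hf : f 0 = 0) (hg : g 0 = 0) (n : ℤ) :
    n * mul f (anti g) n = mul f g n + mul g f n := by
  rw [leibniz_aux f (anti g) g hf (int_mul_anti hg), mul_apply_eq_conv g f, conv_comm f]

theorem tri_eq (f g h : Seq) (hf : f 0 = 0) (hg : g 0 = 0) (hh : h 0 = 0) (n : ℤ) :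
    tri f g h n = n * mul f (mul g (anti h)) n := by
  rw [leibniz_aux f (mul g (anti h)) (mul g h + mul h g) hf
    (fun m => (leibniz g h hg hh m).symm), conv_mul, tri_apply, map_add]
  rfl

/-- Singles out the third factor as a convolution variable; this is the form in which the
oscillating phases of `group θ h` can be read off. -/
theorem tri_eq_conv (f g h : Seq) (hf : f 0 = 0) (hg : g 0 = 0) (hh : h 0 = 0) (n : ℤ) :
    HasSum (fun m => n * (mul f (anti g) (n - m) * anti h m)) (tri f g h n) := by
  have e : tri f g h n = n * mul h (mul f (anti g)) n := by
    rw [← tri_eq h f g hh hf hg, tri_swap₂₃, tri_swap₁₂]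
  rw [e]
  simpa [mul_comm] using (hasSum_mul_apply h (mul f (anti g)) n).mul_left (n : ℂ)

theorem norm_mul_anti_apply_le (f g : Seq) (n : ℤ) : ‖mul f (anti g) n‖ ≤ ‖f‖ * ‖g‖ := by
  rw [mul_apply_eq_conv]
  exact (norm_conv_le _ _ _).trans (by gcongr <;> exact norm_anti_le _)

/-- The resonant part of `h ↦ tri f g h`. -/
def res : Seq →L[ℂ] Seq →L[ℂ] Seq →L[ℂ] Seq :=
  LinearMap.mkContinuous₂
    (LinearMap.mk₂ ℂ (fun f g => mul f (anti g) 0 • ContinuousLinearMap.id ℂ Seq -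
      wcomp (fun n => mul f (anti g) (2 * n)) (fun n => -n) (‖f‖ * ‖g‖)
        (fun n => norm_mul_anti_apply_le f g _) neg_injective.injOn)
      (fun _ _ _ => by ext h n; simp; ring) (fun _ _ _ => by ext h n; simp; ring)
      (fun _ _ _ => by ext h n; simp; ring) (fun _ _ _ => by ext h n; simp; ring)) 2 fun f g => by
    refine ContinuousLinearMap.opNorm_le_bound _ (by positivity) fun h => ?_
    refine (norm_sub_le _ _).trans ?_
    have e1 := mul_le_mul_of_nonneg_right (norm_mul_anti_apply_le f g 0) (norm_nonneg h)
    have e2 := wcomp_norm_le (fun n => mul f (anti g) (2 * n)) (fun n => -n) (‖f‖ * ‖g‖)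
        (fun n => norm_mul_anti_apply_le f g _) neg_injective.injOn h
    rw [← norm_smul] at e1
    refine (add_le_add e1 e2).trans_eq (by ring)

theorem res_apply (f g h : Seq) (n : ℤ) : res f g h n =
    mul f (anti g) 0 * h n - mul f (anti g) (2 * n) * h (-n) := rfl

theorem norm_res_le (f g h : Seq) : ‖res f g h‖ ≤ 2 * ‖f‖ * ‖g‖ * ‖h‖ :=
  (res f g).le_of_opNorm_le ((res f).le_of_opNorm_le
    (res.le_of_opNorm_le (LinearMap.mkContinuous₂_norm_le _ (by positivity) _) f) g) h

/-- The unitary group with multiplier `exp (-i n² θ)`. -/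
def group (θ : ℝ) : Seq →L[ℂ] Seq :=
  wcomp (fun n => Complex.exp (-(n ^ 2 * θ : ℝ) * Complex.I)) id 1
    (fun n => by rw [← Complex.ofReal_neg, Complex.norm_exp_ofReal_mul_I]) Function.injective_id.injOn

theorem group_apply (θ : ℝ) (f : Seq) (n : ℤ) :
    group θ f n = Complex.exp (-(n ^ 2 * θ : ℝ) * Complex.I) * f n := rfl

theorem group_add (θ θ' : ℝ) (f : Seq) : group θ (group θ' f) = group (θ + θ') f := by
  refine ext' fun n => ?_
  rw [group_apply, group_apply, group_apply, ← mul_assoc, ← Complex.exp_add]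
  congr 2
  push_cast
  ring

theorem group_zero (f : Seq) : group 0 f = f := ext' fun n => by simp [group_apply]

theorem group_neg_group (θ : ℝ) (f : Seq) : group (-θ) (group θ f) = f := by
  rw [group_add, neg_add_cancel, group_zero]

theorem group_group_neg (θ : ℝ) (f : Seq) : group θ (group (-θ) f) = f := by
  rw [group_add, add_neg_cancel, group_zero]

theorem norm_group (θ : ℝ) (f : Seq) : ‖group θ f‖ = ‖f‖ := by
  have h : ∀ (θ : ℝ) (f : Seq), ‖group θ f‖ ≤ ‖f‖ := fun θ f =>
    (wcomp_norm_le _ _ _ _ _ f).trans_eq (one_mul _)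
  refine le_antisymm (h θ f) ?_
  conv_lhs => rw [← group_neg_group θ f]
  exact h _ _

attribute [irreducible] wcomp proj anti shift refl dot conv inv mul tri res group

end Seq

end

end VdW

/-! ### The group: strong continuity, periodicity and averages over a period -/

namespace VdW

noncomputable section

namespace Seq

/-- Dominated convergence in the sum over modes. Only strong continuity is available, as the phases
`n² θ` are not equicontinuous in `n`. -/
theorem continuous_group_left (f : Seq) : Continuous fun θ => group θ f := by
  refine continuous_iff_continuousAt.2 fun θ₀ => ?_
  refine tendsto_iff_norm_sub_tendsto_zero.2 ?_
  have h : ∀ θ, ‖group θ f - group θ₀ f‖ ^ 2 =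
      ∑' n : ℤ, ‖(Complex.exp (-(n ^ 2 * θ : ℝ) * Complex.I) -
        Complex.exp (-(n ^ 2 * θ₀ : ℝ) * Complex.I)) * f n‖ ^ 2 := fun θ => by
    rw [← (hasSum_sq _).tsum_eq]
    refine tsum_congr fun n => ?_
    rw [sub_apply, group_apply, group_apply, sub_mul]
  have h2 : Filter.Tendsto (fun θ => ‖group θ f - group θ₀ f‖ ^ 2) (nhds θ₀) (nhds 0) := by
    simp_rw [h]
    have : (0 : ℝ) = ∑' n : ℤ, (0 : ℝ) := by simp
    rw [this]
    refine tendsto_tsum_of_dominated_convergence (bound := fun n => (2 * ‖f n‖) ^ 2) ?_ ?_ ?_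
    · simp_rw [mul_pow]
      exact (hasSum_sq f).summable.mul_left _
    · intro n
      have : Continuous fun θ : ℝ => ‖(Complex.exp (-(n ^ 2 * θ : ℝ) * Complex.I) -
        Complex.exp (-(n ^ 2 * θ₀ : ℝ) * Complex.I)) * f n‖ ^ 2 := by fun_prop
      simpa using this.tendsto θ₀
    · refine Filter.Eventually.of_forall fun θ n => ?_
      rw [Real.norm_of_nonneg (by positivity), norm_mul]
      gcongr
      refine (norm_sub_le _ _).trans ?_
      rw [← Complex.ofReal_neg, Complex.norm_exp_ofReal_mul_I, ← Complex.ofReal_neg,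
        Complex.norm_exp_ofReal_mul_I]
      norm_num
  have h3 := h2.sqrt
  simpa using h3

theorem continuous_group : Continuous fun p : ℝ × Seq => group p.1 p.2 := by
  have hL : ∀ θ, LipschitzWith 1 fun f : Seq => group θ f := fun θ =>
    LipschitzWith.of_dist_le_mul fun f g => by
      rw [dist_eq_norm, dist_eq_norm, ← map_sub, norm_group, NNReal.coe_one, one_mul]
  have := continuous_prod_of_continuous_lipschitzWith (fun p : Seq × ℝ => group p.2 p.1) 1
    continuous_group_left hL
  exact this.comp (continuous_snd.prodMk continuous_fst)

theorem _root_.Continuous.seqGroup {X : Type*} [TopologicalSpace X] {θ : X → ℝ} {f : X → Seq}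
    (hθ : Continuous θ) (hf : Continuous f) : Continuous fun x => group (θ x) (f x) :=
  continuous_group.comp (hθ.prodMk hf)

theorem _root_.ContinuousOn.seqGroup {X : Type*} [TopologicalSpace X] {θ : X → ℝ} {f : X → Seq}
    {s : Set X} (hθ : ContinuousOn θ s) (hf : ContinuousOn f s) :
    ContinuousOn (fun x => group (θ x) (f x)) s :=
  continuous_group.comp_continuousOn (hθ.prodMk hf)

theorem group_two_pi (f : Seq) (θ : ℝ) : group (θ + 2 * π) f = group θ f := by
  ext n
  rw [group_apply, group_apply]
  congr 1
  rw [Complex.exp_eq_exp_iff_exists_int]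
  refine ⟨-n ^ 2, ?_⟩
  push_cast
  ring

theorem group_apply_zero (θ : ℝ) (f : Seq) : group θ f 0 = f 0 := by simp [group_apply]

theorem integral_exp_int (k : ℤ) : ∫ θ in (0 : ℝ)..2 * π, Complex.exp (k * θ * Complex.I) =
    if k = 0 then (2 * π : ℂ) else 0 := by
  split_ifs with h
  · simp [h]
  · have h' : (k * Complex.I : ℂ) ≠ 0 := mul_ne_zero (by exact_mod_cast h) Complex.I_ne_zero
    have := integral_exp_mul_complex (a := 0) (b := 2 * π) h'
    simp_rw [mul_right_comm]
    rw [this, div_eq_zero_iff]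
    left
    have e : (k * Complex.I * (2 * π : ℝ) : ℂ) = k * (2 * π * Complex.I) := by push_cast; ring
    rw [e, Complex.exp_int_mul_two_pi_mul_I]
    simp

theorem eval_integral {F : ℝ → Seq} (hF : Continuous F) (a b : ℝ) (n : ℤ) :
    (∫ θ in a..b, F θ) n = ∫ θ in a..b, F θ n :=
  ((eval n).intervalIntegral_comp_comm (hF.intervalIntegrable a b)).symm

theorem integral_group (f : Seq) (hf : f 0 = 0) : ∫ θ in (0 : ℝ)..2 * π, group (-θ) f = 0 := by
  ext n
  rw [eval_integral (continuous_neg.seqGroup continuous_const)]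
  have : ∀ θ : ℝ, group (-θ) f n = Complex.exp ((n ^ 2 : ℤ) * θ * Complex.I) * f n := fun θ => by
    rw [group_apply]; congr 2; push_cast; ring
  simp_rw [this]
  rw [intervalIntegral.integral_mul_const, integral_exp_int]
  split_ifs with h
  · rw [pow_eq_zero_iff two_ne_zero] at h
    simp [h, hf]
  · simp

/-- The mode `m` of the integrand is a sum of phases `exp(i(m² - n²)θ)`. Only `n = m` and `n = -m`
survive the average; they give the two terms of `res`, the minus sign coming from `m/n = -1`. -/
theorem integral_tri (f g h : Seq) (hf : f 0 = 0) (hg : g 0 = 0) (hh : h 0 = 0) :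
    ∫ θ in (0 : ℝ)..2 * π, group (-θ) (tri f g (group θ h)) = (2 * π : ℂ) • res f g h := by
  have hc : Continuous fun θ => group (-θ) (tri f g (group θ h)) :=
    continuous_neg.seqGroup ((tri f g).continuous.comp (continuous_id.seqGroup continuous_const))
  ext m
  rw [eval_integral hc, smul_apply, res_apply]
  rcases eq_or_ne m 0 with rfl | hm
  -- At `m = 0` the two resonant frequencies coincide, so this mode is treated apart; both sides
  -- vanish.
  · have : ∀ θ : ℝ, group (-θ) (tri f g (group θ h)) 0 = 0 := fun θ => by
      rw [group_apply_zero, tri_eq _ _ _ hf hg (by rw [group_apply_zero, hh])]; simp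
    simp_rw [this]
    simp
  set q := mul f (anti g) with hq
  have hs : ∀ θ : ℝ, HasSum (fun n : ℤ => (m * q (m - n) * anti h n) *
      Complex.exp ((m ^ 2 - n ^ 2 : ℤ) * θ * Complex.I)) (group (-θ) (tri f g (group θ h)) m) := by
    intro θ
    rw [group_apply]
    have := (tri_eq_conv f g (group θ h) hf hg (by rw [group_apply_zero, hh]) m).mul_left
      (Complex.exp (-(m ^ 2 * (-θ) : ℝ) * Complex.I))
    refine (congrArg (fun F => HasSum F _) (funext fun n => ?_)).mpr this
    have e : Complex.exp ((m ^ 2 - n ^ 2 : ℤ) * θ * Complex.I) =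
      Complex.exp (-(m ^ 2 * (-θ) : ℝ) * Complex.I) * Complex.exp (-(n ^ 2 * θ : ℝ) * Complex.I) := by
      rw [← Complex.exp_add]; congr 1; push_cast; ring
    rw [e, anti_apply, anti_apply, group_apply]
    ring
  have hI := intervalIntegral.hasSum_integral_of_dominated_convergence (μ := volume)
    (a := 0) (b := 2 * π)
    (F := fun (n : ℤ) (θ : ℝ) => (m * q (m - n) * anti h n) *
      Complex.exp ((m ^ 2 - n ^ 2 : ℤ) * θ * Complex.I))
    (f := fun θ => group (-θ) (tri f g (group θ h)) m)
    (fun n _ => ‖(m : ℂ)‖ * ‖q‖ * ‖anti h n‖)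
    (fun n => by fun_prop)
    (fun n => .of_forall fun θ _ => by
      rw [norm_mul, norm_mul, norm_mul]
      have : ‖Complex.exp ((m ^ 2 - n ^ 2 : ℤ) * θ * Complex.I)‖ = 1 := by
        have := Complex.norm_exp_ofReal_mul_I (((m ^ 2 - n ^ 2 : ℤ) : ℝ) * θ)
        push_cast at this ⊢
        exact this
      rw [this, mul_one]
      gcongr
      exact norm_apply_le _ _)
    (.of_forall fun _ _ => (summable_anti h).mul_left _)
    (by simp)
    (.of_forall fun θ _ => hs θ)
  refine hI.unique ?_
  have hne : m ≠ -m := by omega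
  have hfin := hasSum_sum_of_ne_finset_zero (L := .unconditional ℤ) (s := {m, -m})
    (f := fun n : ℤ => ∫ θ in (0 : ℝ)..2 * π, (m * q (m - n) * anti h n) *
      Complex.exp ((m ^ 2 - n ^ 2 : ℤ) * θ * Complex.I)) (fun n hn => by
    rw [intervalIntegral.integral_const_mul, integral_exp_int, if_neg, mul_zero]
    intro h0
    rcases sq_eq_sq_iff_eq_or_eq_neg.1 (sub_eq_zero.1 h0) with h1 | h1
    · exact hn (by simp [h1])
    · exact hn (by simp [h1]))
  refine (congrArg (HasSum _) ?_).mp hfin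
  have hm' : (m : ℂ) ≠ 0 := by exact_mod_cast hm
  rw [Finset.sum_pair hne]
  simp only [intervalIntegral.integral_const_mul, integral_exp_int, anti_apply]
  simp
  rw [two_mul m]
  field_simp
  ring

theorem integral_periodic_div {F : ℝ → Seq} (hF : Function.Periodic F (2 * π)) {c : ℝ}
    (hc : c ≠ 0) (t : ℝ) :
    ∫ s in t..t + 2 * π * c, F (s / c) = c • ∫ θ in (0 : ℝ)..2 * π, F θ := by
  rw [intervalIntegral.integral_comp_div _ hc, add_div, mul_div_cancel_right₀ _ hc,
    hF.intervalIntegral_add_eq (t / c) 0, zero_add]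

end Seq

end

end VdW

/-! ### Normal form of a cubic field -/

namespace VdW

noncomputable section

/-- Records that the fixed point of the Picard iteration stays in the ball on which the field is
controlled; that confinement is needed for the radial curves. -/
theorem _root_.IsPicardLindelof.exists_mem_closedBall {E : Type*} [NormedAddCommGroup E]
    [NormedSpace ℝ E] [CompleteSpace E] {f : ℝ → E → E} {tmin tmax : ℝ} {t₀ : Icc tmin tmax}
    {x₀ : E} {a L K : NNReal} (hf : IsPicardLindelof f t₀ x₀ a 0 L K) :
    ∃ c : ℝ → E, c t₀ = x₀ ∧ (∀ t, c t ∈ Metric.closedBall x₀ a) ∧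
      ∀ t ∈ Icc tmin tmax, HasDerivWithinAt c (f t (c t)) (Icc tmin tmax) t := by
  have hx : x₀ ∈ Metric.closedBall x₀ ((0 : NNReal) : ℝ) := Metric.mem_closedBall_self le_rfl
  obtain ⟨c, hc⟩ := ODE.FunSpace.exists_isFixedPt_next hf hx
  refine ⟨c.compProj, by rw [ODE.FunSpace.compProj_val, ← hc, ODE.FunSpace.next_apply₀],
    fun t => c.compProj_mem_closedBall hf.mul_max_le, fun t ht => ?_⟩
  apply ODE.hasDerivWithinAt_picard_Icc t₀.2 hf.continuousOn_uncurry
    c.continuous_compProj.continuousOn (fun _ _ => c.compProj_mem_closedBall hf.mul_max_le)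
    x₀ ht |>.congr_of_mem _ ht
  intro t' ht'
  nth_rw 1 [← hc]
  rw [ODE.FunSpace.compProj_of_mem ht', ODE.FunSpace.next_apply]

section Cubic

variable {X Y : Type*} [NormedAddCommGroup X] [NormedSpace ℂ X] [NormedAddCommGroup Y]
  [NormedSpace ℂ Y]

theorem _root_.HasDerivWithinAt.complex_clm {A : X →L[ℂ] Y} {x : ℝ → X}
    {x' : X} {s : Set ℝ} {t : ℝ} (hx : HasDerivWithinAt x x' s t) :
    HasDerivWithinAt (fun t => A (x t)) (A x') s t :=
  ((A.restrictScalars ℝ).hasFDerivAt (x := x t)).comp_hasDerivWithinAt t hx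

theorem _root_.HasDerivWithinAt.complex_trilinear {q : X →L[ℂ] X →L[ℂ] X →L[ℂ] X} {x y z : ℝ → X}
    {x' y' z' : X} {s : Set ℝ} {t : ℝ} (hx : HasDerivWithinAt x x' s t)
    (hy : HasDerivWithinAt y y' s t) (hz : HasDerivWithinAt z z' s t) :
    HasDerivWithinAt (fun t => q (x t) (y t) (z t))
      (q x' (y t) (z t) + q (x t) y' (z t) + q (x t) (y t) z') s t := by
  have h1 : HasFDerivAt (fun p : X × X × X => q p.1)
      (q ∘L ContinuousLinearMap.fst ℂ X (X × X)) (x t, y t, z t) :=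
    (q ∘L ContinuousLinearMap.fst ℂ X (X × X)).hasFDerivAt
  have h2 : HasFDerivAt (fun p : X × X × X => p.2.1) (ContinuousLinearMap.fst ℂ X X ∘L
      ContinuousLinearMap.snd ℂ X (X × X)) (x t, y t, z t) :=
    (ContinuousLinearMap.fst ℂ X X ∘L ContinuousLinearMap.snd ℂ X (X × X)).hasFDerivAt
  have h3 : HasFDerivAt (fun p : X × X × X => p.2.2) (ContinuousLinearMap.snd ℂ X X ∘L
      ContinuousLinearMap.snd ℂ X (X × X)) (x t, y t, z t) :=
    (ContinuousLinearMap.snd ℂ X X ∘L ContinuousLinearMap.snd ℂ X (X × X)).hasFDerivAt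
  have h4 := (((h1.clm_apply h2).clm_apply h3).restrictScalars ℝ).comp_hasDerivWithinAt t
    (hx.prodMk (hy.prodMk hz))
  refine h4.congr_deriv ?_
  simp
  abel

/-- A trilinear map bounded by `10`. -/
def IsTrilinearBound (q : X →L[ℂ] X →L[ℂ] X →L[ℂ] X) : Prop :=
  ∀ x y z, ‖q x y z‖ ≤ 10 * ‖x‖ * ‖y‖ * ‖z‖

theorem IsTrilinearBound.norm_le {q : X →L[ℂ] X →L[ℂ] X →L[ℂ] X} (hq : IsTrilinearBound q)
    {x y z : X} {a b c : ℝ} (hx : ‖x‖ ≤ a) (hy : ‖y‖ ≤ b) (hz : ‖z‖ ≤ c) :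
    ‖q x y z‖ ≤ 10 * a * b * c := by
  have ha := (norm_nonneg x).trans hx
  have hb := (norm_nonneg y).trans hy
  exact (hq x y z).trans (by gcongr)

theorem IsTrilinearBound.norm_sub_le {q : X →L[ℂ] X →L[ℂ] X →L[ℂ] X} (hq : IsTrilinearBound q)
    {x y : X} {ρ : ℝ} (hx : ‖x‖ ≤ ρ) (hy : ‖y‖ ≤ ρ) :
    ‖q x x x - q y y y‖ ≤ 30 * ρ ^ 2 * ‖x - y‖ := by
  have e : q x x x - q y y y = q (x - y) x x + q y (x - y) x + q y y (x - y) := by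
    simp only [map_sub, sub_apply]; abel
  rw [e]
  refine norm_add₃_le.trans ?_
  have h1 := hq.norm_le (le_refl ‖x - y‖) hx hx
  have h2 := hq.norm_le hy (le_refl ‖x - y‖) hx
  have h3 := hq.norm_le hy hy (le_refl ‖x - y‖)
  linarith

/-- The radial flow of the cubic field `x ↦ q x x x / 2` leads from `z` to `b` in unit time,
inside the ball of radius `ρ`. -/
def RadialCurve (q : X →L[ℂ] X →L[ℂ] X →L[ℂ] X) (ρ : ℝ) (z b : X) : Prop :=
  ∃ c : ℝ → X, c 0 = z ∧ c 1 = b ∧ (∀ s ∈ Icc (0 : ℝ) 1, ‖c s‖ ≤ ρ) ∧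
    ∀ s ∈ Icc (0 : ℝ) 1, HasDerivWithinAt c ((1 / 2 : ℂ) • q (c s) (c s) (c s)) (Icc 0 1) s

theorem RadialCurve.norm_right_le {q : X →L[ℂ] X →L[ℂ] X →L[ℂ] X} {ρ : ℝ} {z b : X}
    (h : RadialCurve q ρ z b) : ‖b‖ ≤ ρ := by
  obtain ⟨c, -, rfl, hc, -⟩ := h
  exact hc 1 (by simp)

theorem RadialCurve.mono {q : X →L[ℂ] X →L[ℂ] X →L[ℂ] X} {ρ ρ' : ℝ} {z b : X}
    (h : RadialCurve q ρ z b) (hρ : ρ ≤ ρ') : RadialCurve q ρ' z b := by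
  obtain ⟨c, h0, h1, hc, hd⟩ := h
  exact ⟨c, h0, h1, fun s hs => (hc s hs).trans hρ, hd⟩

/-- On the ball of radius `r + a` the field `q/2` has norm at most `5(r + a)³ ≤ a`, so a curve from
`z` moves by at most `a` in unit time. -/
theorem exists_radialCurve [CompleteSpace X] {q : X →L[ℂ] X →L[ℂ] X →L[ℂ] X}
    (hq : IsTrilinearBound q) {z : X} {r a : ℝ} (hz : ‖z‖ ≤ r) (ha : 5 * (r + a) ^ 3 ≤ a)
    (ha0 : 0 ≤ a) : ∃ b, RadialCurve q (r + a) z b := by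
  have hr : 0 ≤ r := (norm_nonneg z).trans hz
  have hball : ∀ x ∈ Metric.closedBall z a, ‖x‖ ≤ r + a := fun x hx => by
    rw [mem_closedBall_iff_norm] at hx
    calc ‖x‖ = ‖z + (x - z)‖ := by rw [add_sub_cancel]
      _ ≤ _ := (norm_add_le _ _).trans (add_le_add hz hx)
  have hPL : IsPicardLindelof (fun _ x => (1 / 2 : ℂ) • q x x x)
      (⟨0, by simp⟩ : Icc (0 : ℝ) 1) z ⟨a, ha0⟩ 0 ⟨a, ha0⟩ ⟨15 * (r + a) ^ 2, by positivity⟩ := by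
    constructor
    · intro t _
      refine LipschitzOnWith.of_dist_le_mul fun x hx y hy => ?_
      rw [dist_eq_norm, dist_eq_norm, ← smul_sub, norm_smul]
      have := hq.norm_sub_le (hball x hx) (hball y hy)
      norm_num
      change _ ≤ 15 * (r + a) ^ 2 * ‖x - y‖
      linarith
    · exact fun x _ => continuousOn_const
    · intro t _ x hx
      have h1 := hball x hx
      have := hq.norm_le h1 h1 h1
      rw [norm_smul]
      norm_num
      change _ ≤ a
      nlinarith
    · simp
  obtain ⟨c, h0, hmem, hd⟩ := hPL.exists_mem_closedBall
  exact ⟨c 1, c, h0, rfl, fun s _ => hball _ (hmem s), hd⟩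

/-- Grönwall backwards along the curve: on the ball of radius `1/5` the field has growth rate at
most `10 (1/5)² / 2 = 1/5`. -/
theorem RadialCurve.norm_left_le {q : X →L[ℂ] X →L[ℂ] X →L[ℂ] X} (hq : IsTrilinearBound q)
    {z b : X} (h : RadialCurve q (1 / 5) z b) : ‖z‖ ≤ ‖b‖ * Real.exp (1 / 5) := by
  obtain ⟨c, rfl, rfl, hc, hd⟩ := h
  have hm : ∀ s ∈ Icc (0 : ℝ) 1, 1 - s ∈ Icc (0 : ℝ) 1 := fun s hs =>
    ⟨by linarith [hs.2], by linarith [hs.1]⟩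
  have hder : ∀ s ∈ Icc (0 : ℝ) 1, HasDerivWithinAt (fun s => c (1 - s))
      (-((1 / 2 : ℂ) • q (c (1 - s)) (c (1 - s)) (c (1 - s)))) (Icc 0 1) s := fun s hs => by
    have := (hd (1 - s) (hm s hs)).scomp s
      ((hasDerivWithinAt_id s (Icc 0 1)).const_sub 1) (fun x hx => hm x hx)
    rwa [neg_one_smul] at this
  have := norm_le_gronwallBound_of_norm_deriv_right_le (f := fun s => c (1 - s)) (δ := ‖c 1‖)
    (K := 1 / 5) (ε := 0) (a := 0) (b := 1) (fun s hs => (hder s hs).continuousWithinAt)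
    (fun s hs => (hder s (Ico_subset_Icc_self hs)).mono_of_mem_nhdsWithin
      (Icc_mem_nhdsGE_of_mem hs)) (by simp) (fun s hs => by
    rw [norm_neg, norm_smul]
    have h1 := hc (1 - s) (hm s (Ico_subset_Icc_self hs))
    have := hq.norm_le h1 h1 (le_refl ‖c (1 - s)‖)
    norm_num at this ⊢
    linarith) 1 (by simp)
  rw [gronwallBound_ε0] at this
  simpa using this

/-- The vector `y` below is transported by the linearised flow of `q/2`. It starts as the increment
`iη(-z + q(z,z,z))` and ends as `-iη b`: the cubic part of the step is gone, and `b` is only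
rotated, up to `O(e + η²)`. -/
theorem RadialCurve.step {q : X →L[ℂ] X →L[ℂ] X →L[ℂ] X} (hq : IsTrilinearBound q)
    {z b z' b' : X} (h : RadialCurve q (1 / 5) z b) (h' : RadialCurve q (1 / 5) z' b')
    {η e : ℝ} (hη : 0 ≤ η) (hη1 : η ≤ 1)
    (he : ‖z' - (z + (η * Complex.I : ℂ) • (-z + q z z z))‖ ≤ e) :
    ‖b'‖ ≤ ‖b‖ + (Real.exp 15 + 1) * (e + η ^ 2) := by
  have hb := h.norm_right_le
  have he0 : 0 ≤ e := (norm_nonneg _).trans he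
  obtain ⟨c, rfl, rfl, hc, hd⟩ := h
  obtain ⟨c', rfl, rfl, hc', hd'⟩ := h'
  set y : ℝ → X := fun s => (η * Complex.I : ℂ) • (-c s + ((1 - s : ℝ) : ℂ) • q (c s) (c s) (c s))
    with hy
  set d : ℝ → X := fun s => c s + y s with hdd
  have hηI : ‖(η * Complex.I : ℂ)‖ = η := by simp [abs_of_nonneg hη]
  have hs1 : ∀ s ∈ Icc (0 : ℝ) 1, ‖((1 - s : ℝ) : ℂ)‖ ≤ 1 := fun s hs => by
    rw [Complex.norm_real, Real.norm_eq_abs, abs_le]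
    constructor <;> linarith [hs.1, hs.2]
  have hyn : ∀ s ∈ Icc (0 : ℝ) 1, ‖y s‖ ≤ η * (3 / 10) := fun s hs => by
    rw [hy, norm_smul, hηI]
    gcongr
    refine (norm_add_le _ _).trans ?_
    rw [norm_neg, norm_smul]
    have h1 := hc s hs
    have h2 := hq.norm_le h1 h1 h1
    have h3 := mul_le_mul (hs1 s hs) h2 (norm_nonneg _) zero_le_one
    linarith
  have hdn : ∀ s ∈ Icc (0 : ℝ) 1, ‖d s‖ ≤ 1 := fun s hs => by
    have := norm_add_le (c s) (y s)
    have := hyn s hs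
    have := hc s hs
    simp only [hdd]
    linarith
  set d' : ℝ → X := fun s => (1 / 2 : ℂ) • q (c s) (c s) (c s) + (η * Complex.I : ℂ) •
    (-((1 / 2 : ℂ) • q (c s) (c s) (c s)) + (((1 - s : ℝ) : ℂ) •
      (q ((1 / 2 : ℂ) • q (c s) (c s) (c s)) (c s) (c s) +
        q (c s) ((1 / 2 : ℂ) • q (c s) (c s) (c s)) (c s) +
        q (c s) (c s) ((1 / 2 : ℂ) • q (c s) (c s) (c s))) +
      (-1 : ℂ) • q (c s) (c s) (c s))) with hd'def
  have hder : ∀ s ∈ Icc (0 : ℝ) 1, HasDerivWithinAt d (d' s) (Icc 0 1) s := fun s hs => by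
    have h1 := hd s hs
    have h2 : HasDerivWithinAt (fun s : ℝ => ((1 - s : ℝ) : ℂ)) (-1 : ℂ) (Icc 0 1) s := by
      have := ((hasDerivWithinAt_id s (Icc (0 : ℝ) 1)).const_sub 1).ofReal_comp
      simpa using this
    exact h1.add ((h1.neg.add (h2.smul (h1.complex_trilinear h1 h1))).const_smul _)
  have hres : ∀ s ∈ Icc (0 : ℝ) 1, ‖d' s - (1 / 2 : ℂ) • q (d s) (d s) (d s)‖ ≤ η ^ 2 :=
    fun s hs => by
    have e : d' s - (1 / 2 : ℂ) • q (d s) (d s) (d s) = -((1 / 2 : ℂ) • (q (y s) (y s) (c s) +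
        q (y s) (c s) (y s) + q (c s) (y s) (y s) + q (y s) (y s) (y s))) := by
      have e1 : q (d s) (d s) (d s) = q (c s) (c s) (c s) + (q (y s) (c s) (c s) +
          q (c s) (y s) (c s) + q (c s) (c s) (y s)) + (q (y s) (y s) (c s) +
        q (y s) (c s) (y s) + q (c s) (y s) (y s) + q (y s) (y s) (y s)) := by
        simp only [hdd, map_add, add_apply]; abel
      -- The linearised equation for `y`. It holds exactly, because with `Q = q/2` the derivative of
      -- `Q` at `c` in the direction `c` is `3 Q(c) = Q(c) + q(c,c,c)`. What is left in the defect
      -- is at least quadratic in `y`.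
      have e2 : (1 / 2 : ℂ) • (q (y s) (c s) (c s) + q (c s) (y s) (c s) + q (c s) (c s) (y s)) =
          d' s - (1 / 2 : ℂ) • q (c s) (c s) (c s) := by
        simp only [hy, hd'def, map_add, map_neg, map_smul, add_apply,
          neg_apply, smul_apply]
        module
      rw [e1, smul_add, smul_add, e2]
      module
    rw [e, norm_neg, norm_smul]
    have h1 := hc s hs
    have h2 := hyn s hs
    have h3 := hq.norm_le h2 h2 h1
    have h4 := hq.norm_le h2 h1 h2
    have h5 := hq.norm_le h1 h2 h2
    have h6 := hq.norm_le h2 h2 h2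
    have h7 := norm_add₄_le (a := q (y s) (y s) (c s)) (b := q (y s) (c s) (y s))
      (c := q (c s) (y s) (y s)) (d := q (y s) (y s) (y s))
    norm_num
    nlinarith [mul_nonneg hη (sq_nonneg η), mul_nonneg (sub_nonneg.2 hη1) (sq_nonneg η)]
  -- `d = c + y` is an approximate trajectory of `q/2` with defect `η²`, and starts within `e` of
  -- the trajectory `c'`. The Lipschitz constant of `q/2` on the unit ball is `30/2 = 15`.
  have key := dist_le_of_approx_trajectories_ODE_of_mem (K := 15)
    (v := fun _ x => (1 / 2 : ℂ) • q x x x) (s := fun _ => Metric.closedBall 0 1)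
    (f := c') (f' := fun s => (1 / 2 : ℂ) • q (c' s) (c' s) (c' s)) (g := d) (g' := d')
    (a := 0) (b := 1) (εf := 0) (εg := η ^ 2) (δ := e)
    (fun t _ => LipschitzOnWith.of_dist_le_mul fun x hx y hy => by
      rw [dist_eq_norm, dist_eq_norm, ← smul_sub, norm_smul]
      have := hq.norm_sub_le (mem_closedBall_zero_iff.1 hx) (mem_closedBall_zero_iff.1 hy)
      norm_num
      linarith)
    (fun s hs => (hd' s hs).continuousWithinAt)
    (fun s hs => (hd' s (Ico_subset_Icc_self hs)).mono_of_mem_nhdsWithin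
      (Icc_mem_nhdsGE_of_mem hs)) (by simp)
    (fun s hs => mem_closedBall_zero_iff.2
      ((hc' s (Ico_subset_Icc_self hs)).trans (by norm_num)))
    (fun s hs => (hder s hs).continuousWithinAt)
    (fun s hs => (hder s (Ico_subset_Icc_self hs)).mono_of_mem_nhdsWithin
      (Icc_mem_nhdsGE_of_mem hs)) (fun s hs => by
        rw [dist_eq_norm]; exact hres s (Ico_subset_Icc_self hs))
    (fun s hs => mem_closedBall_zero_iff.2 (hdn s (Ico_subset_Icc_self hs)))
    (by rw [dist_eq_norm]; simpa [hdd, hy] using he) 1 (by simp)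
  rw [dist_eq_norm, gronwallBound_of_K_ne_0 (by norm_num)] at key
  have hd1 : d 1 = (1 - η * Complex.I : ℂ) • c 1 := by
    simp only [hdd, hy, sub_self, Complex.ofReal_zero, zero_smul, add_zero]; module
  have hn1 : ‖(1 - η * Complex.I : ℂ)‖ ≤ 1 + η ^ 2 := by
    refine abs_le_of_sq_le_sq' ?_ (by positivity) |>.2
    rw [← Complex.normSq_eq_norm_sq, Complex.normSq_apply]
    simp
    nlinarith [sq_nonneg η]
  have hlast : ‖c' 1‖ ≤ ‖d 1‖ + ‖c' 1 - d 1‖ := by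
    have := norm_add_le (d 1) (c' 1 - d 1)
    rwa [add_sub_cancel] at this
  rw [hd1, norm_smul] at hlast
  have h15 : 0 < Real.exp 15 := Real.exp_pos _
  have e15 : Real.exp (((15 : NNReal) : ℝ) * (1 - 0)) = Real.exp 15 := by norm_num
  beta_reduce at key
  rw [e15, zero_add, hd1] at key
  have h2 := mul_le_mul_of_nonneg_right hn1 (norm_nonneg (c 1))
  have h3 : η ^ 2 * ‖c 1‖ ≤ η ^ 2 := by nlinarith [sq_nonneg η]
  have h4 : η ^ 2 / ((15 : NNReal) : ℝ) * (Real.exp 15 - 1) ≤ η ^ 2 * Real.exp 15 := by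
    norm_num
    nlinarith [sq_nonneg η, mul_nonneg (sq_nonneg η) h15.le]
  nlinarith [sq_nonneg η]

end Cubic

end

end VdW

/-! ### Averaging over one period of the group -/

namespace VdW

noncomputable section

namespace Seq

/-- The Fourier coefficients of `∂ₓ p₀(u)`, in terms of those of `∂ₓ u`. -/
def nl (f : Seq) : Seq := -f + tri f f f

theorem nl_apply_zero {f : Seq} (hf : f 0 = 0) : nl f 0 = 0 := by
  rw [nl, add_apply, neg_apply, tri_eq f f f hf hf hf, hf]; simp

theorem isTrilinearBound_tri : IsTrilinearBound tri := norm_tri_le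

theorem norm_nl_le {f : Seq} {r : ℝ} (hf : ‖f‖ ≤ r) : ‖nl f‖ ≤ r + 10 * r ^ 3 := by
  refine (norm_add_le _ _).trans ?_
  rw [norm_neg]
  have := isTrilinearBound_tri.norm_le hf hf hf
  linarith

theorem norm_nl_sub_le {f g : Seq} {r : ℝ} (hf : ‖f‖ ≤ r) (hg : ‖g‖ ≤ r) :
    ‖nl f - nl g‖ ≤ (1 + 30 * r ^ 2) * ‖f - g‖ := by
  have e : nl f - nl g = -(f - g) + (tri f f f - tri g g g) := by unfold nl; abel
  rw [e]
  refine (norm_add_le _ _).trans ?_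
  rw [norm_neg]
  have := isTrilinearBound_tri.norm_sub_le hf hg
  linarith

theorem nl_add (x y : Seq) : nl (x + y) =
    nl x - y + (3 : ℂ) • tri x x y + ((3 : ℂ) • tri x y y + tri y y y) := by
  have e1 : tri x y x = tri x x y := tri_swap₂₃ _ _ _
  have e2 : tri y x x = tri x x y := by rw [tri_swap₁₂, e1]
  have e3 : tri y x y = tri x y y := tri_swap₁₂ _ _ _
  have e4 : tri y y x = tri x y y := by rw [tri_swap₂₃, e3]
  simp only [nl, map_add, _root_.add_apply, e1, e2, e3, e4]
  module

theorem continuous_nl : Continuous nl := by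
  unfold nl
  fun_prop

/-- The pair `(α, h)` solves the system in interaction variables on `[a, b]`, and is small. -/
structure Trajectory (ε a b : ℝ) (α h : ℝ → Seq) : Prop where
  deriv_fst : ∀ s ∈ Icc a b, HasDerivWithinAt α
    ((Complex.I / ε : ℂ) • nl (α s + (ε : ℂ) • group (s / ε ^ 3) (h s))) (Icc a b) s
  deriv_snd : ∀ s ∈ Icc a b, HasDerivWithinAt h
    ((-Complex.I / ε ^ 2 : ℂ) • group (-(s / ε ^ 3))
      (nl (α s + (ε : ℂ) • group (s / ε ^ 3) (h s)))) (Icc a b) s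
  zero_fst : ∀ s ∈ Icc a b, α s 0 = 0
  zero_snd : ∀ s ∈ Icc a b, h s 0 = 0
  norm_fst : ∀ s ∈ Icc a b, ‖α s‖ ≤ 1 / 5
  norm_snd : ∀ s ∈ Icc a b, ‖h s‖ ≤ 1 / 5

namespace Trajectory

variable {ε a b : ℝ} {α h : ℝ → Seq}

theorem mono (H : Trajectory ε a b α h) {a' b' : ℝ} (hsub : Icc a' b' ⊆ Icc a b) :
    Trajectory ε a' b' α h where
  deriv_fst s hs := (H.deriv_fst s (hsub hs)).mono hsub
  deriv_snd s hs := (H.deriv_snd s (hsub hs)).mono hsub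
  zero_fst s hs := H.zero_fst s (hsub hs)
  zero_snd s hs := H.zero_snd s (hsub hs)
  norm_fst s hs := H.norm_fst s (hsub hs)
  norm_snd s hs := H.norm_snd s (hsub hs)

theorem norm_sum_le (H : Trajectory ε a b α h) (hε : 0 < ε) (hε1 : ε ≤ 1 / 4) {s : ℝ}
    (hs : s ∈ Icc a b) : ‖α s + (ε : ℂ) • group (s / ε ^ 3) (h s)‖ ≤ 1 / 4 := by
  refine (norm_add_le _ _).trans ?_
  rw [norm_smul, norm_group, Complex.norm_real, Real.norm_of_nonneg hε.le]
  have := H.norm_fst s hs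
  have := H.norm_snd s hs
  nlinarith [norm_nonneg (h s)]

theorem norm_nl_le (H : Trajectory ε a b α h) (hε : 0 < ε) (hε1 : ε ≤ 1 / 4) {s : ℝ}
    (hs : s ∈ Icc a b) : ‖nl (α s + (ε : ℂ) • group (s / ε ^ 3) (h s))‖ ≤ 1 / 2 :=
  (Seq.norm_nl_le (H.norm_sum_le hε hε1 hs)).trans (by norm_num)

/-- The velocity is at most `1/(2ε)` and the duration at most `2πε³`; the same count for `h`, with
velocity `1/(2ε²)`, gives `4ε`. -/
theorem norm_fst_sub_le (H : Trajectory ε a b α h) (hε : 0 < ε) (hε1 : ε ≤ 1 / 4)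
    (hb : b ≤ a + 2 * π * ε ^ 3) {s : ℝ} (hs : s ∈ Icc a b) : ‖α s - α a‖ ≤ 4 * ε ^ 2 := by
  have := norm_image_sub_le_of_norm_deriv_le_segment' H.deriv_fst (C := 1 / (2 * ε))
    (fun x hx => by
      rw [norm_smul, norm_div, Complex.norm_I, Complex.norm_real, Real.norm_of_nonneg hε.le]
      have := H.norm_nl_le hε hε1 (Ico_subset_Icc_self hx)
      calc 1 / ε * _ ≤ 1 / ε * (1 / 2) := by gcongr
        _ = _ := by field_simp) s hs
  refine this.trans ?_
  rw [div_mul_eq_mul_div, div_le_iff₀ (by positivity)]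
  have h1 : s - a ≤ 2 * π * ε ^ 3 := by linarith [hs.2]
  nlinarith [Real.pi_lt_d2, pow_pos hε 3]

theorem norm_snd_sub_le (H : Trajectory ε a b α h) (hε : 0 < ε) (hε1 : ε ≤ 1 / 4)
    (hb : b ≤ a + 2 * π * ε ^ 3) {s : ℝ} (hs : s ∈ Icc a b) : ‖h s - h a‖ ≤ 4 * ε := by
  have := norm_image_sub_le_of_norm_deriv_le_segment' H.deriv_snd (C := 1 / (2 * ε ^ 2))
    (fun x hx => by
      rw [norm_smul, norm_div, norm_neg, Complex.norm_I, norm_group, norm_pow, Complex.norm_real,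
        Real.norm_of_nonneg hε.le]
      have := H.norm_nl_le hε hε1 (Ico_subset_Icc_self hx)
      calc 1 / ε ^ 2 * _ ≤ 1 / ε ^ 2 * (1 / 2) := by gcongr
        _ = _ := by field_simp) s hs
  refine this.trans ?_
  rw [div_mul_eq_mul_div, div_le_iff₀ (by positivity)]
  have h1 : s - a ≤ 2 * π * ε ^ 3 := by linarith [hs.2]
  nlinarith [Real.pi_lt_d2, pow_pos hε 3]

theorem norm_sum_sub_le (H : Trajectory ε a b α h) (hε : 0 < ε) (hε1 : ε ≤ 1 / 4)
    (hb : b ≤ a + 2 * π * ε ^ 3) {s : ℝ} (hs : s ∈ Icc a b) :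
    ‖α s + (ε : ℂ) • group (s / ε ^ 3) (h s) - α a‖ ≤ 2 * ε := by
  have e : α s + (ε : ℂ) • group (s / ε ^ 3) (h s) - α a =
    (α s - α a) + (ε : ℂ) • group (s / ε ^ 3) (h s) := by abel
  rw [e]
  refine (norm_add_le _ _).trans ?_
  rw [norm_smul, norm_group, Complex.norm_real, Real.norm_of_nonneg hε.le]
  have := H.norm_fst_sub_le hε hε1 hb hs
  have := H.norm_snd s hs
  nlinarith [norm_nonneg (h s)]

/-- Over one period the argument of `nl` stays within `2ε` of `α a`, so freezing it there changes
the velocity, which carries the factor `1/ε`, by `O(1)`. -/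
theorem fst_step (H : Trajectory ε a (a + 2 * π * ε ^ 3) α h) (hε : 0 < ε) (hε1 : ε ≤ 1 / 4) :
    ‖α (a + 2 * π * ε ^ 3) - (α a + (2 * π * ε ^ 2 * Complex.I : ℂ) • nl (α a))‖
      ≤ 100 * (2 * π * ε ^ 3) := by
  set τ := 2 * π * ε ^ 3 with hτ
  have hτ0 : 0 ≤ τ := by positivity
  have hεC : (ε : ℂ) ≠ 0 := by exact_mod_cast hε.ne'
  have ha : a ∈ Icc a (a + τ) := ⟨le_rfl, by linarith⟩
  have hder : ∀ s ∈ Icc a (a + τ), HasDerivWithinAt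
      (fun s => α s - ((s - a : ℝ) : ℂ) • (Complex.I / ε : ℂ) • nl (α a))
      ((Complex.I / ε : ℂ) • nl (α s + (ε : ℂ) • group (s / ε ^ 3) (h s)) -
        (1 : ℂ) • (Complex.I / ε : ℂ) • nl (α a)) (Icc a (a + τ)) s := fun s hs => by
    have h2 : HasDerivWithinAt (fun s : ℝ => ((s - a : ℝ) : ℂ)) (1 : ℂ) (Icc a (a + τ)) s := by
      have := ((hasDerivWithinAt_id s (Icc a (a + τ))).sub_const a).ofReal_comp
      simpa using this
    exact (H.deriv_fst s hs).sub (h2.smul_const _)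
  have key := norm_image_sub_le_of_norm_deriv_le_segment' hder (C := 100) (fun s hs => by
    have hs' := Ico_subset_Icc_self hs
    rw [one_smul, ← smul_sub, norm_smul, norm_div, Complex.norm_I, Complex.norm_real,
      Real.norm_of_nonneg hε.le]
    have h1 := norm_nl_sub_le (H.norm_sum_le hε hε1 hs')
      ((H.norm_fst a ha).trans (by norm_num : (1 : ℝ) / 5 ≤ 1 / 4))
    have h2 := H.norm_sum_sub_le hε hε1 le_rfl hs'
    rw [div_mul_eq_mul_div, one_mul, div_le_iff₀ hε]
    refine h1.trans ?_
    rw [show (1 : ℝ) + 30 * (1 / 4) ^ 2 = 23 / 8 by norm_num]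
    linarith) (a + τ) ⟨by linarith, le_rfl⟩
  refine (congrArg (fun x => ‖x‖) ?_).trans_le (key.trans_eq (by ring))
  simp only [sub_self, add_sub_cancel_left, Complex.ofReal_zero, smul_smul, zero_mul, zero_smul, sub_zero]
  have : (τ : ℂ) * (Complex.I / ε) = 2 * π * ε ^ 2 * Complex.I := by
    rw [hτ]; push_cast; field_simp
  rw [this]
  abel

/-- The velocity of `h` carries `1/ε²`, so `nl` is expanded to first order in `ε` around `α a`,
leaving a remainder `O(ε²)`. The average over the period kills the zeroth order and turns the first
one into `-h + 3 res(α,α,h)`. -/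
theorem snd_step (H : Trajectory ε a (a + 2 * π * ε ^ 3) α h) (hε : 0 < ε) (hε1 : ε ≤ 1 / 4) :
    ‖h (a + 2 * π * ε ^ 3) - (h a + (2 * π * ε ^ 2 * Complex.I : ℂ) •
      (h a - (3 : ℂ) • res (α a) (α a) (h a)))‖ ≤ 200 * (2 * π * ε ^ 3) := by
  set τ := 2 * π * ε ^ 3 with hτ
  have hτ0 : 0 ≤ τ := by positivity
  have hεC : (ε : ℂ) ≠ 0 := by exact_mod_cast hε.ne'
  have ha : a ∈ Icc a (a + τ) := ⟨le_rfl, by linarith⟩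
  have hα0 := H.zero_fst a ha
  have hh0 := H.zero_snd a ha
  set F₁ : ℝ → Seq := fun θ => group (-θ) (nl (α a)) with hF₁
  set F₂ : ℝ → Seq := fun θ => group (-θ) (tri (α a) (α a) (group θ (h a))) with hF₂
  have hF₁c : Continuous F₁ := continuous_neg.seqGroup continuous_const
  have hF₂c : Continuous F₂ :=
    continuous_neg.seqGroup ((tri _ _).continuous.comp (continuous_id.seqGroup continuous_const))
  have hper : ∀ (θ : ℝ) (f : Seq), group (-(θ + 2 * π)) f = group (-θ) f := fun θ f => by
    rw [← group_two_pi f (-(θ + 2 * π))]; congr 2; ring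
  have hF₁p : Function.Periodic F₁ (2 * π) := fun θ => hper θ _
  have hF₂p : Function.Periodic F₂ (2 * π) := fun θ => by
    simp only [hF₂]; rw [hper, group_two_pi]
  set G : ℝ → Seq := fun s => (-Complex.I / ε ^ 2 : ℂ) • F₁ (s / ε ^ 3) +
    (-Complex.I / ε : ℂ) • (-h a + (3 : ℂ) • F₂ (s / ε ^ 3)) with hG
  have hF₁c' : Continuous fun s => F₁ (s / ε ^ 3) := hF₁c.comp (continuous_id.div_const _)
  have hF₂c' : Continuous fun s => F₂ (s / ε ^ 3) := hF₂c.comp (continuous_id.div_const _)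
  have hGc : Continuous G := by fun_prop
  -- `G` is the velocity with `α` and `h` frozen at time `a` and truncated at first order; only the
  -- phase of the group still varies.
  have hder : ∀ s ∈ Icc a (a + τ), HasDerivWithinAt (fun s => h s - ∫ r in a..s, G r)
      ((-Complex.I / ε ^ 2 : ℂ) • group (-(s / ε ^ 3))
      (nl (α s + (ε : ℂ) • group (s / ε ^ 3) (h s))) - G s) (Icc a (a + τ)) s := fun s hs =>
    (H.deriv_snd s hs).sub (hGc.integral_hasStrictDerivAt a s).hasDerivAt.hasDerivWithinAt
  have key := norm_image_sub_le_of_norm_deriv_le_segment' hder (C := 200) (fun s hs => by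
    have hs' := Ico_subset_Icc_self hs
    set w := group (s / ε ^ 3) (h a) with hw
    set y := α s + (ε : ℂ) • group (s / ε ^ 3) (h s) - α a with hy
    set y' := y - (ε : ℂ) • w with hy'
    have hyn : ‖y‖ ≤ 2 * ε := H.norm_sum_sub_le hε hε1 le_rfl hs'
    have hy'n : ‖y'‖ ≤ 8 * ε ^ 2 := by
      have e : y' = (α s - α a) + (ε : ℂ) • group (s / ε ^ 3) (h s - h a) := by
        rw [hy', hy, hw, map_sub, smul_sub]; abel
      rw [e]
      refine (norm_add_le _ _).trans ?_
      rw [norm_smul, norm_group, Complex.norm_real, Real.norm_of_nonneg hε.le]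
      have := H.norm_fst_sub_le hε hε1 le_rfl hs'
      have := H.norm_snd_sub_le hε hε1 le_rfl hs'
      nlinarith
    have e1 : α s + (ε : ℂ) • group (s / ε ^ 3) (h s) = α a + y := by rw [hy]; abel
    have e2 : G s = (-Complex.I / ε ^ 2 : ℂ) • group (-(s / ε ^ 3))
        (nl (α a) + (ε : ℂ) • (-w + (3 : ℂ) • tri (α a) (α a) w)) := by
      simp only [hG, hF₁, hF₂, map_add, map_smul, map_neg]
      rw [hw, group_neg_group, smul_add (-Complex.I / (ε : ℂ) ^ 2), smul_smul _ (ε : ℂ)]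
      congr 2
      field_simp
    rw [e1, e2, ← smul_sub, ← map_sub, norm_smul, norm_group, norm_div, norm_neg, Complex.norm_I,
      norm_pow, Complex.norm_real, Real.norm_of_nonneg hε.le, div_mul_eq_mul_div, one_mul,
      div_le_iff₀ (by positivity)]
    -- Here `y` is `O(ε)` and `y' = y - ε w` is `O(ε²)`; the linear terms contain only `y'` and the
    -- others are quadratic or cubic in `y`, so all are `O(ε²)`.
    have e3 : nl (α a + y) - (nl (α a) + (ε : ℂ) • (-w + (3 : ℂ) • tri (α a) (α a) w)) =
        -y' + (3 : ℂ) • tri (α a) (α a) y' + (3 : ℂ) • tri (α a) y y + tri y y y := by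
      rw [nl_add, hy']
      simp only [map_sub, map_smul]
      module
    rw [e3]
    have h1 := norm_add₄_le (a := -y') (b := (3 : ℂ) • tri (α a) (α a) y')
      (c := (3 : ℂ) • tri (α a) y y) (d := tri y y y)
    have hα := H.norm_fst a ha
    have h2 := isTrilinearBound_tri.norm_le hα hα hy'n
    have h3 := isTrilinearBound_tri.norm_le hα hyn hyn
    have h4 := isTrilinearBound_tri.norm_le hyn hyn hyn
    rw [norm_neg, norm_smul, norm_smul] at h1
    have n3 : ‖(3 : ℂ)‖ = 3 := by norm_num
    rw [n3] at h1
    nlinarith [pow_pos hε 2]) (a + τ) ⟨by linarith, le_rfl⟩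
  have hint : ∫ r in a..a + τ, G r = (2 * π * ε ^ 2 * Complex.I : ℂ) •
      (h a - (3 : ℂ) • res (α a) (α a) (h a)) := by
    have hε3 : ε ^ 3 ≠ 0 := (pow_pos hε 3).ne'
    have i1 : ∫ r in a..a + τ, F₁ (r / ε ^ 3) = 0 := by
      rw [hτ, integral_periodic_div hF₁p hε3, integral_group _ (nl_apply_zero hα0), smul_zero]
    have i2 : ∫ r in a..a + τ, F₂ (r / ε ^ 3) = (τ : ℂ) • res (α a) (α a) (h a) := by
      rw [hτ, integral_periodic_div hF₂p hε3, integral_tri _ _ _ hα0 hα0 hh0,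
        ← Complex.coe_smul, smul_smul]
      congr 1
      push_cast
      ring
    simp only [hG]
    rw [intervalIntegral.integral_add (Continuous.intervalIntegrable (by fun_prop) _ _)
      (Continuous.intervalIntegrable (by fun_prop) _ _),
      intervalIntegral.integral_smul, intervalIntegral.integral_smul,
      intervalIntegral.integral_add (Continuous.intervalIntegrable (by fun_prop) _ _)
      (Continuous.intervalIntegrable (by fun_prop) _ _), intervalIntegral.integral_smul, i1, i2,
      intervalIntegral.integral_const, add_sub_cancel_left, smul_zero, zero_add,
      ← Complex.coe_smul τ, smul_neg, smul_smul]
    have : (2 * π * ε ^ 2 * Complex.I : ℂ) = (Complex.I / ε) * τ := by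
      rw [hτ]; push_cast; field_simp
    rw [this]
    module
  refine (congrArg (fun x => ‖x‖) ?_).trans_le (key.trans_eq (by ring))
  rw [hint, intervalIntegral.integral_same]
  abel

end Trajectory

end Seq

end

end VdW

/-! ### The averaged system and its iteration over many periods -/

namespace VdW

noncomputable section

namespace Seq

theorem norm_averaged_aux (x y z : Seq × Seq) :
    ‖((tri x.1 y.1 z.1, (-3 : ℂ) • res x.1 y.1 z.2) : Seq × Seq)‖ ≤ 10 * ‖x‖ * ‖y‖ * ‖z‖ := by
  have hx := norm_fst_le x
  have hy := norm_fst_le y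
  refine max_le ?_ ?_
  · refine (norm_tri_le x.1 y.1 z.1).trans ?_
    gcongr
    exact norm_fst_le z
  · change ‖(-3 : ℂ) • res x.1 y.1 z.2‖ ≤ _
    rw [norm_smul]
    have h1 := norm_res_le x.1 y.1 z.2
    have h2 : 2 * ‖x.1‖ * ‖y.1‖ * ‖z.2‖ ≤ 2 * ‖x‖ * ‖y‖ * ‖z‖ := by
      gcongr
      exact norm_snd_le z
    have h3 : 0 ≤ ‖x‖ * ‖y‖ * ‖z‖ := by positivity
    norm_num
    linarith

/-- The linear maps that make up `averaged`. -/
def averagedMap (x y : Seq × Seq) : Seq × Seq →L[ℂ] Seq × Seq :=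
  (tri x.1 y.1 ∘L ContinuousLinearMap.fst ℂ Seq Seq).prod
    (((-3 : ℂ) • res x.1 y.1) ∘L ContinuousLinearMap.snd ℂ Seq Seq)

theorem averagedMap_apply (x y z : Seq × Seq) :
    averagedMap x y z = (tri x.1 y.1 z.1, (-3 : ℂ) • res x.1 y.1 z.2) := rfl

/-- The trilinear map whose cubic form is the averaged nonlinearity. -/
def averaged : Seq × Seq →L[ℂ] Seq × Seq →L[ℂ] Seq × Seq →L[ℂ] Seq × Seq :=
  LinearMap.mkContinuous₂
    (LinearMap.mk₂ ℂ averagedMap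
      (fun x x' y => ContinuousLinearMap.ext fun z => by
        simp only [averagedMap_apply, _root_.add_apply, Prod.fst_add, map_add, smul_add,
          Prod.mk_add_mk])
      (fun c x y => ContinuousLinearMap.ext fun z => by
        simp only [averagedMap_apply, _root_.smul_apply, Prod.smul_fst, map_smul, Prod.smul_mk,
          smul_comm c (-3 : ℂ)])
      (fun x y y' => ContinuousLinearMap.ext fun z => by
        simp only [averagedMap_apply, _root_.add_apply, Prod.fst_add, map_add, smul_add,
          Prod.mk_add_mk])
      (fun c x y => ContinuousLinearMap.ext fun z => by
        simp only [averagedMap_apply, _root_.smul_apply, Prod.smul_fst, map_smul, Prod.smul_mk,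
          smul_comm c (-3 : ℂ)]))
    10 fun x y => ContinuousLinearMap.opNorm_le_bound _ (by positivity) (norm_averaged_aux x y)

theorem averaged_apply (x y z : Seq × Seq) :
    averaged x y z = (tri x.1 y.1 z.1, (-3 : ℂ) • res x.1 y.1 z.2) := rfl

attribute [irreducible] averaged

theorem isTrilinearBound_averaged : IsTrilinearBound averaged := fun x y z => by
  rw [averaged_apply]
  exact norm_averaged_aux x y z

/-- The rotating state `(α, exp (-2it/ε) h)`. -/
def rotating (ε : ℝ) (α h : ℝ → Seq) (t : ℝ) : Seq × Seq :=
  (α t, Complex.exp ((-(2 * t / ε) : ℝ) * Complex.I) • h t)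

theorem norm_rotating (ε : ℝ) (α h : ℝ → Seq) (t : ℝ) :
    ‖rotating ε α h t‖ = max ‖α t‖ ‖h t‖ := by
  rw [rotating, Prod.norm_mk, norm_smul, Complex.norm_exp_ofReal_mul_I, one_mul]

namespace Trajectory

variable {ε a b : ℝ} {α h : ℝ → Seq}

/-- Over a period the frame turns by `exp(-2iη)`, since `2τ/ε = 2η`. This changes the linear part of
`h` from `+iη` to `-iη`, and commutes with `res(α,α,·)` by linearity. Replacing the exponential by
its expansion costs `O(η²)`, that is `O(τ)`. -/
theorem rotating_step (H : Trajectory ε a (a + 2 * π * ε ^ 3) α h) (hε : 0 < ε)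
    (hε1 : ε ≤ 1 / 4) :
    ‖rotating ε α h (a + 2 * π * ε ^ 3) - (rotating ε α h a + ((2 * π * ε ^ 2 : ℝ) * Complex.I : ℂ) •
      (-rotating ε α h a + averaged (rotating ε α h a) (rotating ε α h a) (rotating ε α h a)))‖
      ≤ 300 * (2 * π * ε ^ 3) := by
  set τ := 2 * π * ε ^ 3 with hτ
  have hτ0 : 0 ≤ τ := by positivity
  set η := 2 * π * ε ^ 2 with hη
  have hη0 : 0 ≤ η := by positivity
  have hη1 : 2 * η ≤ 1 := by rw [hη]; nlinarith [Real.pi_lt_d2, Real.pi_pos]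
  have hη2 : η ^ 2 ≤ 10 * τ := by
    have : η ^ 2 = 2 * π * ε * τ := by rw [hη, hτ]; ring
    rw [this]
    gcongr
    nlinarith [Real.pi_lt_d2, Real.pi_pos]
  have ha : a ∈ Icc a (a + τ) := ⟨le_rfl, by linarith⟩
  rw [averaged_apply]
  refine max_le ?_ ?_
  · have := H.fst_step hε hε1
    refine (congrArg (fun x => ‖x‖) ?_).trans_le (this.trans (by linarith))
    simp only [rotating, nl, Prod.fst_sub, Prod.fst_add, Prod.smul_fst, Prod.fst_neg]
    rw [hη]
    push_cast
    rfl
  · have h1 := H.snd_step hε hε1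
    rw [← hτ] at h1
    have e0 : (2 * π * ε ^ 2 * Complex.I : ℂ) = η * Complex.I := by rw [hη]; push_cast; rfl
    rw [e0] at h1
    set m := Complex.exp ((-(2 * a / ε) : ℝ) * Complex.I) with hm
    set p := Complex.exp (-(2 * η * Complex.I : ℂ)) with hp
    set r := res (α a) (α a) (h a) with hr
    set e := h (a + τ) - (h a + (η * Complex.I : ℂ) • (h a - (3 : ℂ) • r)) with he
    have hmp : Complex.exp ((-(2 * (a + τ) / ε) : ℝ) * Complex.I) = m * p := by
      rw [hm, hp, ← Complex.exp_add]
      congr 1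
      rw [hτ, hη]
      have hεC : (ε : ℂ) ≠ 0 := by exact_mod_cast hε.ne'
      push_cast
      field_simp
      ring
    have hnorm : ‖-(2 * η * Complex.I : ℂ)‖ = 2 * η := by
      simp [abs_of_nonneg hη0]
    have hm1 : ‖m‖ = 1 := Complex.norm_exp_ofReal_mul_I _
    have hp1 : ‖p‖ = 1 := by
      have := Complex.norm_exp_ofReal_mul_I (-(2 * η))
      push_cast at this
      rwa [neg_mul] at this
    have hp2 : ‖p - 1‖ ≤ 4 * η := by
      have := Complex.norm_exp_sub_one_le (x := -(2 * η * Complex.I : ℂ)) (by rw [hnorm]; exact hη1)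
      rw [hnorm] at this
      linarith
    have hp3 : ‖p - 1 + 2 * η * Complex.I‖ ≤ 4 * η ^ 2 := by
      have := Complex.norm_exp_sub_one_sub_id_le (x := -(2 * η * Complex.I : ℂ))
        (by rw [hnorm]; exact hη1)
      rw [hnorm, sub_neg_eq_add] at this
      linarith
    have key : m • ((p - 1 + 2 * η * Complex.I) • h a +
        ((p - 1) * (η * Complex.I)) • (h a - (3 : ℂ) • r) + p • e) =
        (rotating ε α h (a + τ) - (rotating ε α h a + ((η : ℝ) * Complex.I : ℂ) •
        (-rotating ε α h a + (tri (rotating ε α h a).1 (rotating ε α h a).1 (rotating ε α h a).1,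
          (-3 : ℂ) • res (rotating ε α h a).1 (rotating ε α h a).1 (rotating ε α h a).2)))).2 := by
      simp only [rotating, Prod.snd_sub, Prod.snd_add, Prod.smul_snd, Prod.snd_neg]
      rw [hmp, ← hm, map_smul, ← hr, he]
      module
    rw [← key, norm_smul, hm1, one_mul]
    refine norm_add₃_le.trans ?_
    rw [norm_smul, norm_smul, norm_smul, hp1, one_mul, norm_mul]
    have hηI : ‖(η * Complex.I : ℂ)‖ = η := by simp [abs_of_nonneg hη0]
    rw [hηI]
    have hα := H.norm_fst a ha
    have hh := H.norm_snd a ha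
    have hrn : ‖r‖ ≤ 1 / 10 := by
      refine (norm_res_le _ _ _).trans ?_
      calc 2 * ‖α a‖ * ‖α a‖ * ‖h a‖ ≤ 2 * (1 / 5) * (1 / 5) * (1 / 5) := by gcongr
        _ ≤ _ := by norm_num
    have hsub : ‖h a - (3 : ℂ) • r‖ ≤ 1 / 2 := by
      refine (norm_sub_le _ _).trans ?_
      rw [norm_smul]
      norm_num
      linarith
    have t1 : ‖p - 1 + 2 * η * Complex.I‖ * ‖h a‖ ≤ 4 * η ^ 2 * (1 / 5) := by gcongr
    have t2 : ‖p - 1‖ * η * ‖h a - (3 : ℂ) • r‖ ≤ 4 * η * η * (1 / 2) := by gcongr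
    nlinarith

end Trajectory

/-- The growth constant of the averaged dynamics. -/
def growth : ℝ := (Real.exp 15 + 1) * 310

theorem growth_pos : 0 < growth := by unfold growth; positivity

theorem exp_fifth_lt : Real.exp (1 / 5) < 1.222 := by
  refine lt_of_pow_lt_pow_left₀ 5 (by norm_num) ?_
  rw [← Real.exp_nat_mul]
  have := Real.exp_one_lt_d9
  norm_num at this ⊢
  linarith

/-- Induction on the number of periods, each adding at most `growth * τ` to the norm of the
normal-form variable. The factor `310` in `growth` is `300` from `rotating_step` plus `10` from `η²
≤ 10 τ`. -/
theorem Trajectory.exists_radialCurve {ε b : ℝ} {α h : ℝ → Seq} (H : Trajectory ε 0 b α h)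
    (hε : 0 < ε) (hε1 : ε ≤ 1 / 4) (hα : ∀ s ∈ Icc 0 b, ‖α s‖ ≤ 4 / 25)
    (hh : ∀ s ∈ Icc 0 b, ‖h s‖ ≤ 4 / 25) (hα0 : ‖α 0‖ ≤ 0.1185) (hh0 : ‖h 0‖ ≤ 0.1185) (j : ℕ)
    (hj : j * (2 * π * ε ^ 3) ≤ b) :
    ∃ c, RadialCurve averaged (1 / 5) (rotating ε α h (j * (2 * π * ε ^ 3))) c ∧
      ‖c‖ ≤ 0.1294 + growth * (j * (2 * π * ε ^ 3)) := by
  set τ := 2 * π * ε ^ 3 with hτ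
  have hτ0 : 0 ≤ τ := by positivity
  induction j with
  | zero =>
    -- Here `r + a = 0.1294` and `5 * 0.1294 ^ 3 ≤ 0.0109`.
    obtain ⟨c, hc⟩ := VdW.exists_radialCurve isTrilinearBound_averaged
      (z := rotating ε α h 0) (r := 0.1185) (a := 0.0109)
      (by rw [norm_rotating]; exact max_le hα0 hh0) (by norm_num) (by norm_num)
    refine ⟨c, by simpa using hc.mono (by norm_num), ?_⟩
    have := hc.norm_right_le
    norm_num at this ⊢
    exact this
  | succ j ih =>
    push_cast at hj ⊢
    rw [add_one_mul] at hj ⊢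
    obtain ⟨c, hc, hcn⟩ := ih (by linarith)
    have hj0 : 0 ≤ j * τ := by positivity
    -- The bootstrap radius `4/25` is adapted to the ball of radius `1/5`: `4/25 + 1/25 = 1/5` and
    -- `5 (1/5)³ = 1/25`, with equality.
    obtain ⟨c', hc'⟩ := VdW.exists_radialCurve isTrilinearBound_averaged
      (z := rotating ε α h (j * τ + τ)) (r := 4 / 25) (a := 1 / 25)
      (by
        have hm : j * τ + τ ∈ Icc 0 b := ⟨by linarith, hj⟩
        rw [norm_rotating]; exact max_le (hα _ hm) (hh _ hm))
      (by norm_num) (by norm_num)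
    have hr : (4 : ℝ) / 25 + 1 / 25 = 1 / 5 := by norm_num
    rw [hr] at hc'
    refine ⟨c', hc', ?_⟩
    have hstep := (H.mono (Icc_subset_Icc hj0 hj)).rotating_step hε hε1
    have hη1 : 2 * π * ε ^ 2 ≤ 1 := by nlinarith [Real.pi_lt_d2, Real.pi_pos]
    have hη2 : (2 * π * ε ^ 2) ^ 2 ≤ 10 * τ := by
      have : (2 * π * ε ^ 2) ^ 2 = 2 * π * ε * τ := by rw [hτ]; ring
      rw [this]
      gcongr
      nlinarith [Real.pi_lt_d2, Real.pi_pos]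
    have := hc.step isTrilinearBound_averaged hc' (by positivity) hη1 hstep
    have h15 : 0 < Real.exp 15 + 1 := by positivity
    have h2 : (Real.exp 15 + 1) * (300 * τ + (2 * π * ε ^ 2) ^ 2) ≤ growth * τ := by
      have e : growth * τ = (Real.exp 15 + 1) * (310 * τ) := by rw [growth]; ring
      rw [e]
      exact mul_le_mul_of_nonneg_left (by linarith) h15.le
    rw [← hτ] at this
    linarith

/-- The improvement step of the bootstrap: the normal-form bound holds at the last full period
before `b`, and the incomplete period adds at most `4ε`. -/
theorem Trajectory.norm_lt {ε b : ℝ} {α h : ℝ → Seq} (H : Trajectory ε 0 b α h)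
    (hε : 0 < ε) (hε1 : ε ≤ 1 / 10000) (hb0 : 0 ≤ b) (hb : growth * b ≤ 1 / 10000)
    (hα : ∀ s ∈ Icc 0 b, ‖α s‖ ≤ 4 / 25)
    (hh : ∀ s ∈ Icc 0 b, ‖h s‖ ≤ 4 / 25) (hα0 : ‖α 0‖ ≤ 0.1185) (hh0 : ‖h 0‖ ≤ 0.1185) :
    ‖α b‖ < 4 / 25 ∧ ‖h b‖ < 4 / 25 := by
  have hε4 : ε ≤ 1 / 4 := by linarith
  set τ := 2 * π * ε ^ 3 with hτ
  have hτ0 : 0 < τ := by positivity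
  set j := ⌊b / τ⌋₊ with hj
  have h1 : j * τ ≤ b := by
    rw [← le_div_iff₀ hτ0]; exact Nat.floor_le (by positivity)
  have h2 : b ≤ j * τ + τ := by
    rw [← add_one_mul, ← div_le_iff₀ hτ0]; exact (Nat.lt_floor_add_one _).le
  obtain ⟨c, hc, hcn⟩ := H.exists_radialCurve hε hε4 hα hh hα0 hh0 j h1
  have h3 := hc.norm_left_le isTrilinearBound_averaged
  have h4 : growth * (j * τ) ≤ growth * b := mul_le_mul_of_nonneg_left h1 growth_pos.le
  -- The product is below `0.1584`, which leaves room under `4/25` for the final `4ε ≤ 0.0004`.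
  have h5 : ‖rotating ε α h (j * τ)‖ ≤ 0.1296 * 1.222 :=
    h3.trans (mul_le_mul (by linarith) exp_fifth_lt.le (Real.exp_pos _).le (by norm_num))
  rw [norm_rotating, max_le_iff] at h5
  have hj0 : 0 ≤ j * τ := by positivity
  have H' := H.mono (Icc_subset_Icc hj0 le_rfl)
  have hm : b ∈ Icc (j * τ) b := ⟨h1, le_rfl⟩
  have h6 := H'.norm_fst_sub_le hε hε4 h2 hm
  have h7 := H'.norm_snd_sub_le hε hε4 h2 hm
  have h8 := norm_le_norm_add_norm_sub' (α b) (α (j * τ))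
  have h9 := norm_le_norm_add_norm_sub' (h b) (h (j * τ))
  have h10 : ε ^ 2 ≤ ε := by nlinarith
  constructor
  · norm_num at h5
    linarith [h5.1]
  · norm_num at h5
    linarith [h5.2]

end Seq

end

end VdW

/-! ### Bootstrap, truncation, interaction variables and uniqueness -/

namespace VdW

noncomputable section

/-- At the first time where `f ≥ r`, an earlier value above `r` would force an earlier crossing by
the intermediate value theorem; so the hypothesis applies at that time and contradicts it. -/
theorem lt_of_bootstrap {f : ℝ → ℝ} {T r : ℝ} (hf : ContinuousOn f (Icc 0 T)) (h0 : f 0 < r)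
    (h : ∀ t ∈ Icc 0 T, (∀ s ∈ Icc 0 t, f s ≤ r) → f t < r) : ∀ t ∈ Icc 0 T, f t < r := by
  by_contra! hc
  obtain ⟨t, ht, hrt⟩ := hc
  have hcl : IsClosed (Icc 0 T ∩ f ⁻¹' Ici r) := hf.preimage_isClosed_of_isClosed isClosed_Icc
    isClosed_Ici
  have hcomp : IsCompact (Icc 0 T ∩ f ⁻¹' Ici r) :=
    isCompact_Icc.of_isClosed_subset hcl inter_subset_left
  obtain ⟨t₁, ⟨ht₁, hrt₁⟩, hmin⟩ := hcomp.exists_isLeast ⟨t, ht, hrt⟩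
  have hsub : Icc 0 t₁ ⊆ Icc 0 T := Icc_subset_Icc_right ht₁.2
  refine (h t₁ ht₁ fun s hs => ?_).not_ge hrt₁
  by_contra! hs'
  obtain ⟨t₂, ht₂, e⟩ := intermediate_value_Icc hs.1 (hf.mono ((Icc_subset_Icc_right hs.2).trans
    hsub)) ⟨h0.le, hs'.le⟩
  have h1 := hmin ⟨hsub ⟨ht₂.1, ht₂.2.trans hs.2⟩, e.ge⟩
  have h2 : t₂ = s := le_antisymm ht₂.2 (hs.2.trans h1)
  rw [h2] at e
  exact hs'.ne' e

theorem norm_retract_scalar {E : Type*} [SeminormedAddCommGroup E] (x : E) :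
    ‖((max 1 ‖x‖ : ℝ) : ℂ)⁻¹‖ = (max 1 ‖x‖)⁻¹ := by
  rw [norm_inv, Complex.norm_real, Real.norm_of_nonneg (by positivity)]

section Retraction

variable {E : Type*} [NormedAddCommGroup E] [NormedSpace ℂ E]

/-- The radial retraction onto the closed unit ball. -/
def retract (x : E) : E := ((max 1 ‖x‖ : ℝ) : ℂ)⁻¹ • x

theorem retract_of_norm_le {x : E} (hx : ‖x‖ ≤ 1) : retract x = x := by
  rw [retract, max_eq_left hx]; simp

theorem norm_retract_le (x : E) : ‖retract x‖ ≤ 1 := by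
  rw [retract, norm_smul, norm_retract_scalar]
  rw [inv_mul_le_iff₀ (by positivity), mul_one]
  exact le_max_right _ _

theorem norm_retract_sub_le (x y : E) : ‖retract x - retract y‖ ≤ 2 * ‖x - y‖ := by
  set a := max 1 ‖x‖ with ha
  set b := max 1 ‖y‖ with hb
  have ha1 : 1 ≤ a := le_max_left _ _
  have hb1 : 1 ≤ b := le_max_left _ _
  have hab : |b - a| ≤ ‖x - y‖ := by
    rw [abs_sub_comm]
    refine (abs_max_sub_max_le_max 1 ‖x‖ 1 ‖y‖).trans ?_
    simpa using abs_norm_sub_norm_le x y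
  have haC : (a : ℂ) ≠ 0 := by exact_mod_cast (by positivity : a ≠ 0)
  have hbC : (b : ℂ) ≠ 0 := by exact_mod_cast (by positivity : b ≠ 0)
  have e : retract x - retract y = (a : ℂ)⁻¹ • (x - y) + ((b - a : ℝ) * (a : ℂ)⁻¹) •
      retract y := by
    rw [retract, retract, ← ha, ← hb, smul_smul, smul_sub, sub_eq_add_neg, sub_eq_add_neg,
      add_assoc, ← neg_smul, ← neg_smul, ← add_smul]
    congr 2
    push_cast
    field_simp
    ring
  rw [e]
  refine (norm_add_le _ _).trans ?_
  have hinv : ‖(a : ℂ)⁻¹‖ ≤ 1 := by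
    rw [norm_retract_scalar]; exact inv_le_one_of_one_le₀ ha1
  rw [norm_smul, norm_smul, norm_mul, Complex.norm_real, Real.norm_eq_abs]
  have h1 : ‖(a : ℂ)⁻¹‖ * ‖x - y‖ ≤ 1 * ‖x - y‖ := by gcongr
  have h2 : |b - a| * ‖(a : ℂ)⁻¹‖ * ‖retract y‖ ≤ ‖x - y‖ * 1 * 1 := by
    gcongr
    exact norm_retract_le y
  linarith

end Retraction

namespace Seq

/-- Coordinate by coordinate, `f` and `f 0 + ∫ g` have the same derivative, hence agree. Continuity
of `g` in `ℓ²` then gives the derivative in norm. -/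
theorem hasDerivWithinAt_of_apply {f g : ℝ → Seq} {T : ℝ} (hT : 0 ≤ T)
    (hg : ContinuousOn g (Icc 0 T)) (h : ∀ t ∈ Icc 0 T, ∀ j : ℤ,
      HasDerivWithinAt (fun s => f s j) (g t j) (Icc 0 T) t) :
    ∀ t ∈ Icc 0 T, HasDerivWithinAt f (g t) (Icc 0 T) t := by
  set G := IccExtend hT ((Icc 0 T).domRestrict g) with hG
  have hGc : Continuous G := (continuousOn_iff_continuous_domRestrict.1 hg).Icc_extend'
  have hGg : ∀ t ∈ Icc 0 T, G t = g t := fun t ht => by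
    rw [hG, IccExtend_of_mem hT _ ht]; rfl
  have hder : ∀ t, HasDerivAt (fun t => f 0 + ∫ s in (0 : ℝ)..t, G s) (G t) t := fun t =>
    (hGc.integral_hasStrictDerivAt 0 t).hasDerivAt.const_add _
  have heq : ∀ t ∈ Icc 0 T, f t = f 0 + ∫ s in (0 : ℝ)..t, G s := fun t ht => by
    ext j
    have h1 : ∀ s ∈ Icc 0 T, HasDerivWithinAt
        (fun s => f s j - (f 0 + ∫ r in (0 : ℝ)..s, G r) j) 0 (Icc 0 T) s := fun s hs => by
      have := (h s hs j).sub ((hder s).hasDerivWithinAt.complex_clm (A := eval j))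
      rw [eval_apply, hGg s hs, sub_self] at this
      exact this
    have h2 := norm_image_sub_le_of_norm_deriv_le_segment' h1 (C := 0) (by simp) t ht
    rw [zero_mul, norm_le_zero_iff, intervalIntegral.integral_same, add_zero, sub_self, sub_zero]
      at h2
    exact sub_eq_zero.1 h2
  intro t ht
  rw [← hGg t ht]
  exact (hder t).hasDerivWithinAt.congr heq (heq t ht)

/-- The Fourier modes `γ` of `∂ₓ u₁` and `w` of the conjugate of `u₂`, for a solution on the
circle with frequencies `κ ℤ`. -/
structure Modal (ε κ T : ℝ) (γ w : ℝ → Seq) : Prop where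
  continuousOn_fst : ContinuousOn γ (Icc 0 T)
  continuousOn_snd : ContinuousOn w (Icc 0 T)
  zero_fst : ∀ t ∈ Icc 0 T, γ t 0 = 0
  zero_snd : ∀ t ∈ Icc 0 T, w t 0 = 0
  deriv_fst : ∀ t ∈ Icc 0 T, ∀ j : ℤ,
    HasDerivWithinAt (fun s => γ s j) (-(Complex.I * κ * j ^ 2 * w t j)) (Icc 0 T) t
  deriv_snd : ∀ t ∈ Icc 0 T, ∀ j : ℤ, HasDerivWithinAt (fun s => w s j)
    (-(Complex.I * κ * nl (γ t) j) - Complex.I * ε * κ ^ 2 * j ^ 2 * w t j) (Icc 0 T) t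

theorem hasDerivAt_phase (c t : ℝ) : HasDerivAt (fun t : ℝ => Complex.exp (-(c * t : ℝ) * Complex.I))
    (-(c * Complex.I) * Complex.exp (-(c * t : ℝ) * Complex.I)) t := by
  have h1 : HasDerivAt (fun t : ℝ => (-(c * t : ℝ) * Complex.I : ℂ)) (-(c * Complex.I)) t := by
    have := (((hasDerivAt_id t).const_mul c).neg.ofReal_comp).mul_const Complex.I
    simpa using this
  have := h1.cexp
  rwa [mul_comm] at this

/-- The vector field of the system in interaction variables. -/
def field (F : Seq → Seq) (ε κ t : ℝ) (p : Seq × Seq) : Seq × Seq :=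
  ((Complex.I / ε : ℂ) • F (p.1 + ((ε * κ)⁻¹ : ℂ) • group (ε * κ ^ 2 * t) p.2),
    (-(Complex.I * κ) : ℂ) • group (-(ε * κ ^ 2 * t))
      (F (p.1 + ((ε * κ)⁻¹ : ℂ) • group (ε * κ ^ 2 * t) p.2)))

theorem norm_state_sub_le {ε κ : ℝ} (hε : 0 < ε) (hκ : 0 < κ) (t : ℝ) (p p' : Seq × Seq) :
    ‖(p.1 + ((ε * κ)⁻¹ : ℂ) • group (ε * κ ^ 2 * t) p.2) -
      (p'.1 + ((ε * κ)⁻¹ : ℂ) • group (ε * κ ^ 2 * t) p'.2)‖ ≤ (1 + (ε * κ)⁻¹) * ‖p - p'‖ := by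
  have e : (p.1 + ((ε * κ)⁻¹ : ℂ) • group (ε * κ ^ 2 * t) p.2) -
      (p'.1 + ((ε * κ)⁻¹ : ℂ) • group (ε * κ ^ 2 * t) p'.2) =
      (p - p').1 + ((ε * κ)⁻¹ : ℂ) • group (ε * κ ^ 2 * t) (p - p').2 := by
    simp only [Prod.fst_sub, Prod.snd_sub, map_sub, smul_sub]; abel
  rw [e]
  refine (norm_add_le _ _).trans ?_
  rw [norm_smul, norm_group, add_mul, one_mul]
  have : ‖((ε * κ)⁻¹ : ℂ)‖ = (ε * κ)⁻¹ := by
    rw [← Complex.ofReal_mul, ← Complex.ofReal_inv, Complex.norm_real,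
      Real.norm_of_nonneg (by positivity)]
  rw [this]
  gcongr
  · exact norm_fst_le _
  · exact norm_snd_le _

theorem norm_field_sub_le {F : Seq → Seq} {ε κ t K : ℝ} (hε : 0 < ε) (hκ : 0 < κ) (hK : 0 ≤ K)
    {p p' : Seq × Seq}
    (hF : ‖F (p.1 + ((ε * κ)⁻¹ : ℂ) • group (ε * κ ^ 2 * t) p.2) -
      F (p'.1 + ((ε * κ)⁻¹ : ℂ) • group (ε * κ ^ 2 * t) p'.2)‖ ≤
      K * ‖(p.1 + ((ε * κ)⁻¹ : ℂ) • group (ε * κ ^ 2 * t) p.2) -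
        (p'.1 + ((ε * κ)⁻¹ : ℂ) • group (ε * κ ^ 2 * t) p'.2)‖) :
    ‖field F ε κ t p - field F ε κ t p'‖ ≤
      (1 / ε + κ) * (K * (1 + (ε * κ)⁻¹)) * ‖p - p'‖ := by
  have h1 := hF.trans (mul_le_mul_of_nonneg_left (norm_state_sub_le hε hκ t p p') hK)
  have h0 : 0 ≤ K * ((1 + (ε * κ)⁻¹) * ‖p - p'‖) := by positivity
  refine max_le ?_ ?_
  · simp only [field, Prod.fst_sub]
    rw [← smul_sub, norm_smul, norm_div, Complex.norm_I, Complex.norm_real,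
      Real.norm_of_nonneg hε.le]
    calc 1 / ε * _ ≤ (1 / ε + κ) * (K * ((1 + (ε * κ)⁻¹) * ‖p - p'‖)) := by
          gcongr; linarith
      _ = _ := by ring
  · simp only [field, Prod.snd_sub]
    rw [← smul_sub, ← map_sub, norm_smul, norm_group, norm_neg, norm_mul, Complex.norm_I,
      Complex.norm_real, Real.norm_of_nonneg hκ.le, one_mul]
    calc κ * _ ≤ (1 / ε + κ) * (K * ((1 + (ε * κ)⁻¹) * ‖p - p'‖)) := by
          gcongr
          have : 0 < 1 / ε := by positivity
          linarith
      _ = _ := by ring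

theorem norm_field_le {F : Seq → Seq} {ε κ t M : ℝ} (hε : 0 < ε) (hκ : 0 < κ) 
    (hF : ∀ x, ‖F x‖ ≤ M) (p : Seq × Seq) : ‖field F ε κ t p‖ ≤ (1 / ε + κ) * M := by
  have hM : 0 ≤ M := (norm_nonneg _).trans (hF 0)
  have : 0 < 1 / ε := by positivity
  refine max_le ?_ ?_
  · simp only [field]
    rw [norm_smul, norm_div, Complex.norm_I, Complex.norm_real, Real.norm_of_nonneg hε.le]
    exact mul_le_mul (by linarith) (hF _) (norm_nonneg _) (by positivity)
  · simp only [field]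
    rw [norm_smul, norm_group, norm_neg, norm_mul, Complex.norm_I,
      Complex.norm_real, Real.norm_of_nonneg hκ.le, one_mul]
    exact mul_le_mul (by linarith) (hF _) (norm_nonneg _) (by positivity)

theorem continuous_field {F : Seq → Seq} (hF : Continuous F) (ε κ : ℝ) :
    Continuous fun x : ℝ × (Seq × Seq) => field F ε κ x.1 x.2 := by
  have h1 : Continuous fun x : ℝ × (Seq × Seq) =>
      F (x.2.1 + ((ε * κ)⁻¹ : ℂ) • group (ε * κ ^ 2 * x.1) x.2.2) :=
    hF.comp (by
      have := Continuous.seqGroup (X := ℝ × (Seq × Seq)) (θ := fun x => ε * κ ^ 2 * x.1)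
        (f := fun x => x.2.2) (by fun_prop) (by fun_prop)
      fun_prop)
  have h2 : Continuous fun x : ℝ × (Seq × Seq) => group (-(ε * κ ^ 2 * x.1))
      (F (x.2.1 + ((ε * κ)⁻¹ : ℂ) • group (ε * κ ^ 2 * x.1) x.2.2)) :=
    Continuous.seqGroup (by fun_prop) h1
  unfold field
  exact ((ContinuousLinearMap.lsmul ℂ ℂ (E := Seq) (Complex.I / ε : ℂ)).continuous.comp h1).prodMk
    ((ContinuousLinearMap.lsmul ℂ ℂ (E := Seq) (-(Complex.I * κ) : ℂ)).continuous.comp h2)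

/-- The interaction variables of a modal solution. -/
def interaction (ε κ : ℝ) (γ w : ℝ → Seq) (t : ℝ) : Seq × Seq :=
  (γ t - ((ε * κ)⁻¹ : ℂ) • w t, group (-(ε * κ ^ 2 * t)) (w t))

theorem interaction_state (ε κ : ℝ) (γ w : ℝ → Seq) (t : ℝ) :
    (interaction ε κ γ w t).1 + ((ε * κ)⁻¹ : ℂ) •
      group (ε * κ ^ 2 * t) (interaction ε κ γ w t).2 = γ t := by
  simp only [interaction]
  rw [group_group_neg, sub_add_cancel]

namespace Modal

variable {ε κ T : ℝ} {γ w γ' w' : ℝ → Seq}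

theorem continuousOn_interaction (H : Modal ε κ T γ w) :
    ContinuousOn (interaction ε κ γ w) (Icc 0 T) := by
  have h1 := H.continuousOn_fst
  have h2 := H.continuousOn_snd
  have h3 : ContinuousOn (fun t => group (-(ε * κ ^ 2 * t)) (w t)) (Icc 0 T) :=
    ContinuousOn.seqGroup (by fun_prop) h2
  have h4 : ContinuousOn (fun t => γ t - ((ε * κ)⁻¹ : ℂ) • w t) (Icc 0 T) := by fun_prop
  exact h4.prodMk h3

/-- The terms with `j²` cancel in the first component and are absorbed by the phase in the second,
so the derivative is a continuous `ℓ²` valued function although `γ` and `w` are only differentiable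
mode by mode. -/
theorem hasDerivWithinAt_interaction (H : Modal ε κ T γ w) (hε : 0 < ε) (hκ : 0 < κ)
    (hT : 0 ≤ T) : ∀ t ∈ Icc 0 T, HasDerivWithinAt (interaction ε κ γ w)
      (field nl ε κ t (interaction ε κ γ w t)) (Icc 0 T) t := by
  have hεC : (ε : ℂ) ≠ 0 := by exact_mod_cast hε.ne'
  have hκC : (κ : ℂ) ≠ 0 := by exact_mod_cast hκ.ne'
  have hN : ContinuousOn (fun t => nl (γ t)) (Icc 0 T) :=
    continuous_nl.comp_continuousOn H.continuousOn_fst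
  have h1 : ∀ t ∈ Icc 0 T, HasDerivWithinAt (fun t => γ t - ((ε * κ)⁻¹ : ℂ) • w t)
      ((Complex.I / ε : ℂ) • nl (γ t)) (Icc 0 T) t :=
    hasDerivWithinAt_of_apply hT (by fun_prop) fun t ht j => by
      refine ((H.deriv_fst t ht j).sub ((H.deriv_snd t ht j).const_mul
        ((ε * κ)⁻¹ : ℂ))).congr_deriv ?_
      rw [smul_apply]
      field_simp
      ring
  have hG : ContinuousOn (fun t => group (-(ε * κ ^ 2 * t)) (nl (γ t))) (Icc 0 T) :=
    ContinuousOn.seqGroup (by fun_prop) hN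
  have h2 : ∀ t ∈ Icc 0 T, HasDerivWithinAt (fun t => group (-(ε * κ ^ 2 * t)) (w t))
      ((-(Complex.I * κ) : ℂ) • group (-(ε * κ ^ 2 * t)) (nl (γ t))) (Icc 0 T) t :=
    hasDerivWithinAt_of_apply hT (by fun_prop) fun t ht j => by
      have := ((hasDerivAt_phase (-(j ^ 2 * (ε * κ ^ 2))) t).hasDerivWithinAt
        (s := Icc 0 T)).mul (H.deriv_snd t ht j)
      have e : ∀ t : ℝ, -(j ^ 2 * (ε * κ ^ 2)) * t = (j : ℝ) ^ 2 * (-(ε * κ ^ 2 * t)) :=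
        fun t => by ring
      simp only [e] at this
      refine (this.congr_deriv ?_).congr (fun s _ => group_apply _ _ _) (group_apply _ _ _)
      rw [smul_apply, group_apply]
      push_cast
      ring
  intro t ht
  refine ((h1 t ht).prodMk (h2 t ht)).congr_deriv ?_
  rw [field, interaction_state]

/-- On a compact time interval both `γ` and `γ'` are bounded by some `r`, and the field is Lipschitz
on the set where the reconstructed `γ` has norm at most `r`. -/
theorem eqOn (H : Modal ε κ T γ w) (H' : Modal ε κ T γ' w') (hε : 0 < ε) (hκ : 0 < κ)
    (h0 : γ 0 = γ' 0) (h0' : w 0 = w' 0) : ∀ t ∈ Icc 0 T, γ t = γ' t ∧ w t = w' t := by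
  intro t ht
  have hT : 0 ≤ T := ht.1.trans ht.2
  obtain ⟨K, hK⟩ := isCompact_Icc.exists_bound_of_continuousOn H.continuousOn_fst
  obtain ⟨K', hK'⟩ := isCompact_Icc.exists_bound_of_continuousOn H'.continuousOn_fst
  set r := max K K' with hr
  set S : ℝ → Set (Seq × Seq) := fun t =>
    {p | ‖p.1 + ((ε * κ)⁻¹ : ℂ) • group (ε * κ ^ 2 * t) p.2‖ ≤ r} with hS
  have hL : (0 : ℝ) ≤ (1 / ε + κ) * ((1 + 30 * r ^ 2) * (1 + (ε * κ)⁻¹)) := by positivity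
  have key := ODE_solution_unique_of_mem_Icc_right (v := field nl ε κ) (s := S)
    (K := ⟨_, hL⟩) (a := 0) (b := T)
    (fun t _ => LipschitzOnWith.of_dist_le_mul fun p hp p' hp' => by
      rw [dist_eq_norm, dist_eq_norm]
      exact norm_field_sub_le hε hκ (by positivity) (norm_nl_sub_le hp hp'))
    H.continuousOn_interaction
    (fun t ht => (H.hasDerivWithinAt_interaction hε hκ hT t
      (Ico_subset_Icc_self ht)).mono_of_mem_nhdsWithin (Icc_mem_nhdsGE_of_mem ht))
    (fun t ht => by
      change ‖_‖ ≤ r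
      rw [interaction_state]
      exact (hK t (Ico_subset_Icc_self ht)).trans (le_max_left _ _))
    H'.continuousOn_interaction
    (fun t ht => (H'.hasDerivWithinAt_interaction hε hκ hT t
      (Ico_subset_Icc_self ht)).mono_of_mem_nhdsWithin (Icc_mem_nhdsGE_of_mem ht))
    (fun t ht => by
      change ‖_‖ ≤ r
      rw [interaction_state]
      exact (hK' t (Ico_subset_Icc_self ht)).trans (le_max_right _ _))
    (by simp [interaction, h0, h0']) ht
  constructor
  · rw [← interaction_state ε κ γ w t, key, interaction_state]
  · have := congrArg (fun p => group (ε * κ ^ 2 * t) p.2) key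
    simpa only [interaction, group_group_neg] using this

end Modal

end Seq

end

end VdW

/-! ### Existence and uniform bounds on the shortest circle -/

namespace VdW

noncomputable section

namespace Seq

theorem continuous_retract {E : Type*} [NormedAddCommGroup E] [NormedSpace ℂ E] :
    Continuous (retract : E → E) :=
  (LipschitzWith.of_dist_le_mul (K := 2) fun x y => by
    rw [dist_eq_norm, dist_eq_norm]; exact norm_retract_sub_le x y).continuous

/-- A globally Lipschitz truncation of the nonlinearity. -/
def cutNl (f : Seq) : Seq := proj (nl (retract f))

theorem continuous_cutNl : Continuous cutNl :=
  proj.continuous.comp (continuous_nl.comp continuous_retract)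

/-- Why `cutNl` contains a projection: means are conserved before anything is known about the size
of the solution. -/
theorem cutNl_apply_zero (f : Seq) : cutNl f 0 = 0 := by rw [cutNl, proj_apply, if_pos rfl]

theorem cutNl_eq {f : Seq} (hf : ‖f‖ ≤ 1) (h0 : f 0 = 0) : cutNl f = nl f := by
  rw [cutNl, retract_of_norm_le hf, proj_eq_self (nl_apply_zero h0)]

theorem norm_cutNl_le (f : Seq) : ‖cutNl f‖ ≤ 11 := by
  refine (norm_proj_le _).trans ((norm_nl_le (norm_retract_le f)).trans ?_)
  norm_num

theorem norm_cutNl_sub_le (f g : Seq) : ‖cutNl f - cutNl g‖ ≤ 62 * ‖f - g‖ := by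
  rw [cutNl, cutNl, ← map_sub]
  refine (norm_proj_le _).trans ((norm_nl_sub_le (norm_retract_le f) (norm_retract_le g)).trans ?_)
  have := norm_retract_sub_le f g
  linarith

/-- The first modal unknown in terms of the interaction variables. -/
def state (ε κ : ℝ) (c : ℝ → Seq × Seq) (t : ℝ) : Seq :=
  (c t).1 + ((ε * κ)⁻¹ : ℂ) • group (ε * κ ^ 2 * t) (c t).2

theorem exists_interaction (ε κ : ℝ) (hε : 0 < ε) (hκ : 0 < κ) {T : ℝ} (hT : 0 ≤ T)
    (x₀ : Seq × Seq) : ∃ c : ℝ → Seq × Seq, c 0 = x₀ ∧ ∀ t ∈ Icc 0 T,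
      HasDerivWithinAt c (field cutNl ε κ t (c t)) (Icc 0 T) t := by
  have hM : 0 ≤ (1 / ε + κ) * 11 := by positivity
  have hK : 0 ≤ (1 / ε + κ) * (62 * (1 + (ε * κ)⁻¹)) := by positivity
  -- The truncated field is bounded by `M = (1/ε + κ) * 11`, so the radius `M * T` suffices for the
  -- whole interval.
  have hP : IsPicardLindelof (field cutNl ε κ) (⟨0, left_mem_Icc.2 hT⟩ : Icc 0 T) x₀
      (⟨_, hM⟩ * ⟨T, hT⟩) 0 ⟨_, hM⟩ ⟨_, hK⟩ :=
    { lipschitzOnWith := fun t _ => LipschitzOnWith.of_dist_le_mul fun p _ p' _ => by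
        rw [dist_eq_norm, dist_eq_norm]
        exact norm_field_sub_le hε hκ (by norm_num) (norm_cutNl_sub_le _ _)
      continuousOn := fun x _ => ((continuous_field continuous_cutNl ε κ).comp
        (Continuous.prodMk_left x)).continuousOn
      norm_le := fun t _ x _ => norm_field_le hε hκ norm_cutNl_le x
      mul_max_le := by
        change (1 / ε + κ) * 11 * max (T - 0) (0 - 0) ≤ (1 / ε + κ) * 11 * T - 0
        rw [sub_zero, sub_zero, max_eq_left hT, sub_zero] }
  obtain ⟨c, h0, -, hc⟩ := hP.exists_mem_closedBall
  exact ⟨c, h0, hc⟩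

theorem apply_zero_of_deriv {f : ℝ → Seq} {f' : ℝ → Seq} {T : ℝ} (h0 : f 0 0 = 0)
    (hf : ∀ t ∈ Icc 0 T, HasDerivWithinAt f (f' t) (Icc 0 T) t) (hf' : ∀ t, f' t 0 = 0) :
    ∀ t ∈ Icc 0 T, f t 0 = 0 := fun t ht => by
  have := norm_image_sub_le_of_norm_deriv_le_segment' (C := 0)
    (fun s hs => (hf s hs).complex_clm (A := eval 0)) (fun s _ => by simp [hf' s]) t ht
  simpa [h0] using this

theorem Modal.of_interaction {ε κ T : ℝ} {c : ℝ → Seq × Seq} (hε : 0 < ε) (hκ : 0 < κ)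
    (hc : ∀ t ∈ Icc 0 T, HasDerivWithinAt c (field nl ε κ t (c t)) (Icc 0 T) t)
    (h1 : ∀ t ∈ Icc 0 T, (c t).1 0 = 0) (h2 : ∀ t ∈ Icc 0 T, (c t).2 0 = 0) :
    Modal ε κ T (state ε κ c) (fun t => group (ε * κ ^ 2 * t) (c t).2) := by
  have hεC : (ε : ℂ) ≠ 0 := by exact_mod_cast hε.ne'
  have hκC : (κ : ℂ) ≠ 0 := by exact_mod_cast hκ.ne'
  have hcc : ContinuousOn c (Icc 0 T) := fun t ht => (hc t ht).continuousWithinAt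
  have hcw : ContinuousOn (fun t => group (ε * κ ^ 2 * t) (c t).2) (Icc 0 T) :=
    ContinuousOn.seqGroup (by fun_prop) (by fun_prop)
  have hw : ∀ t ∈ Icc 0 T, ∀ j : ℤ, HasDerivWithinAt (fun s => group (ε * κ ^ 2 * s) (c s).2 j)
      (-(Complex.I * κ * nl (state ε κ c t) j) -
        Complex.I * ε * κ ^ 2 * j ^ 2 * group (ε * κ ^ 2 * t) (c t).2 j) (Icc 0 T) t := by
    intro t ht j
    have h3 := (hc t ht).complex_clm (A := eval j ∘L ContinuousLinearMap.snd ℂ Seq Seq)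
    have := ((hasDerivAt_phase (j ^ 2 * (ε * κ ^ 2)) t).hasDerivWithinAt (s := Icc 0 T)).mul h3
    have e : ∀ t : ℝ, (j ^ 2 * (ε * κ ^ 2)) * t = (j : ℝ) ^ 2 * (ε * κ ^ 2 * t) :=
      fun t => by ring
    simp only [e] at this
    refine (this.congr_deriv ?_).congr (fun s _ => group_apply _ _ _) (group_apply _ _ _)
    have e3 : (eval j ∘L ContinuousLinearMap.snd ℂ Seq Seq) (field nl ε κ t (c t)) =
        -(Complex.I * κ) * group (-(ε * κ ^ 2 * t)) (nl (state ε κ c t)) j := rfl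
    have e4 : Complex.exp (-((j : ℝ) ^ 2 * (ε * κ ^ 2 * t) : ℝ) * Complex.I) *
        group (-(ε * κ ^ 2 * t)) (nl (state ε κ c t)) j = nl (state ε κ c t) j := by
      rw [← group_apply, group_group_neg]
    have e5 : (eval j ∘L ContinuousLinearMap.snd ℂ Seq Seq) (c t) = (c t).2 j := rfl
    rw [e3, e5, mul_left_comm _ (-(Complex.I * κ)), e4, group_apply]
    push_cast
    ring
  refine ⟨?_, hcw, fun t ht => ?_, fun t ht => by rw [group_apply_zero, h2 t ht], ?_, hw⟩
  · unfold state
    fun_prop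
  · rw [state, add_apply, smul_apply, group_apply_zero, h1 t ht, h2 t ht]; ring
  · intro t ht j
    have h3 := (hc t ht).complex_clm (A := eval j ∘L ContinuousLinearMap.fst ℂ Seq Seq)
    refine (h3.add ((hw t ht j).const_mul ((ε * κ)⁻¹ : ℂ))).congr_deriv ?_
    have e3 : (eval j ∘L ContinuousLinearMap.fst ℂ Seq Seq) (field nl ε κ t (c t)) =
        Complex.I / ε * nl (state ε κ c t) j := rfl
    rw [e3]
    field_simp
    ring

/-- The truncated equation has a solution on `[0, T]`; the bootstrap keeps it in the ball of radius
`4/25`, where the truncation has no effect. -/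
theorem exists_modal {ε T : ℝ} (hε : 0 < ε) (hε1 : ε ≤ 1 / 10000) (hT : 0 ≤ T)
    (hTb : growth * T ≤ 1 / 10000) {γ₀ w₀ : Seq} (hγ : γ₀ 0 = 0) (hw : w₀ 0 = 0)
    (hγn : ‖γ₀‖ ≤ 0.1179) (hwn : ‖w₀‖ ≤ 0.1179) :
    ∃ γ w : ℝ → Seq, Modal ε (ε ^ 2)⁻¹ T γ w ∧ γ 0 = γ₀ ∧ w 0 = w₀ ∧
      ∀ t ∈ Icc 0 T, ‖γ t‖ ≤ 1 / 4 ∧ ‖w t‖ ≤ 1 / 5 := by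
  have hεC : (ε : ℂ) ≠ 0 := by exact_mod_cast hε.ne'
  set κ : ℝ := (ε ^ 2)⁻¹ with hκdef
  have hκ : 0 < κ := by positivity
  have e1 : ((ε * κ)⁻¹ : ℂ) = ε := by rw [hκdef]; push_cast; field_simp
  have e2 : ∀ t, ε * κ ^ 2 * t = t / ε ^ 3 := fun t => by rw [hκdef]; field_simp
  have e3 : (-(Complex.I * κ) : ℂ) = -Complex.I / ε ^ 2 := by
    rw [hκdef]; push_cast; field_simp
  obtain ⟨c, hc0, hc⟩ := exists_interaction ε κ hε hκ hT (γ₀ - (ε : ℂ) • w₀, w₀)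
  have hcc : ContinuousOn c (Icc 0 T) := fun t ht => (hc t ht).continuousWithinAt
  have hεn : ‖(ε : ℂ)‖ = ε := by rw [Complex.norm_real, Real.norm_of_nonneg hε.le]
  have hd1 : ∀ t ∈ Icc 0 T, HasDerivWithinAt (fun t => (c t).1)
      ((Complex.I / ε : ℂ) • cutNl (state ε κ c t)) (Icc 0 T) t := fun t ht =>
    (hc t ht).complex_clm (A := ContinuousLinearMap.fst ℂ Seq Seq)
  have hd2 : ∀ t ∈ Icc 0 T, HasDerivWithinAt (fun t => (c t).2)
      ((-(Complex.I * κ) : ℂ) • group (-(ε * κ ^ 2 * t)) (cutNl (state ε κ c t)))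
      (Icc 0 T) t := fun t ht =>
    (hc t ht).complex_clm (A := ContinuousLinearMap.snd ℂ Seq Seq)
  have hz1 : ∀ t ∈ Icc 0 T, (c t).1 0 = 0 := apply_zero_of_deriv (by
    rw [hc0, sub_apply, smul_apply, hγ, hw]; ring) hd1
    fun t => by rw [smul_apply, cutNl_apply_zero, mul_zero]
  have hz2 : ∀ t ∈ Icc 0 T, (c t).2 0 = 0 := apply_zero_of_deriv (by simp [hc0, hw]) hd2
    fun t => by rw [smul_apply, group_apply_zero, cutNl_apply_zero, mul_zero]
  have hz : ∀ t ∈ Icc 0 T, state ε κ c t 0 = 0 := fun t ht => by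
    rw [state, add_apply, smul_apply, group_apply_zero, hz1 t ht, hz2 t ht]; ring
  have hst : ∀ t, ‖c t‖ ≤ 4 / 25 → ‖state ε κ c t‖ ≤ 1 / 4 := fun t ht => by
    have n1 := (norm_fst_le (c t)).trans ht
    have n2 := (norm_snd_le (c t)).trans ht
    rw [state, e1]
    refine (norm_add_le _ _).trans ?_
    rw [norm_smul, norm_group, hεn]
    nlinarith [norm_nonneg (c t).2]
  -- The margin between `0.1179` and `0.1185` absorbs the term `ε w₀` of the change of unknown.
  have hini : ‖γ₀ - (ε : ℂ) • w₀‖ ≤ 0.1185 := by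
    refine (norm_sub_le _ _).trans ?_
    rw [norm_smul, hεn]
    nlinarith [norm_nonneg w₀]
  have hcut : ∀ t ∈ Icc 0 T, ‖c t‖ ≤ 4 / 25 → cutNl (state ε κ c t) = nl (state ε κ c t) :=
    fun t ht hb => cutNl_eq ((hst t hb).trans (by norm_num)) (hz t ht)
  have hstate : ∀ t, state ε κ c t = (c t).1 + (ε : ℂ) • group (t / ε ^ 3) (c t).2 := fun t => by
    rw [state, e1, e2]
  have hboot : ∀ t ∈ Icc 0 T, ‖c t‖ < 4 / 25 := by
    refine lt_of_bootstrap hcc.norm ?_ fun t ht hb => ?_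
    · rw [hc0]
      exact max_lt (hini.trans_lt (by norm_num)) (hwn.trans_lt (by norm_num))
    · have hsub : Icc 0 t ⊆ Icc 0 T := Icc_subset_Icc_right ht.2
      have H : Trajectory ε 0 t (fun t => (c t).1) (fun t => (c t).2) :=
        { deriv_fst := fun s hs => by
            rw [← hstate, ← hcut s (hsub hs) (hb s hs)]
            exact (hd1 s (hsub hs)).mono hsub
          deriv_snd := fun s hs => by
            rw [← hstate, ← hcut s (hsub hs) (hb s hs), ← e2, ← e3]
            exact (hd2 s (hsub hs)).mono hsub
          zero_fst := fun s hs => hz1 s (hsub hs)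
          zero_snd := fun s hs => hz2 s (hsub hs)
          norm_fst := fun s hs => ((norm_fst_le _).trans (hb s hs)).trans (by norm_num)
          norm_snd := fun s hs => ((norm_snd_le _).trans (hb s hs)).trans (by norm_num) }
      have := H.norm_lt hε hε1 ht.1 ((mul_le_mul_of_nonneg_left ht.2 growth_pos.le).trans hTb)
        (fun s hs => (norm_fst_le _).trans (hb s hs)) (fun s hs => (norm_snd_le _).trans (hb s hs))
        (by rw [hc0]; exact hini) (by rw [hc0]; exact hwn.trans (by norm_num))
      exact max_lt this.1 this.2
  refine ⟨state ε κ c, fun t => group (ε * κ ^ 2 * t) (c t).2,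
    Modal.of_interaction hε hκ (fun t ht => ?_) hz1 hz2, ?_, ?_, fun t ht => ⟨?_, ?_⟩⟩
  · refine (hc t ht).congr_deriv ?_
    have := hcut t ht (hboot t ht).le
    simp only [field]
    rw [state] at this
    rw [this]
  · rw [hstate, hc0]; simp [group_zero]
  · simp [hc0, group_zero]
  · exact hst t (hboot t ht).le
  · rw [norm_group]
    exact (norm_snd_le _).trans ((hboot t ht).le.trans (by norm_num))

end Seq

end

end VdW

/-! ### Fourier coefficients on a circle -/

namespace VdW

noncomputable section

variable {L : ℝ} [hL : Fact (0 < L)]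

/-- A continuous function on the circle, as an element of `L²`. -/
def ofCont : C(AddCircle L, ℂ) →L[ℂ] L2 L := ContinuousMap.toLp 2 volume ℂ

theorem coeFn_ofCont (φ : C(AddCircle L, ℂ)) : ofCont φ =ᵐ[volume] φ :=
  ContinuousMap.coeFn_toLp volume φ

theorem sqrt_pos' : 0 < √L := Real.sqrt_pos.2 hL.out

theorem sqrt_ne_zero : ((√L : ℝ) : ℂ) ≠ 0 := by exact_mod_cast sqrt_pos'.ne'

theorem sqrt_mul_sqrt : ((√L : ℝ) : ℂ) * (√L : ℝ) = L := by
  rw [← Complex.ofReal_mul, Real.mul_self_sqrt hL.out.le]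

theorem length_ne_zero (L : ℝ) [hL : Fact (0 < L)] : (L : ℂ) ≠ 0 := by exact_mod_cast hL.out.ne'

theorem integral_fourier (n : ℤ) : ∫ x : AddCircle L, fourier n x = if n = 0 then (L : ℂ) else 0 := by
  have h1 : ∫ x : AddCircle L, fourier n x =
      (L : ℂ) * ∫ x : AddCircle L, fourier n x ∂AddCircle.haarAddCircle := by
    rw [AddCircle.integral_haarAddCircle, Complex.real_smul, Complex.ofReal_inv,
      mul_inv_cancel_left₀ (length_ne_zero L)]
  rw [h1]
  split_ifs with h
  · simp [h]
  · rw [integral_eq_zero_of_add_right_eq_neg (fourier_add_half_inv_index h hL.elim), mul_zero]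

theorem inner_ofCont (φ : C(AddCircle L, ℂ)) (f : L2 L) :
    inner ℂ (ofCont φ) f = ∫ x, f x * conj (φ x) := by
  rw [L2.inner_def]
  refine integral_congr_ae ?_
  filter_upwards [coeFn_ofCont φ] with x hx
  rw [hx]; rfl

/-- The normalised exponentials. -/
def expVec (n : ℤ) : L2 L := ((√L : ℝ) : ℂ)⁻¹ • ofCont (fourier n)

theorem orthonormal_expVec : Orthonormal ℂ (expVec (L := L)) := by
  rw [orthonormal_iff_ite]
  intro i j
  rw [expVec, expVec, inner_smul_left, inner_smul_right, inner_ofCont]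
  have : ∫ x, ofCont (L := L) (fourier j) x * conj (fourier i x) =
      ∫ x : AddCircle L, fourier (j - i) x := by
    refine integral_congr_ae ?_
    filter_upwards [coeFn_ofCont (L := L) (fourier j)] with x hx
    rw [hx, ← fourier_neg, ← fourier_add, sub_eq_add_neg]
  rw [this, integral_fourier, map_inv₀, Complex.conj_ofReal]
  have := sqrt_mul_sqrt (L := L)
  have h0 := sqrt_ne_zero (L := L)
  by_cases h : i = j
  · rw [if_pos (by omega), if_pos h, ← this]; field_simp
  · rw [if_neg (by omega), if_neg h]; ring

theorem span_expVec : (Submodule.span ℂ (range (expVec (L := L)))).topologicalClosure = ⊤ := by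
  have h := (ContinuousMap.toLp_denseRange ℂ (volume : Measure (AddCircle L)) ℂ
    (p := 2) (by simp)).topologicalClosure_map_submodule span_fourier_closure_eq_top
  rw [Submodule.map_span] at h
  rw [← h]
  congr 1
  refine le_antisymm (Submodule.span_le.2 ?_) (Submodule.span_le.2 ?_)
  · rintro _ ⟨n, rfl⟩
    exact Submodule.smul_mem _ _ (Submodule.subset_span ⟨_, ⟨n, rfl⟩, rfl⟩)
  · rintro _ ⟨_, ⟨n, rfl⟩, rfl⟩
    have e : ofCont (fourier n) = ((√L : ℝ) : ℂ) • expVec (L := L) n := by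
      rw [expVec, smul_inv_smul₀ sqrt_ne_zero]
    change ofCont (fourier n) ∈ _
    rw [e]
    exact Submodule.smul_mem _ _ (Submodule.subset_span ⟨n, rfl⟩)

/-- The Hilbert basis of normalised exponentials. -/
def expBasis : HilbertBasis ℤ ℂ (L2 L) :=
  HilbertBasis.mk orthonormal_expVec span_expVec.ge

theorem expBasis_apply (n : ℤ) : expBasis (L := L) n = expVec n := by
  rw [expBasis, HilbertBasis.coe_mk]

/-- The isometry of `L²` with square summable sequences. -/
def expIso : L2 L ≃ₗᵢ[ℂ] Seq := expBasis.repr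

/-- The sequence of Fourier coefficients. -/
def coeff : L2 L →L[ℂ] Seq :=
  ((√L : ℝ) : ℂ)⁻¹ • expIso.toContinuousLinearEquiv.toContinuousLinearMap

/-- The function with given Fourier coefficients. -/
def synth : Seq →L[ℂ] L2 L :=
  ((√L : ℝ) : ℂ) • expIso.symm.toContinuousLinearEquiv.toContinuousLinearMap

theorem coeff_def (f : L2 L) : coeff f = ((√L : ℝ) : ℂ)⁻¹ • expIso f := rfl

theorem synth_def (a : Seq) : synth (L := L) a = ((√L : ℝ) : ℂ) • expIso.symm a := rfl

theorem coeff_synth (a : Seq) : coeff (synth (L := L) a) = a := by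
  rw [coeff_def, synth_def, map_smul, LinearIsometryEquiv.apply_symm_apply,
    inv_smul_smul₀ sqrt_ne_zero]

theorem synth_coeff (f : L2 L) : synth (coeff f) = f := by
  rw [coeff_def, synth_def, map_smul, LinearIsometryEquiv.symm_apply_apply,
    smul_inv_smul₀ sqrt_ne_zero]

theorem norm_synth (a : Seq) : ‖synth (L := L) a‖ = √L * ‖a‖ := by
  rw [synth_def, norm_smul, LinearIsometryEquiv.norm_map, Complex.norm_real,
    Real.norm_of_nonneg sqrt_pos'.le]

theorem norm_coeff (f : L2 L) : ‖coeff f‖ = ‖f‖ / √L := by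
  rw [eq_div_iff sqrt_pos'.ne', mul_comm, ← norm_synth, synth_coeff]

theorem coeff_injective : Function.Injective (coeff (L := L)) :=
  Function.LeftInverse.injective synth_coeff

theorem expIso_apply (f : L2 L) (n : ℤ) : expIso f n = inner ℂ (expVec n) f := by
  rw [← expBasis_apply]
  exact expBasis.repr_apply_apply f n

theorem coeff_apply (f : L2 L) (n : ℤ) : coeff f n = (L : ℂ)⁻¹ * ∫ x, f x * fourier (-n) x := by
  rw [coeff_def, Seq.smul_apply, expIso_apply, expVec, inner_smul_left, inner_ofCont, map_inv₀,
    Complex.conj_ofReal, ← mul_assoc, ← mul_inv, sqrt_mul_sqrt]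
  simp only [fourier_neg]

theorem integral_mul_fourier (f : L2 L) (n : ℤ) :
    ∫ x, f x * fourier n x = L * coeff f (-n) := by
  rw [coeff_apply, neg_neg, mul_inv_cancel_left₀ (length_ne_zero L)]

theorem coeff_star (f : L2 L) (n : ℤ) : coeff (star f) n = conj (coeff f (-n)) := by
  rw [coeff_apply, coeff_apply, map_mul, map_inv₀, Complex.conj_ofReal, ← integral_conj]
  congr 1
  refine integral_congr_ae ?_
  filter_upwards [Lp.coeFn_star f] with x hx
  rw [hx, Pi.star_apply, map_mul, ← fourier_neg, neg_neg]; rfl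

theorem coeff_ofCont_apply (φ : C(AddCircle L, ℂ)) (n : ℤ) :
    coeff (ofCont φ) n = (L : ℂ)⁻¹ * ∫ x, φ x * fourier (-n) x := by
  rw [coeff_apply]
  congr 1
  refine integral_congr_ae ?_
  filter_upwards [coeFn_ofCont φ] with x hx
  rw [hx]

theorem ofCont_fourier (n : ℤ) : ofCont (L := L) (fourier n) = ((√L : ℝ) : ℂ) • expVec n := by
  rw [expVec, smul_inv_smul₀ sqrt_ne_zero]

/-- The pairing of `L²` with a continuous function. -/
def pair (φ : C(AddCircle L, ℂ)) : L2 L →L[ℂ] ℂ := innerSL ℂ (ofCont (star φ))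

theorem pair_apply (φ : C(AddCircle L, ℂ)) (f : L2 L) : pair φ f = ∫ x, f x * φ x := by
  rw [pair, innerSL_apply_apply, inner_ofCont]
  simp

theorem hasSum_pair (φ : C(AddCircle L, ℂ)) (f : L2 L) :
    HasSum (fun n => coeff f n * coeff (ofCont φ) (-n)) ((L : ℂ)⁻¹ * ∫ x, f x * φ x) := by
  have h := (expBasis (L := L)).hasSum_inner_mul_inner (ofCont (star φ)) f
  have h2 : inner ℂ (ofCont (star φ)) f = ∫ x, f x * φ x := by
    rw [inner_ofCont]; simp
  rw [h2] at h
  refine (congrArg (fun F => HasSum F _) (funext fun n => ?_)).mpr (h.mul_left (L : ℂ)⁻¹)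
  have e1 : inner ℂ (expBasis (L := L) n) f = ((√L : ℝ) : ℂ) * coeff f n := by
    rw [coeff_def, Seq.smul_apply, mul_inv_cancel_left₀ sqrt_ne_zero, expIso_apply,
      expBasis_apply]
  have hs : ((√L : ℝ) : ℂ) * (L : ℂ)⁻¹ = ((√L : ℝ) : ℂ)⁻¹ := by
    have h0 := sqrt_ne_zero (L := L)
    rw [← div_eq_mul_inv, div_eq_iff (length_ne_zero L), ← sqrt_mul_sqrt (L := L), inv_mul_cancel_left₀ h0]
  have e2 : inner ℂ (ofCont (star φ)) (expBasis (L := L) n) =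
      ((√L : ℝ) : ℂ) * coeff (ofCont φ) (-n) := by
    rw [expBasis_apply, expVec, inner_smul_right, inner_ofCont, coeff_ofCont_apply, neg_neg,
      ← mul_assoc, hs]
    congr 1
    refine integral_congr_ae ?_
    filter_upwards [coeFn_ofCont (L := L) (fourier n)] with x hx
    rw [hx, mul_comm]; simp
  rw [e1, e2]
  have h0 := sqrt_ne_zero (L := L)
  rw [mul_mul_mul_comm, sqrt_mul_sqrt, mul_comm (coeff (ofCont φ) (-n)),
    inv_mul_cancel_left₀ (length_ne_zero L)]

/-- Parseval for `U` paired with `V` times an exponential. -/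
theorem hasSum_coeff_mul (U V : C(AddCircle L, ℂ)) (n : ℤ) :
    HasSum (fun p => coeff (ofCont U) p * coeff (ofCont V) (n - p)) (coeff (ofCont (U * V)) n) := by
  have h := hasSum_pair (V * fourier (-n)) (ofCont U)
  have e1 : (L : ℂ)⁻¹ * ∫ x, ofCont U x * (V * fourier (-n) : C(AddCircle L, ℂ)) x = coeff (ofCont (U * V)) n := by
    rw [coeff_ofCont_apply]
    congr 1
    refine integral_congr_ae ?_
    filter_upwards [coeFn_ofCont U] with x hx
    rw [hx, ContinuousMap.mul_apply, ContinuousMap.mul_apply, mul_assoc]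
  rw [e1] at h
  refine (congrArg (fun F => HasSum F _) (funext fun p => ?_)).mpr h
  rw [coeff_ofCont_apply, coeff_ofCont_apply V, coeff_ofCont_apply (V * _)]
  congr 3
  funext x
  rw [ContinuousMap.mul_apply, mul_assoc, ← fourier_add]
  congr 3
  ring

end

end VdW

/-! ### Weak derivatives and `H¹` in terms of Fourier coefficients -/

namespace VdW

noncomputable section

/-- The fundamental frequency of the circle of length `L`. -/
def freq (L : ℝ) : ℝ := 2 * π / L

variable {L : ℝ}

theorem isSmooth_fourier (n : ℤ) : IsSmooth (L := L) (fourier n) := by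
  unfold IsSmooth
  simp only [fourier_coe_apply]
  refine Complex.contDiff_exp.comp (ContDiff.div_const (contDiff_const.mul ?_) _)
  exact Complex.ofRealCLM.contDiff

theorem IsSmooth.mul {φ ψ : AddCircle L → ℂ} (hφ : IsSmooth φ) (hψ : IsSmooth ψ) :
    IsSmooth fun x => φ x * ψ x :=
  ContDiff.mul hφ hψ

theorem IsSmooth.conj {φ : AddCircle L → ℂ} (hφ : IsSmooth φ) : IsSmooth fun x => conj (φ x) :=
  Complex.conjCLE.contDiff.comp hφ

theorem IsSmooth.differentiableAt {φ : AddCircle L → ℂ} (hφ : IsSmooth φ) (x : ℝ) :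
    DifferentiableAt ℝ (fun s : ℝ => φ (s : AddCircle L)) x :=
  (ContDiff.differentiable hφ (by simp)).differentiableAt

theorem dx_mul {φ ψ : AddCircle L → ℂ} (hφ : IsSmooth φ) (hψ : IsSmooth ψ) (x : AddCircle L) :
    dx (fun x => φ x * ψ x) x = dx φ x * ψ x + φ x * dx ψ x := by
  induction x using QuotientAddGroup.induction_on with
  | H x =>
    refine (dx_coe _ x).trans ?_
    have e1 := dx_coe φ x
    have e2 := dx_coe ψ x
    refine (deriv_fun_mul (hφ.differentiableAt x) (hψ.differentiableAt x)).trans ?_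
    rw [← e1, ← e2]

theorem dx_conj {φ : AddCircle L → ℂ} (hφ : IsSmooth φ) (x : AddCircle L) :
    dx (fun x => conj (φ x)) x = conj (dx φ x) := by
  induction x using QuotientAddGroup.induction_on with
  | H x =>
    refine (dx_coe _ x).trans ?_
    refine Eq.trans ?_ (congrArg conj (dx_coe φ x).symm)
    exact ((Complex.conjCLE.toContinuousLinearMap.hasFDerivAt (x := φ x)).comp_hasDerivAt x
      (hφ.differentiableAt x).hasDerivAt).deriv

theorem dx_fourier (n : ℤ) (x : AddCircle L) :
    dx (fourier n) x = Complex.I * freq L * n * fourier n x := by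
  induction x using QuotientAddGroup.induction_on with
  | H x =>
    refine (dx_coe _ x).trans ((hasDerivAt_fourier L n x).deriv.trans ?_)
    rw [freq]
    push_cast
    ring_nf

variable [hL : Fact (0 < L)]

theorem freq_pos : 0 < freq L := div_pos Real.two_pi_pos hL.out

theorem freq_ne_zero : (freq L : ℂ) ≠ 0 := by exact_mod_cast freq_pos.ne'

theorem integral_dx {φ : AddCircle L → ℂ} (hφ : IsSmooth φ) : ∫ x, dx φ x = 0 := by
  rw [← AddCircle.intervalIntegral_preimage L 0]
  simp only [dx_coe]
  rw [intervalIntegral.integral_deriv_eq_sub (fun x _ => hφ.differentiableAt x)]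
  · rw [zero_add, AddCircle.coe_period, AddCircle.coe_zero, sub_self]
  · have := hφ.dx.continuous
    have h2 : Continuous fun x : ℝ => dx φ (x : AddCircle L) :=
      this.comp (AddCircle.continuous_mk' L)
    simp only [dx_coe] at h2
    exact h2.intervalIntegrable _ _

theorem Continuous.integrable_circle {φ : AddCircle L → ℂ} (h : Continuous φ) : Integrable φ :=
  h.integrable_of_hasCompactSupport (HasCompactSupport.of_compactSpace φ)

theorem integral_dx_mul {φ ψ : AddCircle L → ℂ} (hφ : IsSmooth φ) (hψ : IsSmooth ψ) :
    ∫ x, dx φ x * ψ x = -∫ x, φ x * dx ψ x := by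
  have h := integral_dx (hφ.mul hψ)
  have h1 : Continuous fun x => dx φ x * ψ x := hφ.dx.continuous.mul hψ.continuous
  have h2 : Continuous fun x => φ x * dx ψ x := hφ.continuous.mul hψ.dx.continuous
  simp only [dx_mul hφ hψ] at h
  rw [integral_add (Continuous.integrable_circle h1) (Continuous.integrable_circle h2)] at h
  exact eq_neg_of_add_eq_zero_left h

/-- A smooth function, as a continuous function. -/
def IsSmooth.toCont {φ : AddCircle L → ℂ} (h : IsSmooth φ) : C(AddCircle L, ℂ) :=
  ⟨φ, h.continuous⟩

theorem coeff_dx {φ : AddCircle L → ℂ} (h : IsSmooth φ) (n : ℤ) :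
    coeff (ofCont h.dx.toCont) n = Complex.I * freq L * n * coeff (ofCont h.toCont) n := by
  rw [coeff_ofCont_apply, coeff_ofCont_apply]
  change _ * ∫ x, dx φ x * fourier (-n) x = _ * (_ * ∫ x, φ x * fourier (-n) x)
  rw [integral_dx_mul h (isSmooth_fourier (-n))]
  simp only [dx_fourier]
  have : ∀ x : AddCircle L, φ x * (Complex.I * freq L * (-n : ℤ) * fourier (-n) x) =
      -(Complex.I * freq L * n) * (φ x * fourier (-n) x) := fun x => by push_cast; ring
  simp only [this]
  rw [integral_const_mul]
  ring

/-- Testing on exponentials gives one direction; Parseval against a smooth test function gives the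
other. -/
theorem hasWeakDeriv_iff {f g : L2 L} :
    HasWeakDeriv f g ↔ ∀ n, coeff g n = Complex.I * freq L * n * coeff f n := by
  constructor
  · intro h n
    have h1 := h _ (isSmooth_fourier (-n))
    simp only [dx_fourier] at h1
    have : ∀ x : AddCircle L, f x * (Complex.I * freq L * (-n : ℤ) * fourier (-n) x) =
      -(Complex.I * freq L * n) * (f x * fourier (-n) x) := fun x => by push_cast; ring
    simp only [this] at h1
    rw [integral_const_mul, neg_mul, neg_inj] at h1
    rw [coeff_apply, coeff_apply, ← h1]
    ring
  · intro h φ hφ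
    have h1 := hasSum_pair hφ.dx.toCont f
    have h2 := hasSum_pair hφ.toCont g
    have h3 : HasSum (fun n => coeff g n * coeff (ofCont hφ.toCont) (-n))
        (-((L : ℂ)⁻¹ * ∫ x, f x * dx φ x)) := by
      refine (congrArg (fun F => HasSum F _) (funext fun n => ?_)).mpr h1.neg
      rw [coeff_dx hφ, h]
      push_cast
      ring
    have h4 := h3.unique h2
    rw [← mul_neg] at h4
    rw [← neg_eq_iff_eq_neg]
    exact mul_left_cancel₀ (inv_ne_zero (length_ne_zero L)) h4

theorem coeff_snd (u : H1 L) (n : ℤ) :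
    coeff (u : WithLp 2 (L2 L × L2 L)).snd n = Complex.I * freq L * n * coeff (toL2 u) n :=
  hasWeakDeriv_iff.1 u.2 n

/-- The element of `H¹` with mean zero and given (rescaled) derivative. -/
def mkH1 (γ : Seq) : H1 L :=
  ⟨WithLp.toLp 2 (synth (Seq.anti γ), synth ((Complex.I * freq L : ℂ) • Seq.proj γ)), by
    refine hasWeakDeriv_iff.2 fun n => ?_
    change coeff (synth _) n = _ * coeff (synth _) n
    rw [coeff_synth, coeff_synth, Seq.smul_apply, Seq.proj_apply, Seq.anti_apply]
    split_ifs with h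
    · simp [h]
    · have : (n : ℂ) ≠ 0 := by exact_mod_cast h
      field_simp⟩

theorem toL2_mkH1 (γ : Seq) : toL2 (mkH1 (L := L) γ) = synth (Seq.anti γ) := rfl

theorem continuous_mkH1 : Continuous (mkH1 (L := L)) := by
  refine Continuous.subtype_mk ?_ _
  refine (WithLp.prod_continuous_toLp 2 _ _).comp ?_
  fun_prop

theorem H1_ext {u v : H1 L} (h : toL2 u = toL2 v) : u = v := by
  refine Subtype.ext ?_
  have h2 : (u : WithLp 2 (L2 L × L2 L)).snd = (v : WithLp 2 (L2 L × L2 L)).snd :=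
    coeff_injective (Seq.ext' fun n => by rw [coeff_snd, coeff_snd, h])
  exact (WithLp.ofLp_injective 2) (Prod.ext h h2)

/-- The Fourier coefficients of `∂ₓ u`, divided by `I * freq L`. -/
def slope : H1 L →ₗ[ℂ] Seq where
  toFun u := (Complex.I * freq L : ℂ)⁻¹ • coeff (u : WithLp 2 (L2 L × L2 L)).snd
  map_add' u v := by
    rw [Submodule.coe_add, WithLp.add_snd, map_add, smul_add]
  map_smul' c u := by
    rw [Submodule.coe_smul, WithLp.smul_snd, map_smul, smul_comm, RingHom.id_apply]

theorem slope_apply (u : H1 L) (n : ℤ) : slope u n = n * coeff (toL2 u) n := by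
  change (Complex.I * freq L : ℂ)⁻¹ * coeff (u : WithLp 2 (L2 L × L2 L)).snd n = _
  have := freq_ne_zero (L := L)
  rw [coeff_snd]
  field_simp [Complex.I_ne_zero]

theorem continuous_slope : Continuous (slope (L := L)) := by
  change Continuous fun u : H1 L =>
    (Complex.I * freq L : ℂ)⁻¹ • coeff (u : WithLp 2 (L2 L × L2 L)).snd
  have : Continuous fun u : H1 L => (u : WithLp 2 (L2 L × L2 L)).snd := by
    exact (WithLp.prod_continuous_ofLp 2 _ _).snd.comp continuous_subtype_val
  fun_prop

theorem norm_slope_le (u : H1 L) : freq L * (√L * ‖slope u‖) ≤ ‖u‖ := by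
  have e : ‖slope u‖ = (freq L)⁻¹ * (‖(u : WithLp 2 (L2 L × L2 L)).snd‖ / √L) := by
    rw [← norm_coeff]
    change ‖(Complex.I * freq L : ℂ)⁻¹ • coeff (u : WithLp 2 (L2 L × L2 L)).snd‖ = _
    rw [norm_smul, norm_inv, norm_mul, Complex.norm_I, one_mul, Complex.norm_real,
      Real.norm_of_nonneg freq_pos.le]
  have h1 := freq_pos (L := L)
  have h2 := sqrt_pos' (L := L)
  rw [e]
  calc _ = ‖(u : WithLp 2 (L2 L × L2 L)).snd‖ := by field_simp
    _ ≤ _ := WithLp.norm_snd_le _ _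

theorem anti_slope {u : H1 L} (h : coeff (toL2 u) 0 = 0) : Seq.anti (slope u) = coeff (toL2 u) := by
  refine Seq.ext' fun n => ?_
  rw [Seq.anti_apply, slope_apply]
  by_cases hn : n = 0
  · rw [hn, h]; simp
  · have : (n : ℂ) ≠ 0 := by exact_mod_cast hn
    field_simp

theorem mkH1_slope {u : H1 L} (h : coeff (toL2 u) 0 = 0) : mkH1 (slope u) = u :=
  H1_ext (by rw [toL2_mkH1, anti_slope h, synth_coeff])

theorem slope_mkH1 {γ : Seq} (h : γ 0 = 0) : slope (mkH1 (L := L) γ) = γ := Seq.ext' fun n => by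
  rw [slope_apply, toL2_mkH1, coeff_synth, ← Seq.int_mul_anti h]

theorem coeff_toL2_mkH1_zero (γ : Seq) : coeff (toL2 (mkH1 (L := L) γ)) 0 = 0 := by
  rw [toL2_mkH1, coeff_synth, Seq.anti_apply]; simp

theorem summable_wave (γ : Seq) :
    Summable fun n => Seq.anti γ n • (fourier n : C(AddCircle L, ℂ)) :=
  Summable.of_norm (by simpa only [norm_smul, fourier_norm, mul_one] using Seq.summable_anti γ)

/-- The continuous representative of the element of `H¹` with given (rescaled) derivative. -/
def wave (γ : Seq) : C(AddCircle L, ℂ) := ∑' n, Seq.anti γ n • fourier n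

theorem norm_wave_apply_le (γ : Seq) (x : AddCircle L) : ‖wave γ x‖ ≤ ∑' n, ‖Seq.anti γ n‖ := by
  refine ((wave γ).norm_coe_le_norm x).trans ?_
  refine (norm_tsum_le_tsum_norm ?_).trans_eq ?_
  · simpa only [norm_smul, fourier_norm, mul_one] using Seq.summable_anti γ
  · simp only [norm_smul, fourier_norm, mul_one]

theorem coeff_ofCont_fourier (m n : ℤ) :
    coeff (ofCont (L := L) (fourier m)) n = if n = m then 1 else 0 := by
  have e : ∀ x : AddCircle L, fourier m x * fourier (-n) x = fourier (m - n) x := fun x => by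
    rw [← fourier_add, sub_eq_add_neg]
  simp only [coeff_ofCont_apply, e, integral_fourier]
  by_cases h : n = m
  · rw [if_pos (by omega), if_pos h, inv_mul_cancel₀ (length_ne_zero L)]
  · rw [if_neg (by omega), if_neg h, mul_zero]

theorem coeff_ofCont_wave (γ : Seq) : coeff (ofCont (wave (L := L) γ)) = Seq.anti γ :=
  Seq.ext' fun n => by
    have h := ((summable_wave (L := L) γ).hasSum.mapL ofCont).mapL (Seq.eval n ∘L coeff)
    refine h.unique ?_
    refine (congrArg (fun F => HasSum F _) (funext fun m => ?_)).mpr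
      (hasSum_ite_eq n (Seq.anti γ n))
    rw [map_smul, map_smul]
    change _ * coeff (ofCont (fourier m)) n = _
    rw [coeff_ofCont_fourier]
    by_cases h : n = m
    · rw [if_pos h, if_pos h.symm, mul_one, h]
    · rw [if_neg h, if_neg (Ne.symm h), mul_zero]

theorem ofCont_wave (γ : Seq) : ofCont (wave (L := L) γ) = synth (Seq.anti γ) := by
  rw [← coeff_ofCont_wave (L := L), synth_coeff]

theorem coeFn_mkH1 (γ : Seq) : toL2 (mkH1 (L := L) γ) =ᵐ[volume] wave γ := by
  rw [toL2_mkH1, ← ofCont_wave]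
  exact coeFn_ofCont _

theorem coeff_wave_mul (γ : Seq) (V : C(AddCircle L, ℂ)) :
    coeff (ofCont (wave γ * V)) = Seq.mul γ (coeff (ofCont V)) := Seq.ext' fun n => by
  have h := hasSum_coeff_mul (wave γ) V n
  rw [coeff_ofCont_wave] at h
  exact h.unique (Seq.hasSum_mul_apply _ _ _)

/-- The pressure of a wave. -/
def pressure (γ : Seq) : C(AddCircle L, ℂ) := -wave γ + wave γ * (wave γ * wave γ)

/-- Identifies the algebraic `nl` with the derivative of the pressure of an actual function. -/
theorem coeff_pressure {γ : Seq} (h : γ 0 = 0) (n : ℤ) :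
    n * coeff (ofCont (pressure (L := L) γ)) n = Seq.nl γ n := by
  rw [pressure, map_add, map_neg, map_add, map_neg, coeff_wave_mul, coeff_wave_mul,
    coeff_ofCont_wave, Seq.add_apply, Seq.neg_apply, Seq.nl, Seq.add_apply, Seq.neg_apply,
    Seq.tri_eq _ _ _ h h h, mul_add, mul_neg, ← Seq.int_mul_anti h]

theorem p0_mkH1 (γ : Seq) : (fun x => p0 (toL2 (mkH1 (L := L) γ) x)) =ᵐ[volume] pressure γ := by
  filter_upwards [coeFn_mkH1 (L := L) γ] with x hx
  rw [hx, p0, pressure]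
  simp only [ContinuousMap.add_apply, ContinuousMap.neg_apply, ContinuousMap.mul_apply]
  ring

end

end VdW

/-! ### Distributional solutions and modal solutions -/

namespace VdW

noncomputable section

theorem _root_.HasDerivWithinAt.complex_conj {f : ℝ → ℂ} {f' : ℂ} {s : Set ℝ} {t : ℝ}
    (h : HasDerivWithinAt f f' s t) : HasDerivWithinAt (fun t => conj (f t)) (conj f') s t :=
  (Complex.conjCLE.toContinuousLinearMap.hasFDerivAt (x := f t)).comp_hasDerivWithinAt t h

theorem eq_zero_of_deriv {f : ℝ → ℂ} {T : ℝ} (h0 : f 0 = 0)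
    (hf : ∀ t ∈ Icc 0 T, HasDerivWithinAt f 0 (Icc 0 T) t) : ∀ t ∈ Icc 0 T, f t = 0 :=
  fun t ht => by
  have := norm_image_sub_le_of_norm_deriv_le_segment' (C := 0) hf (fun s _ => by simp) t ht
  simpa [h0] using this

theorem dx_const_mul {L : ℝ} (c : ℂ) (φ : AddCircle L → ℂ) (x : AddCircle L) :
    dx (fun x => c * φ x) x = c * dx φ x :=
  deriv_const_mul_field c

variable {L : ℝ} [hL : Fact (0 < L)]

theorem norm_star_sub_star (f g : L2 L) : ‖star f - star g‖ = ‖f - g‖ := by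
  have h : ∀ᵐ x, ‖(star f - star g : L2 L) x‖ = ‖(f - g : L2 L) x‖ := by
    filter_upwards [Lp.coeFn_star f, Lp.coeFn_star g, Lp.coeFn_sub f g,
      Lp.coeFn_sub (star f) (star g)] with x h1 h2 h3 h4
    rw [h3, h4, Pi.sub_apply, Pi.sub_apply, h1, h2, Pi.star_apply, Pi.star_apply, ← star_sub,
      norm_star]
  exact le_antisymm (Lp.norm_le_norm_of_ae_le (h.mono fun _ => le_of_eq))
    (Lp.norm_le_norm_of_ae_le (h.mono fun _ => ge_of_eq))

theorem isometry_star_L2 : Isometry (star : L2 L → L2 L) :=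
  Isometry.of_dist_eq fun f g => by rw [dist_eq_norm, dist_eq_norm, norm_star_sub_star]

theorem integral_star_mul (f : L2 L) (φ : AddCircle L → ℂ) :
    ∫ x, (star f) x * φ x = ∫ x, conj (f x) * φ x := by
  refine integral_congr_ae ?_
  filter_upwards [Lp.coeFn_star f] with x hx
  rw [hx]; rfl

theorem integral_synth_smul (c : ℂ) (f : Seq) {φ : AddCircle L → ℂ} (hφ : Continuous φ) :
    ∫ x, synth (c • f) x * φ x = c * ∫ x, synth f x * φ x :=
  (pair_apply ⟨φ, hφ⟩ (synth (c • f))).symm.trans (((pair ⟨φ, hφ⟩ ∘L synth).map_smul c f).trans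
    (congrArg (c * ·) (pair_apply ⟨φ, hφ⟩ (synth f))))

theorem integral_synth_anti {f : Seq} (hf : f 0 = 0) {φ : AddCircle L → ℂ} (hφ : IsSmooth φ) :
    ∫ x, synth (Seq.anti f) x * dx φ x = -(Complex.I * freq L) * ∫ x, synth f x * φ x := by
  have h : HasWeakDeriv (L := L) (synth (Seq.anti f)) (synth ((Complex.I * freq L : ℂ) • f)) :=
    hasWeakDeriv_iff.2 fun n => by
      rw [coeff_synth, coeff_synth, Seq.smul_apply, mul_assoc _ (n : ℂ), ← Seq.int_mul_anti hf]
  rw [h φ hφ, neg_mul, integral_synth_smul _ _ hφ.continuous]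

theorem integral_synth_anti_anti {f : Seq} (hf : f 0 = 0) {φ : AddCircle L → ℂ}
    (hφ : IsSmooth φ) : ∫ x, synth (Seq.anti (Seq.anti f)) x * dx (dx φ) x =
      -(freq L : ℂ) ^ 2 * ∫ x, synth f x * φ x := by
  rw [integral_synth_anti (by simp) hφ.dx, integral_synth_anti hf hφ]
  linear_combination ((freq L : ℂ) ^ 2 * ∫ x, synth f x * φ x) * Complex.I_sq

theorem hasWeakDeriv_pressure {γ : Seq} (hγ : γ 0 = 0) :
    HasWeakDeriv (L := L) (ofCont (pressure γ)) (synth ((Complex.I * freq L : ℂ) • Seq.nl γ)) :=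
  hasWeakDeriv_iff.2 fun n => by
    rw [coeff_synth, Seq.smul_apply, mul_assoc _ (n : ℂ), coeff_pressure hγ]

theorem integral_p0_mul_dx {γ : Seq} (hγ : γ 0 = 0) {φ : AddCircle L → ℂ} (hφ : IsSmooth φ) :
    ∫ x, p0 (toL2 (mkH1 (L := L) γ) x) * dx φ x =
      -(Complex.I * freq L) * ∫ x, synth (Seq.nl γ) x * φ x := by
  have e1 : ∫ x, p0 (toL2 (mkH1 (L := L) γ) x) * dx φ x =
      ∫ x, ofCont (pressure (L := L) γ) x * dx φ x := by
    refine integral_congr_ae ?_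
    filter_upwards [p0_mkH1 (L := L) γ, coeFn_ofCont (pressure (L := L) γ)] with x h1 h2
    rw [h1, h2]
  rw [e1, hasWeakDeriv_pressure hγ φ hφ, neg_mul, integral_synth_smul _ _ hφ.continuous]

theorem integral_conj_p0_mul_dx {γ : Seq} (hγ : γ 0 = 0) {φ : AddCircle L → ℂ}
    (hφ : IsSmooth φ) : ∫ x, conj (p0 (toL2 (mkH1 (L := L) γ) x)) * dx φ x =
      Complex.I * freq L * conj (∫ x, synth (Seq.nl γ) x * conj (φ x)) := by
  have h := congrArg conj (integral_p0_mul_dx (L := L) hγ hφ.conj)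
  rw [← integral_conj] at h
  simp only [dx_conj hφ, map_mul, Complex.conj_conj] at h
  rw [h]
  simp

/-- The modal derivatives contain `j²` and need not be in `ℓ²`. Dividing all modes by `j²` makes
them so, and the two lost derivatives are put on the test function. -/
theorem Seq.Modal.isSolution {ε T : ℝ} {γ w : ℝ → Seq} (hT : 0 ≤ T)
    (H : Seq.Modal ε (freq L) T γ w) :
    IsSolution (L := L) ε T fun t => (mkH1 (γ t), star (synth (w t))) := by
  have hκ := freq_ne_zero (L := L)
  have hγc := H.continuousOn_fst
  have hwc := H.continuousOn_snd
  have hnc : ContinuousOn (fun t => Seq.nl (γ t)) (Icc 0 T) :=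
    Seq.continuous_nl.comp_continuousOn hγc
  have hΓ : ∀ t ∈ Icc 0 T, HasDerivWithinAt (fun t => Seq.anti (Seq.anti (γ t)))
      (-(Complex.I * freq L : ℂ) • w t) (Icc 0 T) t := by
    refine Seq.hasDerivWithinAt_of_apply hT (by fun_prop) fun t ht j => ?_
    simp only [Seq.anti_apply, ← mul_assoc]
    refine ((H.deriv_fst t ht j).const_mul _).congr_deriv ?_
    rw [Seq.smul_apply]
    by_cases hj : j = 0
    · rw [hj, H.zero_snd t ht]; simp
    · have : (j : ℂ) ≠ 0 := by exact_mod_cast hj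
      field_simp
  have hV : ∀ t ∈ Icc 0 T, HasDerivWithinAt (fun t => Seq.anti (Seq.anti (w t)))
      (-(Complex.I * freq L : ℂ) • Seq.anti (Seq.anti (Seq.nl (γ t))) -
        (Complex.I * ε * freq L ^ 2 : ℂ) • w t) (Icc 0 T) t := by
    refine Seq.hasDerivWithinAt_of_apply hT (by fun_prop) fun t ht j => ?_
    simp only [Seq.anti_apply, ← mul_assoc]
    refine ((H.deriv_snd t ht j).const_mul _).congr_deriv ?_
    rw [Seq.sub_apply, Seq.smul_apply, Seq.smul_apply, Seq.anti_apply, Seq.anti_apply]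
    by_cases hj : j = 0
    · rw [hj, H.zero_snd t ht]; simp
    · have : (j : ℂ) ≠ 0 := by exact_mod_cast hj
      field_simp
  refine ⟨?_, fun φ hφ t ht => ?_, fun φ hφ t ht => ?_⟩
  · exact (continuous_mkH1.comp_continuousOn hγc).prodMk
      (isometry_star_L2.continuous.comp_continuousOn (synth.continuous.comp_continuousOn hwc))
  · have h1 := ((hΓ t ht).complex_clm (A := pair hφ.dx.toCont ∘L synth)).const_mul
      (-(Complex.I * freq L : ℂ)⁻¹)
    refine (h1.congr_deriv ?_).congr_of_mem (fun s hs => ?_) ht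
    · rw [map_smul, smul_eq_mul]
      simp only [← integral_star_mul, star_star]
      rw [← mul_assoc, neg_mul_neg, inv_mul_cancel₀ (mul_ne_zero Complex.I_ne_zero hκ), one_mul]
      exact pair_apply _ _
    · have h2 := integral_synth_anti (L := L) (f := Seq.anti (γ s)) (by simp) hφ
      have h3 : (pair hφ.dx.toCont ∘L synth) (Seq.anti (Seq.anti (γ s))) =
          ∫ x, synth (Seq.anti (Seq.anti (γ s))) x * dx φ x := pair_apply _ _
      rw [h3, h2, toL2_mkH1, ← mul_assoc, neg_mul_neg,
        inv_mul_cancel₀ (mul_ne_zero Complex.I_ne_zero hκ), one_mul]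
  · have key : ∀ ψ : AddCircle L → ℂ, IsSmooth ψ →
        HasDerivWithinAt (fun s => ∫ x, synth (w s) x * ψ x)
        (-(Complex.I * freq L) * (∫ x, synth (Seq.nl (γ t)) x * ψ x) +
          Complex.I * ε * ∫ x, synth (w t) x * dx (dx ψ) x) (Icc 0 T) t := by
      intro ψ hψ
      have h1 := ((hV t ht).complex_clm (A := pair hψ.dx.dx.toCont ∘L synth)).const_mul
        (-((freq L : ℂ) ^ 2)⁻¹)
      have hp : ∀ f : Seq, (pair hψ.dx.dx.toCont ∘L synth) f = ∫ x, synth f x * dx (dx ψ) x :=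
        fun f => pair_apply _ _
      refine (h1.congr_deriv ?_).congr_of_mem (fun s hs => ?_) ht
      · rw [map_sub, map_smul, map_smul, smul_eq_mul, smul_eq_mul, hp, hp,
          integral_synth_anti_anti (Seq.nl_apply_zero (H.zero_fst t ht)) hψ]
        field_simp
        ring
      · rw [hp, integral_synth_anti_anti (H.zero_snd s hs) hψ]
        field_simp
    have h1 := (key _ hφ.conj).complex_conj
    refine (h1.congr_deriv ?_).congr_of_mem (fun s hs => ?_) ht
    · rw [integral_conj_p0_mul_dx (H.zero_fst t ht) hφ, map_add, map_mul, map_mul, ← integral_conj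
        (f := fun x => synth (w t) x * _)]
      simp only [integral_star_mul]
      have e1 : dx (fun x => conj (φ x)) = fun x => conj (dx φ x) := funext (dx_conj hφ)
      simp only [e1, dx_conj hφ.dx, map_mul, Complex.conj_conj, map_neg, Complex.conj_I,
        Complex.conj_ofReal]
      ring
    · rw [integral_star_mul, ← integral_conj]
      simp

/-- Testing on exponentials gives the modal equations. The mean of `u₁` is shown to vanish first,
because the nonlinear term is computed by recovering `u₁` from its derivative. -/
theorem IsSolution.modal {ε T : ℝ} {v : ℝ → H1 L × L2 L} (H : IsSolution ε T v)
    (h0 : coeff (toL2 (v 0).1) 0 = 0) (h0' : coeff (v 0).2 0 = 0) :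
    (∀ t ∈ Icc 0 T, coeff (toL2 (v t).1) 0 = 0) ∧
    Seq.Modal ε (freq L) T (fun t => slope (v t).1) (fun t => coeff (star (v t).2)) := by
  have d1 : ∀ t ∈ Icc 0 T, ∀ j : ℤ, HasDerivWithinAt (fun s => coeff (toL2 (v s).1) j)
      (-(Complex.I * freq L * j * coeff (star (v t).2) j)) (Icc 0 T) t := fun t ht j => by
    have h := (H.eq_one _ (isSmooth_fourier (-j)) t ht).const_mul (L : ℂ)⁻¹
    simp only [← coeff_apply] at h
    refine h.congr_deriv ?_
    rw [coeff_apply, ← integral_star_mul]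
    simp only [dx_fourier]
    have : ∀ x : AddCircle L, star (v t).2 x * (Complex.I * freq L * (-j : ℤ) * fourier (-j) x) =
      -(Complex.I * freq L * j) * (star (v t).2 x * fourier (-j) x) := fun x => by push_cast; ring
    simp only [this]
    rw [integral_const_mul]
    ring
  have z1 : ∀ t ∈ Icc 0 T, coeff (toL2 (v t).1) 0 = 0 := eq_zero_of_deriv h0 fun t ht =>
    (d1 t ht 0).congr_deriv (by simp)
  have d2 : ∀ t ∈ Icc 0 T, ∀ j : ℤ, HasDerivWithinAt (fun s => coeff (star (v s).2) j)
      (-(Complex.I * freq L * Seq.nl (slope (v t).1) j) -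
        Complex.I * ε * freq L ^ 2 * j ^ 2 * coeff (star (v t).2) j) (Icc 0 T) t := fun t ht j => by
    have h := ((H.eq_two _ (isSmooth_fourier j) t ht).const_mul (L : ℂ)⁻¹).complex_conj
    have hz : slope (v t).1 0 = 0 := by rw [slope_apply]; simp
    have e1 : ∀ s, (L : ℂ)⁻¹ * ∫ x, (v s).2 x * fourier j x = coeff (v s).2 (-j) := fun s => by
      rw [coeff_apply, neg_neg]
    simp only [e1, ← coeff_star] at h
    refine h.congr_deriv ?_
    have e2 := integral_conj_p0_mul_dx (L := L) hz (isSmooth_fourier j)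
    rw [mkH1_slope (z1 t ht)] at e2
    simp only [← fourier_neg, integral_mul_fourier, coeff_synth, neg_neg] at e2
    rw [e2]
    have e3 : ∀ x : AddCircle L, (v t).2 x * dx (dx (fourier j)) x =
        -((freq L : ℂ) ^ 2 * j ^ 2) * ((v t).2 x * fourier j x) := fun x => by
      have : dx (L := L) (fourier j) = fun x => Complex.I * freq L * j * fourier j x :=
        funext (dx_fourier j)
      rw [this, dx_const_mul, dx_fourier]
      linear_combination ((freq L : ℂ) ^ 2 * j ^ 2 * (v t).2 x * fourier j x) * Complex.I_sq
    simp only [e3]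
    rw [integral_const_mul, coeff_star, integral_mul_fourier]
    simp only [map_mul, map_sub, map_neg, map_pow, Complex.conj_conj, Complex.conj_I,
      Complex.conj_ofReal, map_inv₀, map_intCast]
    have := length_ne_zero L
    field_simp
  have z2 : ∀ t ∈ Icc 0 T, coeff (star (v t).2) 0 = 0 := by
    refine eq_zero_of_deriv (by rw [coeff_star]; simp [h0']) fun t ht => ?_
    refine (d2 t ht 0).congr_deriv ?_
    rw [Seq.nl_apply_zero (by rw [slope_apply]; simp)]
    simp
  refine ⟨z1, ?_, ?_, fun t _ => by rw [slope_apply]; simp, z2, fun t ht j => ?_, d2⟩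
  · exact continuous_slope.comp_continuousOn (continuous_fst.comp_continuousOn H.continuousOn)
  · exact coeff.continuous.comp_continuousOn (isometry_star_L2.continuous.comp_continuousOn
      (continuous_snd.comp_continuousOn H.continuousOn))
  · simp only [slope_apply]
    refine ((d1 t ht j).const_mul (j : ℂ)).congr_deriv ?_
    ring

end

end VdW

/-! ### Dilation of frequencies -/

namespace VdW

noncomputable section

namespace Seq

theorem injOn_ediv (n : ℤ) :
    InjOn (fun j => j / n) {j : ℤ | (if n ∣ j then 1 else 0 : ℂ) ≠ 0} := by
  intro i hi j hj h
  have hd : ∀ {k : ℤ}, (if n ∣ k then 1 else 0 : ℂ) ≠ 0 → n ∣ k := fun h => by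
    by_contra h'
    exact h (if_neg h')
  rw [← Int.mul_ediv_cancel' (hd hi), ← Int.mul_ediv_cancel' (hd hj)]
  exact congrArg (n * ·) h

/-- The Fourier coefficients of `x ↦ u (n x)` in terms of those of `u`. -/
def dilate (n : ℤ) : Seq →L[ℂ] Seq :=
  wcomp (fun j => if n ∣ j then 1 else 0) (fun j => j / n) 1
    (fun j => by split_ifs <;> simp) (injOn_ediv n)

theorem dilate_apply (n : ℤ) (f : Seq) (j : ℤ) :
    dilate n f j = if n ∣ j then f (j / n) else 0 := by
  rw [dilate, wcomp_apply]; split_ifs <;> simp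

variable {n : ℤ}

theorem dilate_apply_mul (hn : n ≠ 0) (f : Seq) (k : ℤ) : dilate n f (n * k) = f k := by
  rw [dilate_apply, if_pos (dvd_mul_right n k), Int.mul_ediv_cancel_left _ hn]

theorem dilate_apply_of_not_dvd (f : Seq) {j : ℤ} (h : ¬ n ∣ j) : dilate n f j = 0 := by
  rw [dilate_apply, if_neg h]

theorem dilate_apply_zero (f : Seq) : dilate n f 0 = f 0 := by
  rw [dilate_apply, if_pos (dvd_zero n), Int.zero_ediv]

theorem dilate_ext (hn : n ≠ 0) {f g : Seq} (h : ∀ j, ¬ n ∣ j → f j = 0)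
    (h' : ∀ k, f (n * k) = g k) : f = dilate n g := ext' fun j => by
  by_cases hj : n ∣ j
  · obtain ⟨k, rfl⟩ := hj
    rw [dilate_apply_mul hn, h']
  · rw [dilate_apply_of_not_dvd g hj, h j hj]

theorem norm_dilate_le (f : Seq) : ‖dilate n f‖ ≤ ‖f‖ :=
  (wcomp_norm_le _ _ _ _ _ f).trans_eq (one_mul _)

theorem mul_left_injective' (hn : n ≠ 0) : Function.Injective fun k : ℤ => n * k :=
  fun _ _ h => mul_left_cancel₀ hn h

theorem not_dvd_of_notMem_range {j : ℤ} (h : j ∉ range fun k : ℤ => n * k) : ¬ n ∣ j :=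
  fun ⟨k, hk⟩ => h ⟨k, hk.symm⟩

theorem anti_dilate (hn : n ≠ 0) (f : Seq) : anti ((n : ℂ) • dilate n f) = dilate n (anti f) := by
  have hn' : (n : ℂ) ≠ 0 := by exact_mod_cast hn
  refine dilate_ext hn (fun j hj => ?_) fun k => ?_
  · rw [anti_apply, smul_apply, dilate_apply_of_not_dvd f hj]; ring
  · rw [anti_apply, smul_apply, dilate_apply_mul hn, anti_apply, Int.cast_mul, mul_inv]
    field_simp

/-- In the convolution, if `n` divides `p` but not `j` then it does not divide `j - p`: outside the
multiples of `n` every term vanishes. The factor `n` compensates the division by frequency built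
into `mul`. -/
theorem mul_dilate (hn : n ≠ 0) (f g : Seq) :
    mul ((n : ℂ) • dilate n f) (dilate n g) = dilate n (mul f g) := by
  have h0 := hasSum_mul_apply ((n : ℂ) • dilate n f) (dilate n g)
  rw [anti_dilate hn] at h0
  refine dilate_ext hn (fun j hj => (h0 j).unique ?_) fun k => (h0 (n * k)).unique ?_
  · refine (congrArg (fun F => HasSum F _) (funext fun p => ?_)).mpr hasSum_zero
    by_cases hp : n ∣ p
    · rw [dilate_apply_of_not_dvd g fun h => hj ((dvd_sub_left hp).1 h), mul_zero]
    · rw [dilate_apply_of_not_dvd _ hp, zero_mul]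
  · refine ((mul_left_injective' hn).hasSum_iff fun j hj => ?_).1 ?_
    · rw [dilate_apply_of_not_dvd _ (not_dvd_of_notMem_range hj), zero_mul]
    · refine (congrArg (fun F => HasSum F _) (funext fun p => ?_)).mpr (hasSum_mul_apply f g k)
      simp only [Function.comp_apply, dilate_apply_mul hn, ← mul_sub]

theorem nl_dilate (hn : n ≠ 0) {f : Seq} (hf : f 0 = 0) :
    nl ((n : ℂ) • dilate n f) = (n : ℂ) • dilate n (nl f) := by
  have h0 : ((n : ℂ) • dilate n f) 0 = 0 := by
    rw [smul_apply, dilate_apply_zero, hf, mul_zero]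
  refine ext' fun j => ?_
  rw [nl, add_apply, neg_apply, tri_eq _ _ _ h0 h0 h0, anti_dilate hn, mul_dilate hn,
    mul_dilate hn, smul_apply, smul_apply]
  by_cases hj : n ∣ j
  · obtain ⟨k, rfl⟩ := hj
    simp only [dilate_apply_mul hn]
    rw [nl, add_apply, neg_apply, tri_eq _ _ _ hf hf hf]
    push_cast
    ring
  · simp only [dilate_apply_of_not_dvd _ hj]
    ring

theorem tsum_norm_dilate (hn : n ≠ 0) (f : Seq) : ∑' j, ‖dilate n f j‖ = ∑' k, ‖f k‖ := by
  rw [← (mul_left_injective' hn).tsum_eq]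
  · simp only [dilate_apply_mul hn]
  · intro j hj
    by_contra h
    exact hj (by
      change ‖dilate n f j‖ = 0
      rw [dilate_apply_of_not_dvd _ (not_dvd_of_notMem_range h), norm_zero])

/-- A solution on a circle, repeated `n` times, solves the system on the circle `n` times as long:
`κ j` is unchanged under `κ ↦ κ/n`, `j ↦ n j`. -/
theorem Modal.dilate {ε κ T : ℝ} {γ w : ℝ → Seq} (H : Modal ε κ T γ w) (hn : n ≠ 0) :
    Modal ε (κ / n) T (fun t => (n : ℂ) • Seq.dilate n (γ t)) (fun t => Seq.dilate n (w t)) := by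
  have hn' : (n : ℂ) ≠ 0 := by exact_mod_cast hn
  have h1 := H.continuousOn_fst
  have h2 := H.continuousOn_snd
  refine ⟨by fun_prop, by fun_prop, fun t ht => ?_, fun t ht => ?_, fun t ht j => ?_,
    fun t ht j => ?_⟩
  · rw [smul_apply, dilate_apply_zero, H.zero_fst t ht, mul_zero]
  · rw [dilate_apply_zero, H.zero_snd t ht]
  · simp only [smul_apply]
    by_cases hj : n ∣ j
    · obtain ⟨k, rfl⟩ := hj
      simp only [dilate_apply_mul hn]
      refine ((H.deriv_fst t ht k).const_mul _).congr_deriv ?_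
      push_cast
      field_simp
    · simp only [dilate_apply_of_not_dvd _ hj, mul_zero, neg_zero]
      exact hasDerivWithinAt_const _ _ _
  · rw [nl_dilate hn (H.zero_fst t ht), smul_apply]
    by_cases hj : n ∣ j
    · obtain ⟨k, rfl⟩ := hj
      simp only [dilate_apply_mul hn]
      refine (H.deriv_snd t ht k).congr_deriv ?_
      push_cast
      field_simp
    · simp only [dilate_apply_of_not_dvd _ hj, mul_zero, neg_zero, sub_zero]
      exact hasDerivWithinAt_const _ _ _

end Seq

end

end VdW

/-! ### Rescaled functions on circles of different lengths -/

namespace VdW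

noncomputable section

section Lift

variable {L : ℝ} [hL : Fact (0 < L)]

theorem ae_coe_of_ae {p : AddCircle L → Prop} (h : ∀ᵐ x : AddCircle L, p x) : ∀ᵐ x : ℝ, p (x : AddCircle L) := by
  have h1 : ∀ᵐ (x : ℝ) ∂(volume.restrict (⋃ n : ℤ, Ioc (n • L) ((n + 1) • L))), p (x : AddCircle L) := by
    refine (ae_restrict_iUnion_iff _ _).2 fun n => ?_
    have := (AddCircle.measurePreserving_mk L (n • L)).quasiMeasurePreserving.ae h
    rwa [← add_one_zsmul] at this
  rwa [iUnion_Ioc_zsmul hL.out, Measure.restrict_univ] at h1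

theorem ae_of_ae_coe {p : AddCircle L → Prop} (hp : MeasurableSet {x | p x})
    (h : ∀ᵐ x : ℝ, p (x : AddCircle L)) : ∀ᵐ x : AddCircle L, p x := by
  have h1 := AddCircle.measurePreserving_mk L 0
  rw [← h1.map_eq]
  exact (ae_map_iff h1.measurable.aemeasurable hp).2 (ae_restrict_of_ae h)

end Lift

/-- The homomorphism of circles induced by `x ↦ x / s`. -/
def scaleHom (L L' s : ℝ) (n : ℤ) (h : L / s = n * L') : AddCircle L →+ AddCircle L' :=
  QuotientAddGroup.lift _ ((QuotientAddGroup.mk' (AddSubgroup.zmultiples L')).comp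
    (AddMonoidHom.mulRight s⁻¹)) (by
      rw [AddSubgroup.zmultiples_le]
      change ((L * s⁻¹ : ℝ) : AddCircle L') = 0
      rw [← div_eq_mul_inv, h, ← zsmul_eq_mul, AddCircle.coe_zsmul, AddCircle.coe_period,
        smul_zero])

section Scale

variable {L L' s : ℝ} {n : ℤ} {h : L / s = n * L'}

theorem scaleHom_coe (x : ℝ) : scaleHom L L' s n h (x : AddCircle L) = ((x / s : ℝ) : AddCircle L') := by
  rw [div_eq_mul_inv]; rfl

theorem continuous_scaleHom : Continuous (scaleHom L L' s n h) :=
  (QuotientAddGroup.isOpenQuotientMap_mk).isQuotientMap.continuous_iff.2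
    ((AddCircle.continuous_mk' L').comp (continuous_id.mul continuous_const))

theorem surjective_scaleHom (hs : s ≠ 0) : Function.Surjective (scaleHom L L' s n h) := fun y => by
  induction y using QuotientAddGroup.induction_on with
  | H y => exact ⟨((y * s : ℝ) : AddCircle L), by rw [scaleHom_coe, mul_div_cancel_right₀ _ hs]⟩

theorem fourier_scaleHom (hL' : L' ≠ 0) (hn : n ≠ 0) (k : ℤ) (x : AddCircle L) :
    fourier k (scaleHom L L' s n h x) = fourier (n * k) x := by
  induction x using QuotientAddGroup.induction_on with
  | H x =>
    have hn' : (n : ℝ) ≠ 0 := by exact_mod_cast hn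
    have hs : s ≠ 0 := by
      rintro rfl
      rw [div_zero] at h
      exact mul_ne_zero hn' hL' h.symm
    have h1 : (s : ℂ) * n * L' = L := by
      rw [div_eq_iff hs] at h
      rw [h]; push_cast; ring
    rw [scaleHom_coe, fourier_coe_apply, fourier_coe_apply]
    congr 1
    rw [← h1]
    have e1 : (n : ℂ) ≠ 0 := by exact_mod_cast hn
    have e2 : (s : ℂ) ≠ 0 := by exact_mod_cast hs
    have e3 : (L' : ℂ) ≠ 0 := by exact_mod_cast hL'
    push_cast
    field_simp

variable [hL : Fact (0 < L)] [hL' : Fact (0 < L')]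

theorem measurePreserving_scaleHom (hs : s ≠ 0) :
    MeasurePreserving (scaleHom L L' s n h) AddCircle.haarAddCircle AddCircle.haarAddCircle :=
  (scaleHom L L' s n h).measurePreserving continuous_scaleHom (surjective_scaleHom hs) (by simp)

/-- At multiples of `n` this is invariance of the Haar measure under `scaleHom`. At other `j`,
translation by `L/n` fixes the composed function but multiplies the exponential by a constant
different from `1`, so the coefficient vanishes. -/
theorem coeff_eq_dilate (hs : s ≠ 0) (hn : n ≠ 0) {a : ℂ} {v : L2 L} {w : L2 L'}
    (hv : ∀ᵐ x, v x = a * w (scaleHom L L' s n h x)) :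
    coeff v = a • Seq.dilate n (coeff w) := by
  have hnR : (n : ℝ) ≠ 0 := by exact_mod_cast hn
  have key : ∀ j : ℤ, coeff v j = a * ∫ x : AddCircle L,
      w (scaleHom L L' s n h x) * fourier (-j) x ∂AddCircle.haarAddCircle := fun j => by
    rw [coeff_apply, AddCircle.integral_haarAddCircle, Complex.real_smul, Complex.ofReal_inv,
      mul_left_comm, ← integral_const_mul a]
    congr 1
    refine integral_congr_ae (hv.mono fun x hx => ?_)
    simp only [hx, mul_assoc]
  have hw : AEStronglyMeasurable w (AddCircle.haarAddCircle (T := L')) :=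
    (Lp.stronglyMeasurable w).aestronglyMeasurable
  refine Seq.ext' fun j => ?_
  rw [key, Seq.smul_apply]
  congr 1
  by_cases hj : n ∣ j
  · obtain ⟨k, rfl⟩ := hj
    rw [Seq.dilate_apply_mul hn, coeff_apply]
    have e : ∀ x, fourier (-(n * k)) x = fourier (-k) (scaleHom L L' s n h x) := fun x => by
      rw [fourier_scaleHom hL'.out.ne' hn, mul_neg]
    simp only [e]
    have hm := measurePreserving_scaleHom (n := n) (h := h) hs
    have h2 : AEStronglyMeasurable (fun y => w y * fourier (-k) y)
        (AddCircle.haarAddCircle (T := L')) := hw.mul (fourier (-k)).continuous.aestronglyMeasurable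
    have h3 := integral_map hm.aemeasurable (by rwa [hm.map_eq])
      (f := fun y => w y * fourier (-k) y)
    rw [hm.map_eq] at h3
    rw [← h3, AddCircle.integral_haarAddCircle, Complex.real_smul, Complex.ofReal_inv]
  · rw [Seq.dilate_apply_of_not_dvd _ hj]
    set I := ∫ x : AddCircle L, w (scaleHom L L' s n h x) * fourier (-j) x ∂AddCircle.haarAddCircle
      with hI
    set y : AddCircle L := ((L / n : ℝ) : AddCircle L) with hy
    have hy0 : scaleHom L L' s n h y = 0 := by
      rw [hy, scaleHom_coe, div_right_comm, h, mul_div_cancel_left₀ _ hnR, AddCircle.coe_period]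
    have h1 := integral_add_right_eq_self (μ := AddCircle.haarAddCircle)
      (fun x : AddCircle L => w (scaleHom L L' s n h x) * fourier (-j) x) y
    have e : ∀ x, w (scaleHom L L' s n h (x + y)) * fourier (-j) (x + y) =
        fourier (-j) y * (w (scaleHom L L' s n h x) * fourier (-j) x) := fun x => by
      rw [map_add, hy0, add_zero, fourier_apply, fourier_apply, fourier_apply, smul_add,
        AddCircle.toCircle_add, Circle.coe_mul]
      ring
    simp only [e] at h1
    rw [integral_const_mul, ← hI] at h1
    have h2 : fourier (-j) y ≠ 1 := by
      intro h3
      rw [hy, fourier_coe_apply, Complex.exp_eq_one_iff] at h3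
      obtain ⟨m, hm⟩ := h3
      have e1 : (n : ℂ) ≠ 0 := by exact_mod_cast hn
      have e2 := length_ne_zero L
      have e3 := Complex.two_pi_I_ne_zero
      have h4 : ((-j : ℤ) : ℂ) / n = m := by
        refine mul_right_cancel₀ e3 (Eq.trans ?_ hm)
        push_cast
        field_simp
      rw [div_eq_iff e1] at h4
      have h5 : -j = m * n := by exact_mod_cast h4
      exact hj ((dvd_neg).1 ⟨m, by rw [h5, mul_comm]⟩)
    by_contra h0
    exact h2 (mul_right_cancel₀ h0 (h1.trans (one_mul I).symm))

theorem exists_comp_scaleHom (hs : s ≠ 0) (a : ℂ) (w : L2 L') :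
    ∃ v : L2 L, ∀ᵐ x, v x = a * w (scaleHom L L' s n h x) := by
  have h1 : MemLp (w ∘ scaleHom L L' s n h) 2 (AddCircle.haarAddCircle (T := L)) :=
    (memLp_haarAddCircle_iff.2 (Lp.memLp w)).comp_measurePreserving (measurePreserving_scaleHom hs)
  have h2 := (memLp_haarAddCircle_iff.1 h1).const_mul a
  exact ⟨h2.toLp _, h2.coeFn_toLp⟩

/-- For the converse, the rescaled function exists in `L²` and coefficients determine it. -/
theorem ae_eq_iff_coeff (hs : s ≠ 0) (hn : n ≠ 0) {a : ℂ} {v : L2 L} {w : L2 L'} :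
    (∀ᵐ x, v x = a * w (scaleHom L L' s n h x)) ↔ coeff v = a • Seq.dilate n (coeff w) := by
  refine ⟨coeff_eq_dilate hs hn, fun hv => ?_⟩
  obtain ⟨v', hv'⟩ := exists_comp_scaleHom (n := n) (h := h) hs a w
  rwa [coeff_injective (hv.trans (coeff_eq_dilate hs hn hv').symm)]

end Scale

theorem isRescaled_iff {L : ℝ} [hL : Fact (0 < L)] {n : ℤ} {a ε : ℝ} (hε : 0 < ε) (hn : n ≠ 0)
    (h : L / ε ^ 2 = n * (2 * π)) {v : L2 L} {w : L2 (2 * π)} :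
    IsRescaled a ε v w ↔ coeff v = (a : ℂ) • Seq.dilate n (coeff w) := by
  have hs : ε ^ 2 ≠ 0 := by positivity
  rw [← ae_eq_iff_coeff (h := h) hs hn]
  have hm : MeasurableSet {x : AddCircle L | v x = a * w (scaleHom L (2 * π) (ε ^ 2) n h x)} :=
    measurableSet_eq_fun (Lp.stronglyMeasurable v).measurable (measurable_const.mul
      ((Lp.stronglyMeasurable w).measurable.comp continuous_scaleHom.measurable))
  constructor
  · exact fun h1 => ae_of_ae_coe hm h1
  · exact fun h1 => ae_coe_of_ae h1

end

end VdW

/-! ### Numerical constants and conclusion -/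

namespace VdW

noncomputable section

theorem norm_star_L2 {L : ℝ} [Fact (0 < L)] (f : L2 L) : ‖star f‖ = ‖f‖ :=
  le_antisymm
    (Lp.norm_le_norm_of_ae_le ((Lp.coeFn_star f).mono fun x hx => by
      rw [hx, Pi.star_apply, norm_star]))
    (Lp.norm_le_norm_of_ae_le ((Lp.coeFn_star f).mono fun x hx => by
      rw [hx, Pi.star_apply, norm_star]))

theorem coeff_zero {L : ℝ} [Fact (0 < L)] {f : L2 L} (hf : ∫ x, f x = 0) : coeff f 0 = 0 := by
  rw [coeff_apply]
  simp [hf]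

theorem coeff_star_dilate {L L' : ℝ} [Fact (0 < L)] [Fact (0 < L')] {n : ℤ} {a : ℝ}
    {v : L2 L} {w : L2 L'} (h : coeff v = (a : ℂ) • Seq.dilate n (coeff w)) :
    coeff (star v) = (a : ℂ) • Seq.dilate n (coeff (star w)) := by
  refine Seq.ext' fun j => ?_
  rw [coeff_star, h, Seq.smul_apply, Seq.smul_apply, map_mul, Complex.conj_ofReal,
    Seq.dilate_apply, Seq.dilate_apply]
  by_cases hj : n ∣ j
  · rw [if_pos hj, if_pos ((dvd_neg).2 hj), coeff_star, Int.neg_ediv_of_dvd hj]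
  · rw [if_neg hj, if_neg fun h => hj ((dvd_neg).1 h), map_zero]

/-- The constant function `1` as an element of `H¹`. -/
def oneH1 (L : ℝ) [Fact (0 < L)] : H1 L :=
  ⟨WithLp.toLp 2 (ofCont (fourier 0), 0), hasWeakDeriv_iff.2 fun n => by
    change coeff 0 n = _ * coeff (ofCont (fourier 0)) n
    rw [coeff_ofCont_fourier, map_zero]
    by_cases h : n = 0 <;> simp [h]⟩

theorem norm_oneH1 (L : ℝ) [Fact (0 < L)] : ‖oneH1 L‖ = √L := by
  change ‖(WithLp.toLp 2 (ofCont (fourier 0), 0) : WithLp 2 (L2 L × L2 L))‖ = √L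
  rw [WithLp.prod_norm_eq_of_L2]
  change √(‖ofCont (L := L) (fourier 0)‖ ^ 2 + ‖(0 : L2 L)‖ ^ 2) = √L
  rw [ofCont_fourier, norm_smul, orthonormal_expVec.1 0, Complex.norm_real,
    Real.norm_of_nonneg sqrt_pos'.le, norm_zero, mul_one, zero_pow two_ne_zero, add_zero,
    Real.sqrt_sq sqrt_pos'.le]

/-- Tests the embedding on the constant `1`, whose `H¹` norm is `√L`. The hypothesis rules out the
value `0` that `sInf` takes on an empty set. -/
theorem inv_sqrt_le_embeddingNorm {L : ℝ} [hL : Fact (0 < L)] (h : embeddingNorm L ≠ 0) :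
    (√L)⁻¹ ≤ embeddingNorm L := by
  refine le_csInf ?_ ?_
  · by_contra! h'
    exact h (by rw [embeddingNorm, h', Real.sInf_empty])
  · rintro C ⟨hC, hC'⟩
    have h1 : ∀ᵐ x : AddCircle L, 1 ≤ C * √L := by
      filter_upwards [hC' (oneH1 L), coeFn_ofCont (L := L) (fourier 0)] with x hx hx'
      have e : toL2 (oneH1 L) x = 1 := hx'.trans fourier_zero
      rwa [e, norm_oneH1, norm_one] at hx
    obtain ⟨x, hx⟩ := h1.exists
    rwa [inv_le_iff_one_le_mul₀ sqrt_pos']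

theorem le_sqrt_pi {lam : ℝ} (h : lam ∈ Ioc 0 (1 / (embeddingNorm (2 * π) * √2))) :
    lam ≤ √π := by
  -- With the convention `1 / 0 = 0`, a vanishing constant would leave no admissible `lam`.
  have h0 : embeddingNorm (2 * π) ≠ 0 := fun h' => by
    rw [h', zero_mul, div_zero] at h
    exact h.1.not_ge h.2
  have h1 := inv_sqrt_le_embeddingNorm h0
  have h2 : (0 : ℝ) < √2 := by positivity
  have h3 : 0 < √π := Real.sqrt_pos.2 Real.pi_pos
  rw [Real.sqrt_mul (by norm_num)] at h1
  have h4 : (√π)⁻¹ ≤ embeddingNorm (2 * π) * √2 :=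
    calc (√π)⁻¹ = (√2 * √π)⁻¹ * √2 := by field_simp
      _ ≤ _ := by gcongr
  refine h.2.trans ?_
  rw [one_div]
  exact inv_le_of_inv_le₀ h3 h4

/-- `√π * (1/6) / √(2π) = 1/(6√2)`, and `1.4138 ≤ √2` makes this at most `0.1179`. -/
theorem lam_mul_le {lam : ℝ} (h0 : 0 ≤ lam) (h : lam ≤ √π) {x y : ℝ}
    (hxy : √(2 * π) * x ≤ y) (hy : y < 1 / 6) : lam * x ≤ 0.1179 := by
  have h2 : (0 : ℝ) < √2 := by positivity
  have h3 : 0 < √π := Real.sqrt_pos.2 Real.pi_pos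
  have hs : √2 ^ 2 = 2 := Real.sq_sqrt (by norm_num)
  rw [Real.sqrt_mul (by norm_num)] at hxy
  have h5 : (1.4138 : ℝ) ≤ √2 := Real.le_sqrt_of_sq_le (by norm_num)
  rcases le_total x 0 with hx | hx
  · nlinarith
  · have h6 : lam * x ≤ √π * x := mul_le_mul_of_nonneg_right h hx
    have h7 : √2 * (√π * x) ≤ 1 / 6 := by rw [← mul_assoc]; linarith
    have h8 : 1.4138 * (√π * x) ≤ √2 * (√π * x) :=
      mul_le_mul_of_nonneg_right h5 (by positivity)
    linarith

theorem norm_inv_le : ‖Seq.inv‖ ≤ 2 := by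
  have h := Seq.norm_inv_sq
  have : π < 3.15 := Real.pi_lt_d2
  nlinarith [norm_nonneg Seq.inv, Real.pi_pos]

end

end VdW

theorem theorem3 (lam : ℝ) (hlam : lam ∈ Set.Ioc 0 (1 / (VdW.embeddingNorm (2 * π) * √2))) :
    ∃ T > (0 : ℝ), ∃ C : ℝ, ∃ ε₀ > (0 : ℝ), ∀ ε ∈ Set.Ioo 0 ε₀,
      ∀ (L : ℝ) [Fact (0 < L)], (∃ n : ℕ, L = n * (2 * π * ε ^ 2)) →
      ∀ u₀ : VdW.H1 (2 * π) × VdW.L2 (2 * π),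
        (∫ x, VdW.toL2 u₀.1 x) = 0 → (∫ x, u₀.2 x) = 0 →
        max ‖u₀.1‖ ‖u₀.2‖ < 1 / 6 → VdW.energy u₀ ≤ 0 →
        ∃ u : ℝ → VdW.H1 L × VdW.L2 L,
          (VdW.IsSolution ε T u ∧
            VdW.IsRescaled lam ε (VdW.toL2 (u 0).1) (VdW.toL2 u₀.1) ∧ VdW.IsRescaled lam ε (u 0).2 u₀.2) ∧
          (∀ v : ℝ → VdW.H1 L × VdW.L2 L, VdW.IsSolution ε T v →
            VdW.IsRescaled lam ε (VdW.toL2 (v 0).1) (VdW.toL2 u₀.1) →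
            VdW.IsRescaled lam ε (v 0).2 u₀.2 → Set.EqOn v u (Set.Icc 0 T)) ∧
          ∀ t ∈ Set.Icc 0 T, (∀ᵐ x, ‖VdW.toL2 (u t).1 x‖ ≤ C) ∧ ‖(u t).2‖ ≤ C * √L := by
  open VdW in
  have hg := Seq.growth_pos
  have hlam0 := hlam.1
  have hlamπ := le_sqrt_pi hlam
  -- `T` is the time in which the normal-form variable may grow by `1/10000`.
  refine ⟨1 / (10000 * Seq.growth), by positivity, 1, 1 / 10000, by norm_num, ?_⟩
  rintro ε ⟨hε, hε1⟩ L hL ⟨m, hm⟩ u₀ hm1 hm2 hmax -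
  set T := 1 / (10000 * Seq.growth) with hT
  have hT0 : 0 ≤ T := by positivity
  set n : ℤ := (m : ℤ) with hn
  have hm0 : m ≠ 0 := by
    rintro rfl
    rw [Nat.cast_zero, zero_mul] at hm
    exact hL.out.ne' hm
  have hn0 : n ≠ 0 := Int.natCast_ne_zero.2 hm0
  have hnR : (n : ℝ) = m := by rw [hn, Int.cast_natCast]
  have hnR0 : (n : ℝ) ≠ 0 := by exact_mod_cast hn0
  have hscale : L / ε ^ 2 = n * (2 * π) := by
    rw [hnR, hm]
    field_simp
  have hfreq : (ε ^ 2)⁻¹ / n = freq L := by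
    have hLe : L = ε ^ 2 * (n * (2 * π)) := by
      rw [← hscale]; field_simp
    rw [freq, hLe]
    have := Real.pi_pos
    field_simp
  have hfreq1 : freq (2 * π) = 1 := div_self (by positivity)
  set γ₀ : Seq := (lam : ℂ) • slope u₀.1 with hγ₀
  set w₀ : Seq := (lam : ℂ) • coeff (star u₀.2) with hw₀
  have hc1 : coeff (toL2 u₀.1) 0 = 0 := coeff_zero hm1
  have hc2 : coeff u₀.2 0 = 0 := coeff_zero hm2
  have hγ₀0 : γ₀ 0 = 0 := by rw [hγ₀, Seq.smul_apply, slope_apply]; simp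
  have hw₀0 : w₀ 0 = 0 := by rw [hw₀, Seq.smul_apply, coeff_star]; simp [hc2]
  have hlamn : ‖(lam : ℂ)‖ = lam := by rw [Complex.norm_real, Real.norm_of_nonneg hlam0.le]
  have hγ₀n : ‖γ₀‖ ≤ 0.1179 := by
    rw [hγ₀, norm_smul, hlamn]
    have := norm_slope_le u₀.1
    rw [hfreq1, one_mul] at this
    exact lam_mul_le hlam0.le hlamπ this ((le_max_left _ _).trans_lt hmax)
  have hw₀n : ‖w₀‖ ≤ 0.1179 := by
    rw [hw₀, norm_smul, hlamn]
    have h1 : √(2 * π) * ‖coeff (star u₀.2)‖ ≤ ‖u₀.2‖ := by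
      rw [← norm_synth, synth_coeff, norm_star_L2]
    exact lam_mul_le hlam0.le hlamπ h1 ((le_max_right _ _).trans_lt hmax)
  obtain ⟨γ, w, H, hγ0, hw0, hb⟩ := Seq.exists_modal hε hε1.le hT0
    (by rw [hT]; field_simp; exact le_rfl) hγ₀0 hw₀0 hγ₀n hw₀n
  have Hd := H.dilate hn0
  rw [hfreq] at Hd
  set Γ : ℝ → Seq := fun t => (n : ℂ) • Seq.dilate n (γ t) with hΓ
  set W : ℝ → Seq := fun t => Seq.dilate n (w t) with hW
  have hu1 : IsRescaled lam ε (toL2 (mkH1 (L := L) (Γ 0))) (toL2 u₀.1) := by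
    rw [isRescaled_iff hε hn0 hscale, toL2_mkH1, coeff_synth, hΓ]
    simp only
    rw [Seq.anti_dilate hn0, hγ0, hγ₀, map_smul, map_smul, anti_slope hc1]
  have hu2 : IsRescaled lam ε (star (synth (L := L) (W 0))) u₀.2 := by
    rw [isRescaled_iff hε hn0 hscale]
    have e : coeff (synth (L := L) (W 0)) = (lam : ℂ) • Seq.dilate n (coeff (star u₀.2)) := by
      rw [coeff_synth, hW]
      simp only
      rw [hw0, hw₀, map_smul]
    rw [coeff_star_dilate e, star_star]
  refine ⟨fun t => (mkH1 (Γ t), star (synth (W t))), ⟨Hd.isSolution hT0, hu1, hu2⟩,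
    fun v hv hv1 hv2 t ht => ?_, fun t ht => ⟨?_, ?_⟩⟩
  · rw [isRescaled_iff hε hn0 hscale] at hu1 hu2 hv1 hv2
    have i1 : (v 0).1 = mkH1 (Γ 0) := H1_ext (coeff_injective (hv1.trans hu1.symm))
    have i2 : (v 0).2 = star (synth (W 0)) := coeff_injective (hv2.trans hu2.symm)
    obtain ⟨hz, Hv⟩ := hv.modal (by rw [i1, coeff_toL2_mkH1_zero])
      (by rw [hv2, Seq.smul_apply, Seq.dilate_apply_zero, hc2, mul_zero])
    obtain ⟨j1, j2⟩ := Hv.eqOn Hd hε freq_pos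
      (by rw [i1, slope_mkH1 (Hd.zero_fst 0 (left_mem_Icc.2 hT0))])
      (by rw [i2, star_star, coeff_synth]) t ht
    refine Prod.ext ?_ ?_
    · simp only
      rw [← j1, mkH1_slope (hz t ht)]
    · simp only
      rw [← j2, synth_coeff, star_star]
  · filter_upwards [coeFn_mkH1 (L := L) (Γ t)] with x hx
    rw [hx]
    refine (norm_wave_apply_le _ _).trans ?_
    simp only [hΓ]
    -- Dilation permutes frequencies without changing the `ℓ¹` norm, so the sup bound does not
    -- depend on `n`, hence not on `L`.
    rw [Seq.anti_dilate hn0, Seq.tsum_norm_dilate hn0]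
    refine (Seq.tsum_anti_le _).trans ?_
    calc ‖Seq.inv‖ * ‖γ t‖ ≤ 2 * (1 / 4) :=
          mul_le_mul norm_inv_le (hb t ht).1 (norm_nonneg _) (by norm_num)
      _ ≤ 1 := by norm_num
  · simp only [hW]
    rw [norm_star_L2, norm_synth, mul_comm]
    have := (Seq.norm_dilate_le (n := n) (w t)).trans (hb t ht).2
    exact mul_le_mul_of_nonneg_right (this.trans (by norm_num)) (Real.sqrt_nonneg _)
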